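/- Let $(M,g_M)$ be a Riemannian manifold and $(N,g_N,P)$ a Kähler manifold, both smooth, finite-dimensional and without boundary: $P$ is a smooth $(1,1)$-tensor field on $N$ with $P^2=-I$, $g_N(P\cdot,P\cdot)=g_N$ and $\nabla^N P=0$, where $\nabla^M,\nabla^N$ denote the Levi-Civita connections. Let $F:M\to N$ be a smooth map with the following properties. (a) $F$ is a Riemannian map: $g_N(F_*X,F_*Y)=g_M(X,Y)$ for all $X,Y\in(\ker F_*)^\perp$. (b) $F$ is semi-invariant: there are smooth subbundles $D_1,D_2$ of $\operatorname{range}F_*$ (subbundles of $F^{-1}TN$ over $M$) with $\operatorname{range}F_*=D_1\oplus D_2$, $P(D_1)=D_1$ and $P(D_2)\subseteq(\operatorname{range}F_*)^\perp$. (c) $F$ is Clairaut with $s=e^f$, for a smooth function $f:N\to\mathbb R$, and $(\operatorname{range}F_*)^\perp$ is totally geodesic. Here $\operatorname{range}F_*$ and $(\operatorname{range}F_*)^\perp$ are regarded locally as complementary distributions on $N$; that is, every $q\in M$ has an open neighbourhood $U$ for which there are an open set $O\supseteq F(U)$ of $N$ and a smooth distribution $R$ on $O$ such that $R_{F(x)}=F_*(T_xM)$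 for $x\in U$; $\nabla^N_VW$ is a section of $R^\perp$ for all smooth sections $V,W$ of $R^\perp$ over $O$; and, for every geodesic $\beta$ of $N$ lying in $O$, the function $(s\circ\beta)\sin\theta$ is constant, where $\theta(t)$ is the angle between $\dot\beta(t)$ and its component $V(t)$ in $R^\perp$ ($\theta(t)=\pi/2$ if $V(t)=0$). Assume $\dim D_2>1$. For $i=1,2$ let $\bar D_i$ be the distribution on $M$ of the vectors $X\in(\ker F_*)^\perp$ with $F_*X\in D_i$. Let $(\nabla F_*)(X,Y)=\nabla^{F}_XF_*Y-F_*(\nabla^M_XY)$ be the second fundamental form of $F$, where $\nabla^{F}$ is the pullback of $\nabla^N$ along $F$. Call a smooth distribution $D$ on $M$ a totally geodesic foliation if $[X,Y]$ and $\nabla^M_XY$ are sections of $D$ for all smooth sections $X,Y$ of $D$, and say that $(\ker F_*)^\perp$ is locally a product of $\bar D_1$ and $\bar D_2$ if $(\ker F_*)^\perp=\bar D_1\oplus\bar D_2$ and both $\bar D_1$ and $\bar D_2$ define totally geodesic foliations of $M$. Then $(\ker F_*)^\perp$ is locally a product of $\bar D_1$ and $\bar D_2$ if and only if (i) $(\nabla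 F_*)(X,U)$ has no component in $D_1$ (i.e. is orthogonal to $D_1$) for all $X\in\Gamma(\bar D_1)$ and $U\in\Gamma(\ker F_*)$, and (ii) $(\nabla F_*)(X_2,U)$ has no component in $D_2$ (i.e. is orthogonal to $D_2$) for all $X_2\in\Gamma(\bar D_2)$ and $U\in\Gamma(\ker F_*)$. -/

import Mathlib

open Set Bundle Manifold
open scoped ContDiff Topology

noncomputable section

/-! ### The Levi-Civita connection, along smooth maps

`N` is a smooth manifold without boundary modelled on a finite-dimensional real vector space `E`,
with a smooth Riemannian metric on its tangent bundle. `A` is a second manifold, the source of maps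
into `N`; below it is `ℝ` (curves in `N`), `N` itself (vector fields on `N`), or the source of a
Riemannian map. -/

section Connection

variable {EA : Type*} [NormedAddCommGroup EA] [NormedSpace ℝ EA]
  {A : Type*} [TopologicalSpace A] [ChartedSpace EA A]
  {E : Type*} [NormedAddCommGroup E] [NormedSpace ℝ E]
  {N : Type*} [TopologicalSpace N] [ChartedSpace E N] [IsManifold 𝓘(ℝ, E) ∞ N]
  [RiemannianBundle (fun y : N => TangentSpace 𝓘(ℝ, E) y)]

/-- The matrix `(g_ij)` of the metric in the chart at `p`, as a function of the point `y` of the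
model space with values in the bilinear forms on `E`. -/
def chartMetric (p : N) (y : E) : E →L[ℝ] E →L[ℝ] ℝ :=
  let x : N := (extChartAt 𝓘(ℝ, E) p).symm y
  let e : E →L[ℝ] TangentSpace 𝓘(ℝ, E) x :=
    (trivializationAt E (TangentSpace 𝓘(ℝ, E)) p).symmL ℝ x
  (innerSL ℝ (E := TangentSpace 𝓘(ℝ, E) x)).bilinearComp e e

set_option synthInstance.maxHeartbeats 200000 in
/-- `chartMetricDeriv p u v w` is the derivative at `p`, in the direction `u`, of `g (v, w)`, in the
chart at `p`. -/
def chartMetricDeriv (p : N) : E →L[ℝ] E →L[ℝ] E →L[ℝ] ℝ :=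
  fderiv ℝ (chartMetric p) (extChartAt 𝓘(ℝ, E) p p)

/-- The linear form `z ↦ (∂_u g (v, z) + ∂_v g (u, z) - ∂_z g (u, v)) / 2` on `T_p N`: the Christoffel
symbol of the first kind at `p`, in the chart at `p`. -/
def christoffelForm (p : N) (u v : E) : TangentSpace 𝓘(ℝ, E) p →L[ℝ] ℝ :=
  ((1 / 2 : ℝ) • (chartMetricDeriv p u v + chartMetricDeriv p v u
      - ((chartMetricDeriv p).flip u).flip v)).comp
    ((trivializationAt E (TangentSpace 𝓘(ℝ, E)) p).continuousLinearMapAt ℝ p)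

variable [FiniteDimensional ℝ E]

/-- The Christoffel symbol `Γ_p (u, v)` (of the second kind) of the Levi-Civita connection at `p`, in
the chart at `p`: the tangent vector that represents `christoffelForm p u v`. -/
def christoffel (p : N) (u v : E) : TangentSpace 𝓘(ℝ, E) p :=
  haveI : FiniteDimensional ℝ (TangentSpace 𝓘(ℝ, E) p) := inferInstanceAs (FiniteDimensional ℝ E)
  haveI : CompleteSpace (TangentSpace 𝓘(ℝ, E) p) := FiniteDimensional.complete ℝ _
  (InnerProductSpace.toDual ℝ (TangentSpace 𝓘(ℝ, E) p)).symm (christoffelForm p u v)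

/-- The Levi-Civita connection of `N` pulled back along `h : A → N`: the covariant derivative at `a`,
in the direction `v ∈ T_a A`, of a vector field `W` along `h`. In the chart at `h a` it is
`∂_v W + Γ (dh v, W)`. -/
def covDerivAlong (h : A → N) (W : ∀ a, TangentSpace 𝓘(ℝ, E) (h a)) (a : A)
    (v : TangentSpace 𝓘(ℝ, EA) a) : TangentSpace 𝓘(ℝ, E) (h a) :=
  let e := trivializationAt E (TangentSpace 𝓘(ℝ, E)) (h a)
  let w : A → E := fun b => (e (⟨h b, W b⟩ : TangentBundle 𝓘(ℝ, E) N)).2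
  e.symmL ℝ (h a) (mfderiv 𝓘(ℝ, EA) 𝓘(ℝ, E) w a v)
    + christoffel (h a)
        (e.continuousLinearMapAt ℝ (h a) (mfderiv 𝓘(ℝ, EA) 𝓘(ℝ, E) h a v)) (w a)

/-- `(∇_X Y)(y)`, for the Levi-Civita connection `∇` of `N` and vector fields `X`, `Y` on `N`. -/
def leviCivita (X Y : ∀ y : N, TangentSpace 𝓘(ℝ, E) y) (y : N) : TangentSpace 𝓘(ℝ, E) y :=
  covDerivAlong (EA := E) (A := N) (fun z => z) Y y (X y)

/-- The velocity of a curve. -/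
def velocity (β : ℝ → N) (t : ℝ) : TangentSpace 𝓘(ℝ, E) (β t) :=
  mfderiv 𝓘(ℝ, ℝ) 𝓘(ℝ, E) β t (1 : ℝ)

/-- `β` is a geodesic of `N` on the open interval `(a, b)`: a `C^2` curve with `∇_{β'} β' = 0`. -/
def IsGeodesicOn (β : ℝ → N) (a b : ℝ) : Prop :=
  ContMDiffOn 𝓘(ℝ, ℝ) 𝓘(ℝ, E) 2 β (Ioo a b) ∧
    ∀ t ∈ Ioo a b, covDerivAlong (EA := ℝ) (E := E) β (velocity β) t (1 : ℝ) = 0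

end Connection

/-! ### Subbundles, foliations -/

section Distributions

variable {EA : Type*} [NormedAddCommGroup EA] [NormedSpace ℝ EA]
  {A : Type*} [TopologicalSpace A] [ChartedSpace EA A]
  {E : Type*} [NormedAddCommGroup E] [NormedSpace ℝ E]
  {N : Type*} [TopologicalSpace N] [ChartedSpace E N] [IsManifold 𝓘(ℝ, E) ∞ N]

/-- `W` is a smooth vector field along `h`, on the set `S`. -/
def IsSmoothAlong (h : A → N) (W : ∀ a, TangentSpace 𝓘(ℝ, E) (h a)) (S : Set A) : Prop :=
  ContMDiffOn 𝓘(ℝ, EA) 𝓘(ℝ, E).tangent ∞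
    (fun a => (⟨h a, W a⟩ : TangentBundle 𝓘(ℝ, E) N)) S

/-- `D` is a smooth subbundle, over the open set `S`, of the pullback bundle `h⁻¹ TN`: it has smooth
local frames. -/
def IsSubbundleAlong (h : A → N) (D : ∀ a, Submodule ℝ (TangentSpace 𝓘(ℝ, E) (h a)))
    (S : Set A) : Prop :=
  ∀ a ∈ S, ∃ V : Set A, IsOpen V ∧ a ∈ V ∧ ∃ (k : ℕ)
    (s : Fin k → ∀ b, TangentSpace 𝓘(ℝ, E) (h b)),
      (∀ i, IsSmoothAlong (EA := EA) h (s i) V) ∧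
      ∀ b ∈ V, LinearIndependent ℝ (fun i => s i b) ∧
        Submodule.span ℝ (range fun i => s i b) = D b

/-- `X` is a smooth section, over the open set `S`, of the distribution `D` on `N`. -/
def IsSectionOn (D : ∀ y : N, Submodule ℝ (TangentSpace 𝓘(ℝ, E) y)) (S : Set N)
    (X : ∀ y : N, TangentSpace 𝓘(ℝ, E) y) : Prop :=
  IsSmoothAlong (EA := E) (A := N) (fun y => y) X S ∧ ∀ y ∈ S, X y ∈ D y

variable [RiemannianBundle (fun y : N => TangentSpace 𝓘(ℝ, E) y)] [FiniteDimensional ℝ E]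

/-- The distribution `D` is totally geodesic on the open set `S`: `∇_X Y` is tangent to `D` for all
sections `X`, `Y` of `D`. -/
def IsTotallyGeodesicOn (D : ∀ y : N, Submodule ℝ (TangentSpace 𝓘(ℝ, E) y)) (S : Set N) : Prop :=
  ∀ X Y, IsSectionOn D S X → IsSectionOn D S Y → ∀ y ∈ S, leviCivita X Y y ∈ D y

/-- `D` defines a totally geodesic foliation of `N`: it is a smooth distribution, it is integrable
(closed under Lie brackets), and the second fundamental form of its leaves vanishes. -/
structure IsTotallyGeodesicFoliation (D : ∀ y : N, Submodule ℝ (TangentSpace 𝓘(ℝ, E) y)) :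
    Prop where
  subbundle : IsSubbundleAlong (EA := E) (A := N) (fun y => y) D univ
  involutive : ∀ X Y, IsSectionOn D univ X → IsSectionOn D univ Y →
    ∀ y, VectorField.mlieBracket 𝓘(ℝ, E) X Y y ∈ D y
  totallyGeodesic : IsTotallyGeodesicOn D univ

/-- The distribution `D` is locally a product of the distributions `L₁` and `L₂`: it is their direct
sum, and both define totally geodesic foliations. -/
structure IsLocallyProductOf (D L₁ L₂ : ∀ y : N, Submodule ℝ (TangentSpace 𝓘(ℝ, E) y)) : Prop where
  inf_eq_bot : ∀ y, L₁ y ⊓ L₂ y = ⊥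
  sup_eq : ∀ y, L₁ y ⊔ L₂ y = D y
  foliation₁ : IsTotallyGeodesicFoliation L₁
  foliation₂ : IsTotallyGeodesicFoliation L₂

/-- `(N, g, P)` is a Kähler manifold: `P` is a smooth field of endomorphisms of the tangent spaces
with `P² = -1`, `g (P v, P w) = g (v, w)` and `∇P = 0`. -/
structure IsKahler (P : ∀ y : N, TangentSpace 𝓘(ℝ, E) y →L[ℝ] TangentSpace 𝓘(ℝ, E) y) : Prop where
  smooth : ContMDiff 𝓘(ℝ, E) (𝓘(ℝ, E).prod 𝓘(ℝ, E →L[ℝ] E)) ∞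
    (fun y => TotalSpace.mk' (E →L[ℝ] E)
      (E := fun y : N => TangentSpace 𝓘(ℝ, E) y →L[ℝ] TangentSpace 𝓘(ℝ, E) y) y (P y))
  sq : ∀ (y : N) (v : TangentSpace 𝓘(ℝ, E) y), P y (P y v) = -v
  isometry : ∀ (y : N) (v w : TangentSpace 𝓘(ℝ, E) y), inner ℝ (P y v) (P y w) = inner ℝ v w
  parallel : ∀ X Y : ∀ y : N, TangentSpace 𝓘(ℝ, E) y,
    IsSmoothAlong (EA := E) (A := N) (fun y => y) X univ →
    IsSmoothAlong (EA := E) (A := N) (fun y => y) Y univ →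
    ∀ y, leviCivita X (fun z => P z (Y z)) y = P y (leviCivita X Y y)

end Distributions

/-! ### Riemannian maps -/

section Maps

variable {EM : Type*} [NormedAddCommGroup EM] [NormedSpace ℝ EM] [FiniteDimensional ℝ EM]
  {M : Type*} [TopologicalSpace M] [ChartedSpace EM M] [IsManifold 𝓘(ℝ, EM) ∞ M]
  [RiemannianBundle (fun x : M => TangentSpace 𝓘(ℝ, EM) x)]
  {EN : Type*} [NormedAddCommGroup EN] [NormedSpace ℝ EN] [FiniteDimensional ℝ EN]
  {N : Type*} [TopologicalSpace N] [ChartedSpace EN N] [IsManifold 𝓘(ℝ, EN) ∞ N]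
  [RiemannianBundle (fun y : N => TangentSpace 𝓘(ℝ, EN) y)]

/-- The differential `F_*` at `q`. -/
def pushforward (F : M → N) (q : M) :
    TangentSpace 𝓘(ℝ, EM) q →ₗ[ℝ] TangentSpace 𝓘(ℝ, EN) (F q) :=
  (mfderiv 𝓘(ℝ, EM) 𝓘(ℝ, EN) F q).toLinearMap

/-- `ker F_*`. -/
def vertical (F : M → N) (q : M) : Submodule ℝ (TangentSpace 𝓘(ℝ, EM) q) :=
  LinearMap.ker (pushforward (EM := EM) (EN := EN) F q)

/-- `(ker F_*)^⊥`. -/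
def horizontal (F : M → N) (q : M) : Submodule ℝ (TangentSpace 𝓘(ℝ, EM) q) :=
  (vertical (EM := EM) (EN := EN) F q)ᗮ

/-- `range F_*`, at `q`. -/
def rangeBundle (F : M → N) (q : M) : Submodule ℝ (TangentSpace 𝓘(ℝ, EN) (F q)) :=
  LinearMap.range (pushforward (EM := EM) (EN := EN) F q)

/-- For `D ⊆ range F_*`, the distribution `D̄` of the horizontal vectors `X` with `F_* X ∈ D`. -/
def horizontalLift (F : M → N) (D : ∀ q : M, Submodule ℝ (TangentSpace 𝓘(ℝ, EN) (F q))) (q : M) :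
    Submodule ℝ (TangentSpace 𝓘(ℝ, EM) q) :=
  horizontal (EM := EM) (EN := EN) F q ⊓ (D q).comap (pushforward (EM := EM) (EN := EN) F q)

/-- The second fundamental form `(∇F_*)(X, Y) = ∇^F_X (F_* Y) - F_* (∇_X Y)` of `F`. -/
def secondFundamentalForm (F : M → N) (X Y : ∀ q : M, TangentSpace 𝓘(ℝ, EM) q) (q : M) :
    TangentSpace 𝓘(ℝ, EN) (F q) :=
  covDerivAlong (EA := EM) (E := EN) F (fun x => pushforward F x (Y x)) q (X q)
    - pushforward F q (leviCivita X Y q)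

/-- `F` is a Riemannian map: it is smooth, and `F_*` is isometric on horizontal vectors. -/
structure IsRiemannianMap (F : M → N) : Prop where
  smooth : ContMDiff 𝓘(ℝ, EM) 𝓘(ℝ, EN) ∞ F
  isometry : ∀ (q : M), ∀ v ∈ horizontal (EM := EM) (EN := EN) F q,
    ∀ w ∈ horizontal (EM := EM) (EN := EN) F q,
      inner ℝ (pushforward (EM := EM) (EN := EN) F q v) (pushforward F q w) = inner ℝ v w

/-- `F` is a semi-invariant Riemannian map into `(N, g, P)`, with the subbundles `D₁` and `D₂`:
`range F_* = D₁ ⊕ D₂`, `P D₁ = D₁` and `P D₂ ⊆ (range F_*)^⊥`. -/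
structure IsSemiInvariantRiemannianMap (F : M → N)
    (P : ∀ y : N, TangentSpace 𝓘(ℝ, EN) y →L[ℝ] TangentSpace 𝓘(ℝ, EN) y)
    (D₁ D₂ : ∀ q : M, Submodule ℝ (TangentSpace 𝓘(ℝ, EN) (F q))) : Prop where
  riemannianMap : IsRiemannianMap (EM := EM) (EN := EN) F
  subbundle₁ : IsSubbundleAlong (EA := EM) F D₁ univ
  subbundle₂ : IsSubbundleAlong (EA := EM) F D₂ univ
  inf_eq_bot : ∀ q, D₁ q ⊓ D₂ q = ⊥
  sup_eq : ∀ q, D₁ q ⊔ D₂ q = rangeBundle (EM := EM) F q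
  invariant : ∀ q, (D₁ q).map (P (F q)).toLinearMap = D₁ q
  antiInvariant : ∀ q, (D₂ q).map (P (F q)).toLinearMap ≤ (rangeBundle (EM := EM) F q)ᗮ

/-- The Clairaut condition for the distribution `R` on the open set `O ⊆ N` and the function `s`:
along each geodesic `β` of `N` that runs in `O`, the function `(s ∘ β) sin θ` is constant, where
`θ t` is the angle between `β' t` and `V t`, and `X t ∈ R`, `V t ∈ R^⊥` are the components of `β' t`.
(The angle with a zero vector is `π / 2`, so that `sin θ = 1` where `V t = 0`.) -/
def ClairautCondition (R : ∀ y : N, Submodule ℝ (TangentSpace 𝓘(ℝ, EN) y)) (O : Set N)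
    (s : N → ℝ) : Prop :=
  ∀ (a b : ℝ) (β : ℝ → N), IsGeodesicOn (E := EN) β a b → MapsTo β (Ioo a b) O →
    ∀ X V : ∀ t, TangentSpace 𝓘(ℝ, EN) (β t),
      (∀ t ∈ Ioo a b, X t ∈ R (β t) ∧ V t ∈ (R (β t))ᗮ ∧ velocity β t = X t + V t) →
      ∀ t₁ ∈ Ioo a b, ∀ t₂ ∈ Ioo a b,
        s (β t₁) * Real.sin (InnerProductGeometry.angle (velocity β t₁) (V t₁))
          = s (β t₂) * Real.sin (InnerProductGeometry.angle (velocity β t₂) (V t₂))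

/-- `F` is a Clairaut Riemannian map with the positive function `s`, and with totally geodesic
`(range F_*)^⊥`. Here `range F_*` and `(range F_*)^⊥` are regarded, locally, as complementary
distributions on `N`: around each `q` there is a smooth distribution `R` on an open set of `N` that
agrees with `range F_*` along `F`. -/
structure IsClairautRiemannianMap (F : M → N) (s : N → ℝ) : Prop where
  riemannianMap : IsRiemannianMap (EM := EM) (EN := EN) F
  pos : ∀ y, 0 < s y
  clairaut : ∀ q : M, ∃ (U : Set M) (O : Set N)
    (R : ∀ y : N, Submodule ℝ (TangentSpace 𝓘(ℝ, EN) y)),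
      IsOpen U ∧ q ∈ U ∧ IsOpen O ∧ MapsTo F U O ∧
      IsSubbundleAlong (EA := EN) (A := N) (fun y => y) R O ∧
      (∀ x ∈ U, R (F x) = rangeBundle (EM := EM) F x) ∧
      IsTotallyGeodesicOn (fun y => (R y)ᗮ) O ∧
      ClairautCondition R O s

/-- `F` is a Clairaut semi-invariant Riemannian map into `(N, g, P)`, with the subbundles `D₁`, `D₂`
of `range F_*` and the positive function `s`. -/
structure IsClairautSemiInvariantRiemannianMap (F : M → N)
    (P : ∀ y : N, TangentSpace 𝓘(ℝ, EN) y →L[ℝ] TangentSpace 𝓘(ℝ, EN) y)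
    (D₁ D₂ : ∀ q : M, Submodule ℝ (TangentSpace 𝓘(ℝ, EN) (F q))) (s : N → ℝ) : Prop where
  semiInvariant : IsSemiInvariantRiemannianMap (EM := EM) F P D₁ D₂
  clairaut : IsClairautRiemannianMap (EM := EM) (EN := EN) F s

end Maps

end

/-! The Clairaut condition forces `range F_*` to be umbilical. Let `X` be the `R`-component of the
velocity of a geodesic `β`. Clairaut's relation says that `e^{2f} |X|²` is a constant multiple of
`|β'|²`, and `|β'|` is constant, so `⟨∇X, X⟩ = -df(β') |X|²`. Start `β` with velocity `x + Z`, where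
`x ∈ R` and `Z` is a section of `R^⊥`. The identities `⟨X, β'⟩ = ⟨X, X⟩` and `⟨X, Z⟩ = 0`, together
with `∇_Z Z ∈ R^⊥`, turn this into `⟨x, ∇_x Z⟩ = df(x + Z) |x|²`. The case `Z = 0` shows that the
term in `df(x)` vanishes (`ClairautCondition.inner_covDerivAlong_field`). Along `F` the form `⟨y,
∇_x Z⟩` is symmetric because the connection is torsion-free, so polarisation gives `⟨∇_X F_*Y, v⟩ =
-⟨F_*X, F_*Y⟩ df(v)` for `v` normal to the range.

The Kähler structure then separates `D₁` from `D₂`. For orthogonal `w`, `z` in `D₂` with `z ≠ 0`,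
compute `⟨∇_z Z, P w⟩` twice: by umbilicity it is `-|z|² df(P w)`; moving `P` and the derivative
across the product gives `⟨P z, ∇_z W⟩`, which is a multiple of `⟨z, w⟩ = 0`. Hence `df` vanishes on
`P D₂`; this is where `dim D₂ > 1` enters
(`IsClairautSemiInvariantRiemannianMap.dirDeriv_apply_eq_zero`). For a section `W` of `D₁` it
follows that `⟨∇W, w⟩ = ⟨∇(P W), P w⟩ = 0`, so derivatives of sections of either subbundle are
orthogonal to the other.

For horizontal fields, `⟨∇_X Y, Z⟩ = ⟨∇^F_X F_*Y, F_*Z⟩`, so `∇_X Y` with `X`, `Y` in `D̄ᵢ` never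
has a component in the other lift. Its vertical component is given by `⟨∇_X Y, U⟩ = ⟨F_*Y, (∇F_*)(X,
U)⟩`. Thus `D̄ᵢ` is a totally geodesic foliation exactly when the `i`-th condition holds
(`IsRiemannianMap.isTotallyGeodesicFoliation_horizontalLift_iff`).

The rest is groundwork for the connection given in charts: metric compatibility, vanishing torsion,
independence of the chart, and short time existence of geodesics. -/

noncomputable section

set_option linter.unusedSectionVars false

/-! ### Directional derivatives of vector-valued functions on a manifold -/

section DirDeriv

variable {EA : Type*} [NormedAddCommGroup EA] [NormedSpace ℝ EA]
  {A : Type*} [TopologicalSpace A] [ChartedSpace EA A]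
  {V : Type*} [NormedAddCommGroup V] [NormedSpace ℝ V]
  {V' : Type*} [NormedAddCommGroup V'] [NormedSpace ℝ V']
  {V'' : Type*} [NormedAddCommGroup V''] [NormedSpace ℝ V'']

/-- The derivative at `a`, in the direction `v`, of a vector-valued function. -/
def dirDeriv (k : A → V) (a : A) (v : TangentSpace 𝓘(ℝ, EA) a) : V :=
  fderiv ℝ (k ∘ (extChartAt 𝓘(ℝ, EA) a).symm) (extChartAt 𝓘(ℝ, EA) a a) (v : EA)

theorem MDifferentiableAt.differentiableAt_chart {k : A → V} {a : A}
    (hk : MDifferentiableAt 𝓘(ℝ, EA) 𝓘(ℝ, V) k a) :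
    DifferentiableAt ℝ (k ∘ (extChartAt 𝓘(ℝ, EA) a).symm) (extChartAt 𝓘(ℝ, EA) a a) := by
  have h := hk.differentiableWithinAt_writtenInExtChartAt
  rw [ModelWithCorners.range_eq_univ, differentiableWithinAt_univ] at h
  exact h

/-- The chart of the target is the identity. The form on the right takes its values in `V` itself
instead of a tangent space depending on `k a`, so that sums and products of derivatives make sense.
-/
theorem mfderiv_apply_eq_dirDeriv {k : A → V} {a : A}
    (hk : MDifferentiableAt 𝓘(ℝ, EA) 𝓘(ℝ, V) k a) (v : TangentSpace 𝓘(ℝ, EA) a) :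
    mfderiv 𝓘(ℝ, EA) 𝓘(ℝ, V) k a v = dirDeriv (EA := EA) k a v := by
  rw [hk.mfderiv, ModelWithCorners.range_eq_univ, fderivWithin_univ]
  rfl

theorem dirDeriv_congr {k l : A → V} {a : A} (h : k =ᶠ[𝓝 a] l) (v : TangentSpace 𝓘(ℝ, EA) a) :
    dirDeriv k a v = dirDeriv l a v := by
  unfold dirDeriv
  have ht : Filter.Tendsto (extChartAt 𝓘(ℝ, EA) a).symm (𝓝 (extChartAt 𝓘(ℝ, EA) a a)) (𝓝 a) := by
    have := continuousAt_extChartAt_symm (I := 𝓘(ℝ, EA)) a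
    rwa [ContinuousAt, extChartAt_to_inv] at this
  have h' : k ∘ (extChartAt 𝓘(ℝ, EA) a).symm =ᶠ[𝓝 (extChartAt 𝓘(ℝ, EA) a a)]
      l ∘ (extChartAt 𝓘(ℝ, EA) a).symm := ht.eventually h
  rw [h'.fderiv_eq]

theorem dirDeriv_comp {k : A → V} {a : A} {G : V → V'} (hG : DifferentiableAt ℝ G (k a))
    (hk : MDifferentiableAt 𝓘(ℝ, EA) 𝓘(ℝ, V) k a) (v : TangentSpace 𝓘(ℝ, EA) a) :
    dirDeriv (fun b => G (k b)) a v = fderiv ℝ G (k a) (dirDeriv k a v) := by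
  have hka : (k ∘ (extChartAt 𝓘(ℝ, EA) a).symm) (extChartAt 𝓘(ℝ, EA) a a) = k a := by
    simp
  have h := fderiv_comp (𝕜 := ℝ) (g := G) (f := k ∘ (extChartAt 𝓘(ℝ, EA) a).symm)
    (extChartAt 𝓘(ℝ, EA) a a) (by rwa [hka]) hk.differentiableAt_chart
  rw [hka] at h
  exact congrArg (fun L => L v) h

@[simp]
theorem dirDeriv_const (c : V) (a : A) (v : TangentSpace 𝓘(ℝ, EA) a) : dirDeriv (fun _ : A => c) a v = 0 := by
  have h : fderiv ℝ ((fun _ : A => c) ∘ (extChartAt 𝓘(ℝ, EA) a).symm)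
      (extChartAt 𝓘(ℝ, EA) a a) = 0 := fderiv_const_apply (𝕜 := ℝ) c
  unfold dirDeriv
  rw [h]; rfl

theorem dirDeriv_add {k l : A → V} {a : A}
    (hk : MDifferentiableAt 𝓘(ℝ, EA) 𝓘(ℝ, V) k a)
    (hl : MDifferentiableAt 𝓘(ℝ, EA) 𝓘(ℝ, V) l a) (v : TangentSpace 𝓘(ℝ, EA) a) :
    dirDeriv (fun b => k b + l b) a v = dirDeriv k a v + dirDeriv l a v := by
  have h := fderiv_add hk.differentiableAt_chart hl.differentiableAt_chart
  exact congrArg (fun L => L v) h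

theorem dirDeriv_bilin (B : V →L[ℝ] V' →L[ℝ] V'') {k : A → V} {l : A → V'} {a : A}
    (hk : MDifferentiableAt 𝓘(ℝ, EA) 𝓘(ℝ, V) k a)
    (hl : MDifferentiableAt 𝓘(ℝ, EA) 𝓘(ℝ, V') l a) (v : TangentSpace 𝓘(ℝ, EA) a) :
    dirDeriv (fun b => B (k b) (l b)) a v
      = B (dirDeriv k a v) (l a) + B (k a) (dirDeriv l a v) := by
  have h := B.fderiv_of_bilinear hk.differentiableAt_chart hl.differentiableAt_chart
  have h' := congrArg (fun L => L v) h
  simp only [ContinuousLinearMap.precompR_apply,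
    Function.comp_apply, extChartAt_to_inv] at h'
  rw [add_comm]
  exact h'

theorem dirDeriv_smul {c : A → ℝ} {k : A → V} {a : A}
    (hc : MDifferentiableAt 𝓘(ℝ, EA) 𝓘(ℝ, ℝ) c a)
    (hk : MDifferentiableAt 𝓘(ℝ, EA) 𝓘(ℝ, V) k a) (v : TangentSpace 𝓘(ℝ, EA) a) :
    dirDeriv (fun b => c b • k b) a v = dirDeriv c a v • k a + c a • dirDeriv k a v :=
  dirDeriv_bilin (ContinuousLinearMap.lsmul ℝ ℝ) hc hk v

theorem dirDeriv_add_right (k : A → V) (a : A) (v w : TangentSpace 𝓘(ℝ, EA) a) :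
    dirDeriv k a (v + w) = dirDeriv k a v + dirDeriv k a w := map_add _ _ _

end DirDeriv

/-! ### Tangent vectors in a chart -/

section Model

variable {EA : Type*} [NormedAddCommGroup EA] [NormedSpace ℝ EA]
  {A : Type*} [TopologicalSpace A] [ChartedSpace EA A]
  {E : Type*} [NormedAddCommGroup E] [NormedSpace ℝ E]
  {N : Type*} [TopologicalSpace N] [ChartedSpace E N] [IsManifold 𝓘(ℝ, E) ∞ N]

/-- The coordinates, in the chart at `p`, of tangent vectors at `x`. -/
def toModel (p x : N) : TangentSpace 𝓘(ℝ, E) x →L[ℝ] E :=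
  (trivializationAt E (TangentSpace 𝓘(ℝ, E)) p).continuousLinearMapAt ℝ x

/-- The tangent vector at `x` with the given coordinates in the chart at `p`. -/
def ofModel (p x : N) : E →L[ℝ] TangentSpace 𝓘(ℝ, E) x :=
  (trivializationAt E (TangentSpace 𝓘(ℝ, E)) p).symmL ℝ x

theorem ofModel_toModel {p x : N} (hx : x ∈ (chartAt E p).source) (v : TangentSpace 𝓘(ℝ, E) x) :
    ofModel p x (toModel p x v) = v :=
  (trivializationAt E (TangentSpace 𝓘(ℝ, E)) p).symmL_continuousLinearMapAt hx v

theorem toModel_ofModel {p x : N} (hx : x ∈ (chartAt E p).source) (u : E) :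
    toModel p x (ofModel p x u) = u :=
  (trivializationAt E (TangentSpace 𝓘(ℝ, E)) p).continuousLinearMapAt_symmL hx u

/-- The coordinates, in the chart at `p`, of a vector field `W` along `h`. -/
def rep (p : N) (h : A → N) (W : ∀ a, TangentSpace 𝓘(ℝ, E) (h a)) (b : A) : E :=
  (trivializationAt E (TangentSpace 𝓘(ℝ, E)) p (⟨h b, W b⟩ : TangentBundle 𝓘(ℝ, E) N)).2

theorem rep_eq {p : N} {h : A → N} {W : ∀ a, TangentSpace 𝓘(ℝ, E) (h a)} {b : A}
    (hb : h b ∈ (chartAt E p).source) : rep p h W b = toModel p (h b) (W b) :=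
  ((trivializationAt E (TangentSpace 𝓘(ℝ, E)) p).continuousLinearMapAt_apply_of_mem
    (R := ℝ) hb (W b)).symm

/-- `W` is a vector field along `h` that is differentiable at `a`. -/
def DiffAlongAt (h : A → N) (W : ∀ a, TangentSpace 𝓘(ℝ, E) (h a)) (a : A) : Prop :=
  MDifferentiableAt 𝓘(ℝ, EA) 𝓘(ℝ, E).tangent
    (fun b => (⟨h b, W b⟩ : TangentBundle 𝓘(ℝ, E) N)) a

/-- `W` is a vector field along `h` that is `C^n` at `a`. -/
def ContDiffAlongAt (n : WithTop ℕ∞) (h : A → N) (W : ∀ a, TangentSpace 𝓘(ℝ, E) (h a)) (a : A) :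
    Prop :=
  ContMDiffAt 𝓘(ℝ, EA) 𝓘(ℝ, E).tangent n
    (fun b => (⟨h b, W b⟩ : TangentBundle 𝓘(ℝ, E) N)) a

variable {p : N} {h : A → N} {W Z : ∀ a, TangentSpace 𝓘(ℝ, E) (h a)} {a : A}

theorem diffAlongAt_iff (ha : h a ∈ (chartAt E p).source) :
    DiffAlongAt (EA := EA) h W a ↔ MDifferentiableAt 𝓘(ℝ, EA) 𝓘(ℝ, E) h a ∧
      MDifferentiableAt 𝓘(ℝ, EA) 𝓘(ℝ, E) (rep p h W) a :=
  (trivializationAt E (TangentSpace 𝓘(ℝ, E)) p).mdifferentiableAt_totalSpace_iff 𝓘(ℝ, E)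
    (fun b => (⟨h b, W b⟩ : TangentBundle 𝓘(ℝ, E) N))
    ((trivializationAt E (TangentSpace 𝓘(ℝ, E)) p).mem_source.2 ha)

theorem contDiffAlongAt_iff {n : WithTop ℕ∞} [ContMDiffVectorBundle n E (TangentSpace 𝓘(ℝ, E) : N → Type _) 𝓘(ℝ, E)]
    (ha : h a ∈ (chartAt E p).source) :
    ContDiffAlongAt (EA := EA) n h W a ↔ ContMDiffAt 𝓘(ℝ, EA) 𝓘(ℝ, E) n h a ∧
      ContMDiffAt 𝓘(ℝ, EA) 𝓘(ℝ, E) n (rep p h W) a :=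
  (trivializationAt E (TangentSpace 𝓘(ℝ, E)) p).contMDiffAt_iff
    (f := fun b => (⟨h b, W b⟩ : TangentBundle 𝓘(ℝ, E) N))
    ((trivializationAt E (TangentSpace 𝓘(ℝ, E)) p).mem_source.2 ha)

theorem ContDiffAlongAt.diffAlongAt {n : WithTop ℕ∞} (hW : ContDiffAlongAt (EA := EA) n h W a)
    (hn : n ≠ 0) : DiffAlongAt (EA := EA) h W a := hW.mdifferentiableAt hn

theorem DiffAlongAt.base (hW : DiffAlongAt (EA := EA) h W a) :
    MDifferentiableAt 𝓘(ℝ, EA) 𝓘(ℝ, E) h a :=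
  ((diffAlongAt_iff (mem_chart_source E (h a))).1 hW).1

theorem DiffAlongAt.rep (hW : DiffAlongAt (EA := EA) h W a) (ha : h a ∈ (chartAt E p).source) :
    MDifferentiableAt 𝓘(ℝ, EA) 𝓘(ℝ, E) (rep p h W) a :=
  ((diffAlongAt_iff ha).1 hW).2

theorem eventually_mem_source (hh : ContinuousAt h a) (ha : h a ∈ (chartAt E p).source) :
    ∀ᶠ b in 𝓝 a, h b ∈ (chartAt E p).source :=
  hh.eventually ((chartAt E p).open_source.mem_nhds ha)

theorem rep_congr (p : N) (hWZ : ∀ᶠ b in 𝓝 a, W b = Z b) :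
    ∀ᶠ b in 𝓝 a, rep p h W b = rep p h Z b := by
  filter_upwards [hWZ] with b hb
  rw [rep, rep, hb]

theorem DiffAlongAt.congr (hW : DiffAlongAt (EA := EA) h W a) (hWZ : ∀ᶠ b in 𝓝 a, Z b = W b) :
    DiffAlongAt (EA := EA) h Z a := by
  refine MDifferentiableAt.congr_of_eventuallyEq hW ?_
  filter_upwards [hWZ] with b hb
  rw [hb]

theorem rep_add (hh : ContinuousAt h a) (ha : h a ∈ (chartAt E p).source) :
    rep p h (fun b => W b + Z b) =ᶠ[𝓝 a] fun b => rep p h W b + rep p h Z b := by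
  filter_upwards [eventually_mem_source hh ha] with b hb
  rw [rep_eq hb, rep_eq hb, rep_eq hb, map_add]

theorem rep_smul {c : A → ℝ} (hh : ContinuousAt h a) (ha : h a ∈ (chartAt E p).source) :
    rep p h (fun b => c b • W b) =ᶠ[𝓝 a] fun b => c b • rep p h W b := by
  filter_upwards [eventually_mem_source hh ha] with b hb
  rw [rep_eq hb, rep_eq hb, map_smul]

theorem DiffAlongAt.add (hW : DiffAlongAt (EA := EA) h W a) (hZ : DiffAlongAt (EA := EA) h Z a) :
    DiffAlongAt (EA := EA) h (fun b => W b + Z b) a := by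
  have ha := mem_chart_source E (h a)
  refine (diffAlongAt_iff ha).2 ⟨hW.base, ?_⟩
  exact ((hW.rep ha).add (hZ.rep ha)).congr_of_eventuallyEq (rep_add hW.base.continuousAt ha)

theorem DiffAlongAt.smul {c : A → ℝ} (hc : MDifferentiableAt 𝓘(ℝ, EA) 𝓘(ℝ, ℝ) c a)
    (hW : DiffAlongAt (EA := EA) h W a) : DiffAlongAt (EA := EA) h (fun b => c b • W b) a := by
  have ha := mem_chart_source E (h a)
  refine (diffAlongAt_iff ha).2 ⟨hW.base, ?_⟩
  exact (hc.smul (hW.rep ha)).congr_of_eventuallyEq (rep_smul hW.base.continuousAt ha)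

theorem ContDiffAlongAt.add {n : WithTop ℕ∞}
    [ContMDiffVectorBundle n E (TangentSpace 𝓘(ℝ, E) : N → Type _) 𝓘(ℝ, E)]
    (hW : ContDiffAlongAt (EA := EA) n h W a) (hZ : ContDiffAlongAt (EA := EA) n h Z a) :
    ContDiffAlongAt (EA := EA) n h (fun b => W b + Z b) a := by
  have ha := mem_chart_source E (h a)
  rw [contDiffAlongAt_iff ha] at *
  exact ⟨hW.1, (hW.2.add hZ.2).congr_of_eventuallyEq (rep_add hW.1.continuousAt ha)⟩

theorem ContDiffAlongAt.smul {n : WithTop ℕ∞}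
    [ContMDiffVectorBundle n E (TangentSpace 𝓘(ℝ, E) : N → Type _) 𝓘(ℝ, E)]
    {c : A → ℝ} (hc : ContMDiffAt 𝓘(ℝ, EA) 𝓘(ℝ, ℝ) n c a)
    (hW : ContDiffAlongAt (EA := EA) n h W a) :
    ContDiffAlongAt (EA := EA) n h (fun b => c b • W b) a := by
  have ha := mem_chart_source E (h a)
  rw [contDiffAlongAt_iff ha] at *
  exact ⟨hW.1, (hc.smul hW.2).congr_of_eventuallyEq (rep_smul hW.1.continuousAt ha)⟩

theorem ContDiffAlongAt.congr {n : WithTop ℕ∞} (hW : ContDiffAlongAt (EA := EA) n h W a)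
    (hWZ : ∀ᶠ b in 𝓝 a, Z b = W b) : ContDiffAlongAt (EA := EA) n h Z a := by
  refine ContMDiffAt.congr_of_eventuallyEq hW ?_
  filter_upwards [hWZ] with b hb
  rw [hb]

/-- The field of vectors with constant coordinates `u` in the chart at `p`. -/
def constField (p : N) (u : E) (x : N) : TangentSpace 𝓘(ℝ, E) x := ofModel p x u

theorem rep_constField {p x : N} (hx : x ∈ (chartAt E p).source) (u : E) :
    rep p (fun y : N => y) (constField p u) x = u := by
  rw [rep_eq hx]; exact toModel_ofModel hx u

theorem contDiffAlongAt_constField {n : WithTop ℕ∞}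
    [ContMDiffVectorBundle n E (TangentSpace 𝓘(ℝ, E) : N → Type _) 𝓘(ℝ, E)]
    {p x : N} (hx : x ∈ (chartAt E p).source) (u : E) :
    ContDiffAlongAt (EA := E) n (fun y : N => y) (constField p u) x := by
  refine (contDiffAlongAt_iff hx).2 ⟨contMDiffAt_id, ?_⟩
  refine (contMDiffAt_const (c := u)).congr_of_eventuallyEq ?_
  filter_upwards [(chartAt E p).open_source.mem_nhds hx] with y hy using rep_constField hy u

theorem mdifferentiableAt_extChartAt_comp (hh : MDifferentiableAt 𝓘(ℝ, EA) 𝓘(ℝ, E) h a)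
    (ha : h a ∈ (chartAt E p).source) :
    MDifferentiableAt 𝓘(ℝ, EA) 𝓘(ℝ, E) (fun b => extChartAt 𝓘(ℝ, E) p (h b)) a :=
  (mdifferentiableAt_extChartAt ha).comp a hh

theorem toModel_mfderiv (hh : MDifferentiableAt 𝓘(ℝ, EA) 𝓘(ℝ, E) h a)
    (ha : h a ∈ (chartAt E p).source) (v : TangentSpace 𝓘(ℝ, EA) a) :
    toModel p (h a) (mfderiv 𝓘(ℝ, EA) 𝓘(ℝ, E) h a v)
      = dirDeriv (EA := EA) (fun b => extChartAt 𝓘(ℝ, E) p (h b)) a v := by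
  rw [← mfderiv_apply_eq_dirDeriv (mdifferentiableAt_extChartAt_comp hh ha)]
  rw [toModel, TangentBundle.continuousLinearMapAt_trivializationAt ha]
  exact (mfderiv_comp_apply a (mdifferentiableAt_extChartAt ha) hh v).symm

theorem dirDeriv_comp_map {V : Type*} [NormedAddCommGroup V] [NormedSpace ℝ V] {k : N → V}
    (hk : MDifferentiableAt 𝓘(ℝ, E) 𝓘(ℝ, V) k (h a))
    (hh : MDifferentiableAt 𝓘(ℝ, EA) 𝓘(ℝ, E) h a) (v : TangentSpace 𝓘(ℝ, EA) a) :
    dirDeriv (fun b => k (h b)) a v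
      = dirDeriv k (h a) (mfderiv 𝓘(ℝ, EA) 𝓘(ℝ, E) h a v) := by
  have h1 := mfderiv_apply_eq_dirDeriv (hk.comp a hh) v
  have h2 := mfderiv_apply_eq_dirDeriv hk (mfderiv 𝓘(ℝ, EA) 𝓘(ℝ, E) h a v)
  exact h1.symm.trans ((mfderiv_comp_apply a hk hh v).trans h2)

theorem dirDeriv_extChartAt {x : N} (hx : x ∈ (chartAt E p).source) (v : TangentSpace 𝓘(ℝ, E) x) :
    dirDeriv (fun y => extChartAt 𝓘(ℝ, E) p y) x v = toModel p x v := by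
  have := toModel_mfderiv (h := fun y : N => y) (a := x) mdifferentiableAt_id hx v
  rw [← this]
  exact congrArg (toModel p x) (congrArg (fun L => L v) (mfderiv_id (I := 𝓘(ℝ, E)) (x := x)))

/-- The tangent space at `x` is identified with the model space by the preferred chart at `x`, whose
differential at `x` is therefore the identity. -/
theorem toModel_self (x : N) (v : TangentSpace 𝓘(ℝ, E) x) : toModel x x v = v := by
  rw [toModel, TangentBundle.continuousLinearMapAt_trivializationAt (mem_chart_source E x)]
  exact congrArg (fun L => L v) (mfderiv_extChartAt_self (I := 𝓘(ℝ, E)) (x := x))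

end Model

/-! ### The Levi-Civita connection in an arbitrary chart -/

section Metric

instance normedAddCommGroupBilin (E : Type*) [NormedAddCommGroup E] [NormedSpace ℝ E] :
    NormedAddCommGroup (E →L[ℝ] E →L[ℝ] ℝ) := ContinuousLinearMap.toNormedAddCommGroup

variable {EA : Type*} [NormedAddCommGroup EA] [NormedSpace ℝ EA]
  {A : Type*} [TopologicalSpace A] [ChartedSpace EA A]
  {E : Type*} [NormedAddCommGroup E] [NormedSpace ℝ E] [FiniteDimensional ℝ E]
  {N : Type*} [TopologicalSpace N] [ChartedSpace E N] [IsManifold 𝓘(ℝ, E) ∞ N]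
  [RiemannianBundle (fun y : N => TangentSpace 𝓘(ℝ, E) y)]

theorem inner_ofModel {p x : N} (hx : x ∈ (chartAt E p).source) (u v : E) :
    inner ℝ (ofModel p x u) (ofModel p x v) = chartMetric p (extChartAt 𝓘(ℝ, E) p x) u v := by
  have h : (extChartAt 𝓘(ℝ, E) p).symm (extChartAt 𝓘(ℝ, E) p x) = x :=
    (extChartAt 𝓘(ℝ, E) p).left_inv (by rwa [extChartAt_source])
  change _ = inner ℝ (ofModel p ((extChartAt 𝓘(ℝ, E) p).symm (extChartAt 𝓘(ℝ, E) p x)) u)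
    (ofModel p ((extChartAt 𝓘(ℝ, E) p).symm (extChartAt 𝓘(ℝ, E) p x)) v)
  rw [h]

theorem inner_eq_chartMetric {p x : N} (hx : x ∈ (chartAt E p).source)
    (v w : TangentSpace 𝓘(ℝ, E) x) :
    inner ℝ v w = chartMetric p (extChartAt 𝓘(ℝ, E) p x) (toModel p x v) (toModel p x w) := by
  rw [← inner_ofModel hx, ofModel_toModel hx, ofModel_toModel hx]

theorem chartMetric_symm (p : N) (y u v : E) : chartMetric p y u v = chartMetric p y v u :=
  real_inner_comm (ofModel p ((extChartAt 𝓘(ℝ, E) p).symm y) v)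
    (ofModel p ((extChartAt 𝓘(ℝ, E) p).symm y) u)

variable [IsContMDiffRiemannianBundle 𝓘(ℝ, E) ∞ E (fun y : N => TangentSpace 𝓘(ℝ, E) y)]

/-- In finite dimension it suffices to treat each coefficient, and a coefficient is the inner
product of two smooth fields with constant coordinates. -/
theorem contDiffOn_chartMetric (p : N) :
    ContDiffOn ℝ ∞ (chartMetric (E := E) p) (extChartAt 𝓘(ℝ, E) p).target := by
  refine contDiffOn_clm_apply.2 fun u => contDiffOn_clm_apply.2 fun v => ?_
  intro y hy
  rw [← contMDiffWithinAt_iff_contDiffWithinAt]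
  have hx : (extChartAt 𝓘(ℝ, E) p).symm y ∈ (chartAt E p).source := by
    rw [← extChartAt_source 𝓘(ℝ, E)]; exact (extChartAt 𝓘(ℝ, E) p).map_target hy
  have h1 : ContMDiffAt 𝓘(ℝ, E) 𝓘(ℝ, ℝ) ∞
      (fun x : N => inner ℝ (constField p u x) (constField p v x))
      ((extChartAt 𝓘(ℝ, E) p).symm y) :=
    ContMDiffAt.inner_bundle (b := fun x : N => x) (contDiffAlongAt_constField hx u)
      (contDiffAlongAt_constField hx v)
  exact h1.comp_contMDiffWithinAt y (contMDiffOn_extChartAt_symm p y hy)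

theorem differentiableAt_chartMetric {p x : N} (hx : x ∈ (chartAt E p).source) :
    DifferentiableAt ℝ (chartMetric (E := E) p) (extChartAt 𝓘(ℝ, E) p x) := by
  have hx' : x ∈ (extChartAt 𝓘(ℝ, E) p).source := by rwa [extChartAt_source]
  exact ((contDiffOn_chartMetric p).contDiffAt ((isOpen_extChartAt_target p).mem_nhds
    ((extChartAt 𝓘(ℝ, E) p).map_source hx'))).differentiableAt (by simp)

end Metric

/-! ### Christoffel symbols in an arbitrary chart, and metric compatibility -/

section Christoffel

variable {EA : Type*} [NormedAddCommGroup EA] [NormedSpace ℝ EA]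
  {A : Type*} [TopologicalSpace A] [ChartedSpace EA A]
  {E : Type*} [NormedAddCommGroup E] [NormedSpace ℝ E] [FiniteDimensional ℝ E]
  {N : Type*} [TopologicalSpace N] [ChartedSpace E N] [IsManifold 𝓘(ℝ, E) ∞ N]
  [RiemannianBundle (fun y : N => TangentSpace 𝓘(ℝ, E) y)]

set_option synthInstance.maxHeartbeats 200000 in
/-- The derivative at `x` of the metric in the chart at `p`. -/
def metricDeriv (p x : N) : E →L[ℝ] E →L[ℝ] E →L[ℝ] ℝ :=
  fderiv ℝ (chartMetric p) (extChartAt 𝓘(ℝ, E) p x)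

/-- The Christoffel symbol of the first kind at `x`, in the chart at `p`. -/
def chartChristoffelForm (p x : N) (u v : E) : TangentSpace 𝓘(ℝ, E) x →L[ℝ] ℝ :=
  ((1 / 2 : ℝ) • (metricDeriv p x u v + metricDeriv p x v u
      - ((metricDeriv p x).flip u).flip v)).comp (toModel p x)

/-- The Christoffel symbol of the second kind at `x`, in the chart at `p`, as a tangent vector. -/
def chartChristoffel (p x : N) (u v : E) : TangentSpace 𝓘(ℝ, E) x :=
  haveI : FiniteDimensional ℝ (TangentSpace 𝓘(ℝ, E) x) := inferInstanceAs (FiniteDimensional ℝ E)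
  haveI : CompleteSpace (TangentSpace 𝓘(ℝ, E) x) := FiniteDimensional.complete ℝ _
  (InnerProductSpace.toDual ℝ (TangentSpace 𝓘(ℝ, E) x)).symm (chartChristoffelForm p x u v)

/-- The Levi-Civita connection along `h`, computed in the chart at `p`. -/
def covAlong (p : N) (h : A → N) (W : ∀ a, TangentSpace 𝓘(ℝ, E) (h a)) (a : A)
    (v : TangentSpace 𝓘(ℝ, EA) a) : TangentSpace 𝓘(ℝ, E) (h a) :=
  let w : A → E := rep p h W
  ofModel (E := E) p (h a) (mfderiv 𝓘(ℝ, EA) 𝓘(ℝ, E) w a v)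
    + chartChristoffel p (h a) (toModel (E := E) p (h a) (mfderiv 𝓘(ℝ, EA) 𝓘(ℝ, E) h a v)) (w a)

theorem covDerivAlong_eq_covAlong_self (h : A → N) (W : ∀ a, TangentSpace 𝓘(ℝ, E) (h a)) (a : A)
    (v : TangentSpace 𝓘(ℝ, EA) a) : covDerivAlong h W a v = covAlong (h a) h W a v := rfl

theorem inner_chartChristoffel (p x : N) (u v : E) (z : TangentSpace 𝓘(ℝ, E) x) :
    inner ℝ (chartChristoffel p x u v) z = 1 / 2 * (metricDeriv p x u v (toModel p x z)
      + metricDeriv p x v u (toModel p x z) - metricDeriv p x (toModel p x z) u v) := by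
  have : FiniteDimensional ℝ (TangentSpace 𝓘(ℝ, E) x) := inferInstanceAs (FiniteDimensional ℝ E)
  have : CompleteSpace (TangentSpace 𝓘(ℝ, E) x) := FiniteDimensional.complete ℝ _
  exact InnerProductSpace.toDual_symm_apply

theorem eq_of_inner_right {x : N} {v w : TangentSpace 𝓘(ℝ, E) x}
    (h : ∀ z : TangentSpace 𝓘(ℝ, E) x, inner ℝ v z = inner ℝ w z) : v = w :=
  ext_inner_right ℝ h

set_option synthInstance.maxHeartbeats 200000 in
theorem chartChristoffel_add_left (p x : N) (u u' v : E) :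
    chartChristoffel p x (u + u') v = chartChristoffel p x u v + chartChristoffel p x u' v := by
  refine eq_of_inner_right fun z => ?_
  rw [inner_add_left, inner_chartChristoffel, inner_chartChristoffel, inner_chartChristoffel]
  simp only [map_add, _root_.add_apply]
  ring

set_option synthInstance.maxHeartbeats 200000 in
theorem chartChristoffel_add_right (p x : N) (u v v' : E) :
    chartChristoffel p x u (v + v') = chartChristoffel p x u v + chartChristoffel p x u v' := by
  refine eq_of_inner_right fun z => ?_
  rw [inner_add_left, inner_chartChristoffel, inner_chartChristoffel, inner_chartChristoffel]
  simp only [map_add, _root_.add_apply]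
  ring

set_option synthInstance.maxHeartbeats 200000 in
theorem chartChristoffel_smul_right (p x : N) (c : ℝ) (u v : E) :
    chartChristoffel p x u (c • v) = c • chartChristoffel p x u v := by
  refine eq_of_inner_right fun z => ?_
  rw [real_inner_smul_left, inner_chartChristoffel, inner_chartChristoffel]
  simp only [map_smul, _root_.smul_apply, smul_eq_mul]
  ring

variable [IsContMDiffRiemannianBundle 𝓘(ℝ, E) ∞ E (fun y : N => TangentSpace 𝓘(ℝ, E) y)]

theorem metricDeriv_apply_apply {p x : N} (hx : x ∈ (chartAt E p).source) (u v w : E) :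
    metricDeriv p x u v w
      = fderiv ℝ (fun y => chartMetric p y v w) (extChartAt 𝓘(ℝ, E) p x) u := by
  have hd := differentiableAt_chartMetric hx
  have hd' : DifferentiableAt ℝ (fun y => chartMetric p y v) (extChartAt 𝓘(ℝ, E) p x) :=
    hd.clm_apply (differentiableAt_const v)
  rw [fderiv_clm_apply hd' (differentiableAt_const w), fderiv_clm_apply hd (differentiableAt_const v)]
  simp [metricDeriv]

theorem metricDeriv_symm {p x : N} (hx : x ∈ (chartAt E p).source) (u v w : E) :
    metricDeriv p x u v w = metricDeriv p x u w v := by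
  rw [metricDeriv_apply_apply hx, metricDeriv_apply_apply hx]
  simp only [chartMetric_symm p _ v w]

theorem chartChristoffel_symm {p x : N} (hx : x ∈ (chartAt E p).source) (u v : E) :
    chartChristoffel p x u v = chartChristoffel p x v u := by
  refine eq_of_inner_right fun z => ?_
  rw [inner_chartChristoffel, inner_chartChristoffel, metricDeriv_symm hx (toModel p x z) u v]
  ring

/-- In the sum of the two Christoffel symbols of the first kind everything but `∂_u g (v, w)`
cancels, by symmetry of `g`. This is metric compatibility for fields with constant coordinates. -/
theorem metricDeriv_eq {p x : N} (hx : x ∈ (chartAt E p).source) (u v w : E) :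
    metricDeriv p x u v w = inner ℝ (chartChristoffel p x u v) (ofModel p x w)
      + inner ℝ (ofModel p x v) (chartChristoffel p x u w) := by
  rw [real_inner_comm (chartChristoffel p x u w), inner_chartChristoffel, inner_chartChristoffel,
    toModel_ofModel hx,
    toModel_ofModel hx, metricDeriv_symm hx u w v, metricDeriv_symm hx w u v,
    metricDeriv_symm hx v u w]
  ring

variable {p : N} {h : A → N} {W Z : ∀ a, TangentSpace 𝓘(ℝ, E) (h a)} {a : A}

theorem covAlong_eq (hW : DiffAlongAt (EA := EA) h W a)
    (ha : h a ∈ (chartAt E p).source) (v : TangentSpace 𝓘(ℝ, EA) a) :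
    covAlong p h W a v = ofModel p (h a) (dirDeriv (EA := EA) (rep p h W) a v)
      + chartChristoffel p (h a)
        (dirDeriv (EA := EA) (fun b => extChartAt 𝓘(ℝ, E) p (h b)) a v) (rep p h W a) := by
  rw [covAlong, mfderiv_apply_eq_dirDeriv (hW.rep ha), toModel_mfderiv hW.base ha]

/-- The connection is compatible with the metric. -/
theorem dirDeriv_inner (hW : DiffAlongAt (EA := EA) h W a) (hZ : DiffAlongAt (EA := EA) h Z a)
    (ha : h a ∈ (chartAt E p).source) (v : TangentSpace 𝓘(ℝ, EA) a) :
    dirDeriv (EA := EA) (fun b => inner ℝ (W b) (Z b)) a v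
      = inner ℝ (covAlong p h W a v) (Z a) + inner ℝ (W a) (covAlong p h Z a v) := by
  have hh := hW.base
  set k : A → E →L[ℝ] E →L[ℝ] ℝ := fun b => chartMetric p (extChartAt 𝓘(ℝ, E) p (h b)) with hk_def
  have hφ := mdifferentiableAt_extChartAt_comp hh ha
  have hd := differentiableAt_chartMetric (E := E) ha
  have hk : MDifferentiableAt 𝓘(ℝ, EA) 𝓘(ℝ, E →L[ℝ] E →L[ℝ] ℝ) k a :=
    MDifferentiableAt.comp (I' := 𝓘(ℝ, E)) (g := chartMetric (E := E) p)
      (f := fun b => extChartAt 𝓘(ℝ, E) p (h b)) a hd.mdifferentiableAt hφ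
  have hw := hW.rep ha
  have hz := hZ.rep ha
  have hkw : MDifferentiableAt 𝓘(ℝ, EA) 𝓘(ℝ, E →L[ℝ] ℝ) (fun b => k b (rep p h W b)) a :=
    hk.clm_apply hw
  -- In coordinates the inner product is trilinear in the metric and the two fields. The product
  -- rule gives three terms, and `metricDeriv_eq` splits the derivative of the metric into the two
  -- Christoffel terms.
  have e1 : (fun b => inner ℝ (W b) (Z b)) =ᶠ[𝓝 a]
      fun b => k b (rep p h W b) (rep p h Z b) := by
    filter_upwards [eventually_mem_source hh.continuousAt ha] with b hb
    rw [inner_eq_chartMetric hb, ← rep_eq hb, ← rep_eq hb]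
  rw [dirDeriv_congr e1]
  have e2 := dirDeriv_bilin (ContinuousLinearMap.id ℝ (E →L[ℝ] ℝ)) hkw hz v
  have e3 := dirDeriv_bilin (ContinuousLinearMap.id ℝ (E →L[ℝ] E →L[ℝ] ℝ)) hk hw v
  have e4 : dirDeriv (EA := EA) k a v = metricDeriv p (h a)
      (dirDeriv (EA := EA) (fun b => extChartAt 𝓘(ℝ, E) p (h b)) a v) := dirDeriv_comp hd hφ v
  simp only [ContinuousLinearMap.id_apply] at e2 e3
  rw [e2, e3, e4, _root_.add_apply, metricDeriv_eq ha, covAlong_eq hW ha, covAlong_eq hZ ha,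
    inner_add_left, inner_add_right, hk_def]
  simp only
  rw [← inner_ofModel ha, ← inner_ofModel ha, rep_eq ha, rep_eq ha, ofModel_toModel ha,
    ofModel_toModel ha]
  ring

end Christoffel

/-! ### Leibniz, sum and chain rules for the pulled back connection -/

section Calculus

variable {EA : Type*} [NormedAddCommGroup EA] [NormedSpace ℝ EA]
  {A : Type*} [TopologicalSpace A] [ChartedSpace EA A]
  {E : Type*} [NormedAddCommGroup E] [NormedSpace ℝ E] [FiniteDimensional ℝ E]
  {N : Type*} [TopologicalSpace N] [ChartedSpace E N] [IsManifold 𝓘(ℝ, E) ∞ N]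
  [RiemannianBundle (fun y : N => TangentSpace 𝓘(ℝ, E) y)]
  [IsContMDiffRiemannianBundle 𝓘(ℝ, E) ∞ E (fun y : N => TangentSpace 𝓘(ℝ, E) y)]
  {p : N} {h : A → N} {W Z : ∀ a, TangentSpace 𝓘(ℝ, E) (h a)} {a : A}

theorem covAlong_congr (hW : DiffAlongAt (EA := EA) h W a) (ha : h a ∈ (chartAt E p).source)
    (hZW : ∀ᶠ b in 𝓝 a, Z b = W b) (v : TangentSpace 𝓘(ℝ, EA) a) :
    covAlong p h Z a v = covAlong p h W a v := by
  rw [covAlong_eq hW ha, covAlong_eq (hW.congr hZW) ha, dirDeriv_congr (rep_congr p hZW),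
    (rep_congr p hZW).self_of_nhds]

theorem covAlong_add (hW : DiffAlongAt (EA := EA) h W a) (hZ : DiffAlongAt (EA := EA) h Z a)
    (ha : h a ∈ (chartAt E p).source) (v : TangentSpace 𝓘(ℝ, EA) a) :
    covAlong p h (fun b => W b + Z b) a v = covAlong p h W a v + covAlong p h Z a v := by
  have hr := rep_add (W := W) (Z := Z) hW.base.continuousAt ha
  rw [covAlong_eq hW ha, covAlong_eq hZ ha, covAlong_eq (hW.add hZ) ha, dirDeriv_congr hr,
    hr.self_of_nhds, dirDeriv_add (hW.rep ha) (hZ.rep ha), map_add, chartChristoffel_add_right]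
  abel

theorem covAlong_smul {c : A → ℝ} (hc : MDifferentiableAt 𝓘(ℝ, EA) 𝓘(ℝ, ℝ) c a)
    (hW : DiffAlongAt (EA := EA) h W a)
    (ha : h a ∈ (chartAt E p).source) (v : TangentSpace 𝓘(ℝ, EA) a) :
    covAlong p h (fun b => c b • W b) a v
      = dirDeriv (EA := EA) c a v • W a + c a • covAlong p h W a v := by
  have hr := rep_smul (c := c) (W := W) hW.base.continuousAt ha
  rw [covAlong_eq hW ha, covAlong_eq (hW.smul hc) ha, dirDeriv_congr hr,
    hr.self_of_nhds, dirDeriv_smul hc (hW.rep ha), map_add, map_smul, map_smul,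
    chartChristoffel_smul_right, smul_add, add_assoc, rep_eq ha, ofModel_toModel ha]

theorem covAlong_zero (hh : MDifferentiableAt 𝓘(ℝ, EA) 𝓘(ℝ, E) h a)
    (ha : h a ∈ (chartAt E p).source) (v : TangentSpace 𝓘(ℝ, EA) a) :
    DiffAlongAt (EA := EA) h (fun b => (0 : TangentSpace 𝓘(ℝ, E) (h b))) a ∧
    covAlong p h (fun b => (0 : TangentSpace 𝓘(ℝ, E) (h b))) a v = 0 := by
  have hr : rep p h (fun b => (0 : TangentSpace 𝓘(ℝ, E) (h b))) =ᶠ[𝓝 a] fun _ => (0 : E) := by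
    filter_upwards [eventually_mem_source hh.continuousAt ha] with b hb
    rw [rep_eq hb, map_zero]
  have hd : DiffAlongAt (EA := EA) h (fun b => (0 : TangentSpace 𝓘(ℝ, E) (h b))) a :=
    (diffAlongAt_iff ha).2 ⟨hh, mdifferentiableAt_const.congr_of_eventuallyEq hr⟩
  refine ⟨hd, ?_⟩
  rw [covAlong_eq hd ha, dirDeriv_congr hr, hr.self_of_nhds, dirDeriv_const, map_zero, zero_add]
  have := chartChristoffel_smul_right p (h a) 0
    (dirDeriv (EA := EA) (fun b => extChartAt 𝓘(ℝ, E) p (h b)) a v) 0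
  simpa using this

theorem covAlong_sum {ι : Type*} (s : Finset ι) {W : ι → ∀ a, TangentSpace 𝓘(ℝ, E) (h a)}
    (hh : MDifferentiableAt 𝓘(ℝ, EA) 𝓘(ℝ, E) h a)
    (hW : ∀ i, DiffAlongAt (EA := EA) h (W i) a)
    (ha : h a ∈ (chartAt E p).source) (v : TangentSpace 𝓘(ℝ, EA) a) :
    DiffAlongAt (EA := EA) h (fun b => ∑ i ∈ s, W i b) a ∧
    covAlong p h (fun b => ∑ i ∈ s, W i b) a v = ∑ i ∈ s, covAlong p h (W i) a v := by
  classical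
  induction s using Finset.induction_on with
  | empty => simpa using covAlong_zero hh ha v
  | insert i s hi ih =>
    simp only [Finset.sum_insert hi]
    exact ⟨(hW i).add ih.1, by rw [covAlong_add (hW i) ih.1 ha, ih.2]⟩

/-- No regularity of `W` is needed: `mfderiv` is linear in the direction whatever its value. -/
theorem covAlong_add_dir (p : N) (W : ∀ a, TangentSpace 𝓘(ℝ, E) (h a))
    (v w : TangentSpace 𝓘(ℝ, EA) a) :
    covAlong p h W a (v + w) = covAlong p h W a v + covAlong p h W a w := by
  simp only [covAlong]
  rw [map_add, map_add, map_add, chartChristoffel_add_left]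
  erw [map_add]
  abel

theorem DiffAlongAt.comp {X : ∀ y : N, TangentSpace 𝓘(ℝ, E) y}
    (hX : DiffAlongAt (EA := E) (fun y : N => y) X (h a))
    (hh : MDifferentiableAt 𝓘(ℝ, EA) 𝓘(ℝ, E) h a) :
    DiffAlongAt (EA := EA) h (fun b => X (h b)) a :=
  MDifferentiableAt.comp a hX hh

/-- The chain rule for the pulled back connection. -/
theorem covAlong_comp {X : ∀ y : N, TangentSpace 𝓘(ℝ, E) y}
    (hX : DiffAlongAt (EA := E) (fun y : N => y) X (h a))
    (hh : MDifferentiableAt 𝓘(ℝ, EA) 𝓘(ℝ, E) h a) (ha : h a ∈ (chartAt E p).source)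
    (v : TangentSpace 𝓘(ℝ, EA) a) :
    covAlong p h (fun b => X (h b)) a v
      = covAlong p (fun y : N => y) X (h a) (mfderiv 𝓘(ℝ, EA) 𝓘(ℝ, E) h a v) := by
  rw [covAlong_eq (hX.comp hh) ha, covAlong_eq (h := fun y : N => y) hX ha,
    dirDeriv_comp_map (mdifferentiableAt_extChartAt ha) hh]
  have := dirDeriv_comp_map (hX.rep (p := p) ha) hh v
  rw [← this]
  rfl

end Calculus

/-! ### Lie brackets in charts -/

section Torsion

variable {EA : Type*} [NormedAddCommGroup EA] [NormedSpace ℝ EA] [FiniteDimensional ℝ EA]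
  {A : Type*} [TopologicalSpace A] [ChartedSpace EA A] [IsManifold 𝓘(ℝ, EA) ∞ A]
  {V : Type*} [NormedAddCommGroup V] [NormedSpace ℝ V]

theorem contDiffAt_comp_extChartAt_symm {k : A → V} {a b : A} (hb : b ∈ (chartAt EA a).source)
    (hk : ContMDiffAt 𝓘(ℝ, EA) 𝓘(ℝ, V) ∞ k b) :
    ContDiffAt ℝ ∞ (k ∘ (extChartAt 𝓘(ℝ, EA) a).symm) (extChartAt 𝓘(ℝ, EA) a b) := by
  have hb' : b ∈ (extChartAt 𝓘(ℝ, EA) a).source := by rwa [extChartAt_source]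
  have hi := (extChartAt 𝓘(ℝ, EA) a).left_inv hb'
  rw [← contMDiffAt_iff_contDiffAt]
  refine ContMDiffAt.comp (I' := 𝓘(ℝ, EA)) _ (by rwa [hi]) ?_
  exact (contMDiffOn_extChartAt_symm a).contMDiffAt ((isOpen_extChartAt_target a).mem_nhds
    ((extChartAt 𝓘(ℝ, EA) a).map_source hb'))

theorem extChartAt_target_mem_nhds_of_mem {a b : A} (hb : b ∈ (chartAt EA a).source) :
    (extChartAt 𝓘(ℝ, EA) a).target ∈ 𝓝 (extChartAt 𝓘(ℝ, EA) a b) :=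
  (isOpen_extChartAt_target a).mem_nhds
    ((extChartAt 𝓘(ℝ, EA) a).map_source (by rwa [extChartAt_source]))

theorem dirDeriv_eq_fderiv_chart {k : A → V} {a b : A} (hb : b ∈ (chartAt EA a).source)
    (hk : ContMDiffAt 𝓘(ℝ, EA) 𝓘(ℝ, V) ∞ k b) (v : TangentSpace 𝓘(ℝ, EA) b) :
    dirDeriv k b v = fderiv ℝ (k ∘ (extChartAt 𝓘(ℝ, EA) a).symm) (extChartAt 𝓘(ℝ, EA) a b)
      (toModel a b v) := by
  have hd : DifferentiableAt ℝ (k ∘ (extChartAt 𝓘(ℝ, EA) a).symm) (extChartAt 𝓘(ℝ, EA) a b) :=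
    (contDiffAt_comp_extChartAt_symm hb hk).differentiableAt (by simp)
  have he : k =ᶠ[𝓝 b] fun c => (k ∘ (extChartAt 𝓘(ℝ, EA) a).symm) (extChartAt 𝓘(ℝ, EA) a c) := by
    filter_upwards [(chartAt EA a).open_source.mem_nhds hb] with c hc
    simp only [Function.comp_apply]
    rw [(extChartAt 𝓘(ℝ, EA) a).left_inv (by rwa [extChartAt_source])]
  rw [dirDeriv_congr he, dirDeriv_comp hd (mdifferentiableAt_extChartAt hb), dirDeriv_extChartAt hb]

theorem mpullbackWithin_extChartAt_symm (X : ∀ y : A, TangentSpace 𝓘(ℝ, EA) y) {a : A} {y : EA}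
    (hy : y ∈ (extChartAt 𝓘(ℝ, EA) a).target) :
    VectorField.mpullbackWithin 𝓘(ℝ, EA) 𝓘(ℝ, EA) (extChartAt 𝓘(ℝ, EA) a).symm X
      (range 𝓘(ℝ, EA)) y = rep a (fun x : A => x) X ((extChartAt 𝓘(ℝ, EA) a).symm y) := by
  have hb : (extChartAt 𝓘(ℝ, EA) a).symm y ∈ (chartAt EA a).source := by
    rw [← extChartAt_source 𝓘(ℝ, EA)]; exact (extChartAt 𝓘(ℝ, EA) a).map_target hy
  have hs := TangentBundle.symmL_trivializationAt (I := 𝓘(ℝ, EA)) hb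
  rw [(extChartAt 𝓘(ℝ, EA) a).right_inv hy] at hs
  rw [VectorField.mpullbackWithin_apply]
  refine Eq.trans ?_ (rep_eq (h := fun x : A => x) hb).symm
  rw [← hs]
  have hinv : (ofModel a ((extChartAt 𝓘(ℝ, EA) a).symm y)).inverse
      = toModel a ((extChartAt 𝓘(ℝ, EA) a).symm y) :=
    ContinuousLinearMap.inverse_eq (ContinuousLinearMap.ext fun v => ofModel_toModel hb v)
      (ContinuousLinearMap.ext fun v => toModel_ofModel hb v)
  exact congrArg (fun L => L (X ((extChartAt 𝓘(ℝ, EA) a).symm y))) hinv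

theorem toModel_mlieBracket {X Y : ∀ y : A, TangentSpace 𝓘(ℝ, EA) y} {a : A} :
    toModel a a (VectorField.mlieBracket 𝓘(ℝ, EA) X Y a)
      = dirDeriv (rep a (fun y : A => y) Y) a (X a) - dirDeriv (rep a (fun y : A => y) X) a (Y a) := by
  have ht := extChartAt_target_mem_nhds_of_mem (mem_chart_source EA a)
  have key : ∀ X : ∀ y : A, TangentSpace 𝓘(ℝ, EA) y,
      VectorField.mpullbackWithin 𝓘(ℝ, EA) 𝓘(ℝ, EA) (extChartAt 𝓘(ℝ, EA) a).symm X
        (range 𝓘(ℝ, EA)) =ᶠ[𝓝 (extChartAt 𝓘(ℝ, EA) a a)]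
        rep a (fun x : A => x) X ∘ (extChartAt 𝓘(ℝ, EA) a).symm := fun X =>
    Filter.eventually_of_mem ht fun y hy => mpullbackWithin_extChartAt_symm X hy
  have hval : ∀ X : ∀ y : A, TangentSpace 𝓘(ℝ, EA) y,
      (rep a (fun x : A => x) X ∘ (extChartAt 𝓘(ℝ, EA) a).symm) (extChartAt 𝓘(ℝ, EA) a a)
        = X a := fun X => by
    rw [Function.comp_apply, extChartAt_to_inv, rep_eq (mem_chart_source EA a)]
    exact toModel_self a (X a)
  have hinv : ∀ z, (mfderiv 𝓘(ℝ, EA) 𝓘(ℝ, EA) (extChartAt 𝓘(ℝ, EA) a) a).inverse z = z := by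
    intro z
    rw [mfderiv_extChartAt_self]
    exact congrArg (fun L => L z) (ContinuousLinearMap.inverse_id (R := ℝ) (M := EA))
  rw [toModel_self]
  change VectorField.mlieBracketWithin 𝓘(ℝ, EA) X Y univ a = _
  rw [VectorField.mlieBracketWithin_apply]
  refine (hinv _).trans ?_
  simp only [preimage_univ, univ_inter, ModelWithCorners.range_eq_univ]
  simp only [ModelWithCorners.range_eq_univ] at key
  refine (congrFun (VectorField.lieBracketWithin_univ (𝕜 := ℝ) (E := EA)) _).trans ?_
  refine (Filter.EventuallyEq.lieBracket_vectorField_eq (𝕜 := ℝ) (E := EA) (key X) (key Y)).trans ?_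
  rw [VectorField.lieBracket, hval X, hval Y]
  rfl

/-- The second derivative of `k` is symmetric, so only the terms that differentiate the coordinates
of `X` and `Y` survive, and these form the bracket. -/
theorem dirDeriv_dirDeriv_sub {k : A → V} {X Y : ∀ y : A, TangentSpace 𝓘(ℝ, EA) y} {a : A}
    (hk : ∀ᶠ b in 𝓝 a, ContMDiffAt 𝓘(ℝ, EA) 𝓘(ℝ, V) ∞ k b)
    (hX : DiffAlongAt (EA := EA) (fun y : A => y) X a)
    (hY : DiffAlongAt (EA := EA) (fun y : A => y) Y a) :
    dirDeriv (fun b => dirDeriv k b (Y b)) a (X a) - dirDeriv (fun b => dirDeriv k b (X b)) a (Y a)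
      = dirDeriv k a (VectorField.mlieBracket 𝓘(ℝ, EA) X Y a) := by
  have ha := mem_chart_source EA a
  set kc := k ∘ (extChartAt 𝓘(ℝ, EA) a).symm with hkc
  have hcd : ContDiffAt ℝ ∞ kc (extChartAt 𝓘(ℝ, EA) a a) :=
    contDiffAt_comp_extChartAt_symm ha hk.self_of_nhds
  have hd : DifferentiableAt ℝ (fderiv ℝ kc) (extChartAt 𝓘(ℝ, EA) a a) :=
    (hcd.fderiv_right (m := 1) (by norm_cast)).differentiableAt (by simp)
  have hχ : MDifferentiableAt 𝓘(ℝ, EA) 𝓘(ℝ, EA) (fun b => extChartAt 𝓘(ℝ, EA) a b) a :=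
    mdifferentiableAt_extChartAt ha
  have hD : MDifferentiableAt 𝓘(ℝ, EA) 𝓘(ℝ, EA →L[ℝ] V)
      (fun b => fderiv ℝ kc (extChartAt 𝓘(ℝ, EA) a b)) a :=
    MDifferentiableAt.comp (I' := 𝓘(ℝ, EA)) (g := fderiv ℝ kc) a hd.mdifferentiableAt hχ
  -- The inner derivative at `b` is defined in the chart at `b`; it has to be rewritten in the fixed
  -- chart at `a` before it can be differentiated. This uses smoothness of `k` near `a`, not only at
  -- `a`.
  have key : ∀ {X Y : ∀ y : A, TangentSpace 𝓘(ℝ, EA) y},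
      DiffAlongAt (EA := EA) (fun y : A => y) Y a →
      dirDeriv (fun b => dirDeriv k b (Y b)) a (X a)
        = fderiv ℝ (fderiv ℝ kc) (extChartAt 𝓘(ℝ, EA) a a) (toModel a a (X a)) (toModel a a (Y a))
          + fderiv ℝ kc (extChartAt 𝓘(ℝ, EA) a a)
            (dirDeriv (rep a (fun y : A => y) Y) a (X a)) := by
    intro X Y hY
    have he : (fun b => dirDeriv k b (Y b)) =ᶠ[𝓝 a]
        fun b => fderiv ℝ kc (extChartAt 𝓘(ℝ, EA) a b) (rep a (fun y : A => y) Y b) := by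
      filter_upwards [(chartAt EA a).open_source.mem_nhds ha, hk] with b hb hkb
      rw [dirDeriv_eq_fderiv_chart hb hkb, rep_eq hb]
    rw [dirDeriv_congr he]
    have h1 := dirDeriv_bilin (ContinuousLinearMap.id ℝ (EA →L[ℝ] V)) hD (hY.rep ha) (X a)
    have h2 := dirDeriv_comp (G := fderiv ℝ kc) hd hχ (X a)
    simp only [ContinuousLinearMap.id_apply] at h1
    rw [h1, h2, dirDeriv_extChartAt ha, rep_eq ha]
  rw [key hY, key hX, dirDeriv_eq_fderiv_chart ha hk.self_of_nhds, toModel_mlieBracket, map_sub]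
  have hs := (hcd.isSymmSndFDerivAt (by
    simpa using WithTop.coe_le_coe.2 (le_top : (2 : ℕ∞) ≤ ⊤))).eq (toModel a a (X a)) (toModel a a (Y a))
  rw [hs]
  abel

end Torsion

/-! ### Vanishing torsion, and independence of the chart -/

section LeviCivita

variable {EA : Type*} [NormedAddCommGroup EA] [NormedSpace ℝ EA]
  {A : Type*} [TopologicalSpace A] [ChartedSpace EA A]
  {E : Type*} [NormedAddCommGroup E] [NormedSpace ℝ E] [FiniteDimensional ℝ E]
  {N : Type*} [TopologicalSpace N] [ChartedSpace E N] [IsManifold 𝓘(ℝ, E) ∞ N]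

theorem contDiffAlongAt_pushforward [IsManifold 𝓘(ℝ, EA) ∞ A] {h : A → N} {a : A}
    (hh : ContMDiff 𝓘(ℝ, EA) 𝓘(ℝ, E) ∞ h) {X : ∀ y : A, TangentSpace 𝓘(ℝ, EA) y}
    (hX : ContDiffAlongAt (EA := EA) ∞ (fun y : A => y) X a) :
    ContDiffAlongAt (EA := EA) ∞ h (fun b => mfderiv 𝓘(ℝ, EA) 𝓘(ℝ, E) h b (X b)) a :=
  ContMDiffAt.comp a (hh.contMDiff_tangentMap (m := ∞) (by simp)).contMDiffAt hX

theorem diffAlongAt_pushforward [IsManifold 𝓘(ℝ, EA) ∞ A] {h : A → N} {a : A}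
    (hh : ContMDiff 𝓘(ℝ, EA) 𝓘(ℝ, E) ∞ h) {X : ∀ y : A, TangentSpace 𝓘(ℝ, EA) y}
    (hX : DiffAlongAt (EA := EA) (fun y : A => y) X a) :
    DiffAlongAt (EA := EA) h (fun b => mfderiv 𝓘(ℝ, EA) 𝓘(ℝ, E) h b (X b)) a :=
  MDifferentiableAt.comp a
    ((hh.contMDiff_tangentMap (m := ∞) (by simp)).contMDiffAt.mdifferentiableAt (by simp)) hX

variable [RiemannianBundle (fun y : N => TangentSpace 𝓘(ℝ, E) y)]
  [IsContMDiffRiemannianBundle 𝓘(ℝ, E) ∞ E (fun y : N => TangentSpace 𝓘(ℝ, E) y)]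

/-- The connection is torsion-free, along a map. -/
theorem covAlong_pushforward_sub [FiniteDimensional ℝ EA] [IsManifold 𝓘(ℝ, EA) ∞ A] {p : N}
    {h : A → N} {a : A} (hh : ContMDiff 𝓘(ℝ, EA) 𝓘(ℝ, E) ∞ h) (ha : h a ∈ (chartAt E p).source)
    {X Y : ∀ y : A, TangentSpace 𝓘(ℝ, EA) y}
    (hX : DiffAlongAt (EA := EA) (fun y : A => y) X a)
    (hY : DiffAlongAt (EA := EA) (fun y : A => y) Y a) :
    covAlong p h (fun b => mfderiv 𝓘(ℝ, EA) 𝓘(ℝ, E) h b (Y b)) a (X a)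
        - covAlong p h (fun b => mfderiv 𝓘(ℝ, EA) 𝓘(ℝ, E) h b (X b)) a (Y a)
      = mfderiv 𝓘(ℝ, EA) 𝓘(ℝ, E) h a (VectorField.mlieBracket 𝓘(ℝ, EA) X Y a) := by
  have hmd : ∀ b, MDifferentiableAt 𝓘(ℝ, EA) 𝓘(ℝ, E) h b := fun b =>
    hh.contMDiffAt.mdifferentiableAt (by simp)
  set k : A → E := fun b => extChartAt 𝓘(ℝ, E) p (h b) with hk_def
  have hsrc := eventually_mem_source hh.continuous.continuousAt ha
  have hk : ∀ᶠ b in 𝓝 a, ContMDiffAt 𝓘(ℝ, EA) 𝓘(ℝ, E) ∞ k b := by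
    filter_upwards [hsrc] with b hb
    exact (contMDiffAt_extChartAt' (n := ∞) hb).comp b hh.contMDiffAt
  have hrep : ∀ X : ∀ y : A, TangentSpace 𝓘(ℝ, EA) y,
      rep p h (fun b => mfderiv 𝓘(ℝ, EA) 𝓘(ℝ, E) h b (X b)) =ᶠ[𝓝 a]
        fun b => dirDeriv k b (X b) := fun X => by
    filter_upwards [hsrc] with b hb
    rw [rep_eq hb, toModel_mfderiv (hmd b) hb]
  rw [covAlong_eq (diffAlongAt_pushforward hh hX) ha, covAlong_eq (diffAlongAt_pushforward hh hY) ha,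
    dirDeriv_congr (hrep X), dirDeriv_congr (hrep Y), (hrep X).self_of_nhds,
    (hrep Y).self_of_nhds, chartChristoffel_symm ha (dirDeriv k a (X a)),
    add_sub_add_right_eq_sub, ← map_sub, dirDeriv_dirDeriv_sub hk hX hY, ← toModel_mfderiv (hmd a) ha,
    ofModel_toModel ha]

theorem covAlong_sub_of_mlieBracket {p x : N} (hx : x ∈ (chartAt E p).source)
    {X Y : ∀ y : N, TangentSpace 𝓘(ℝ, E) y}
    (hX : DiffAlongAt (EA := E) (fun y : N => y) X x)
    (hY : DiffAlongAt (EA := E) (fun y : N => y) Y x) :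
    covAlong p (fun y : N => y) Y x (X x) - covAlong p (fun y : N => y) X x (Y x)
      = VectorField.mlieBracket 𝓘(ℝ, E) X Y x := by
  have h := covAlong_pushforward_sub (h := fun y : N => y) contMDiff_id hx hX hY
  have hid : ∀ (y : N) (v : TangentSpace 𝓘(ℝ, E) y),
      mfderiv 𝓘(ℝ, E) 𝓘(ℝ, E) (fun y : N => y) y v = v := fun y v =>
    congrArg (fun L => L v) (mfderiv_id (I := 𝓘(ℝ, E)) (x := y))
  simp only [hid] at h
  exact h

/-- Uniqueness of the Levi-Civita connection: the difference of the two expressions, paired with a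
third field, is symmetric in the first two arguments (both are torsion-free) and skew in the last
two (both are metric), hence zero. -/
theorem covAlong_constField_eq {p x : N} (hx : x ∈ (chartAt E p).source) (u v : E) :
    covAlong p (fun y : N => y) (constField p v) x (constField p u x)
      = covDerivAlong (fun y : N => y) (constField p v) x (constField p u x) := by
  have hd : ∀ u : E, DiffAlongAt (EA := E) (fun y : N => y) (constField p u) x := fun u =>
    (contDiffAlongAt_constField (n := ∞) hx u).diffAlongAt (by simp)
  have hx' := mem_chart_source E x
  set T : E → E → E → ℝ := fun u v w => inner ℝ
    (covAlong p (fun y : N => y) (constField p v) x (constField p u x)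
      - covDerivAlong (fun y : N => y) (constField p v) x (constField p u x))
    (constField p w x) with hT
  have hsymm : ∀ u v w, T u v w = T v u w := by
    intro u v w
    have h1 := covAlong_sub_of_mlieBracket hx (hd u) (hd v)
    have h2 := covAlong_sub_of_mlieBracket hx' (hd u) (hd v)
    simp only [hT, covDerivAlong_eq_covAlong_self]
    rw [← h2] at h1
    congr 1
    rw [sub_eq_sub_iff_sub_eq_sub]
    exact h1
  have hskew : ∀ u v w, T u v w = - T u w v := by
    intro u v w
    have h1 := dirDeriv_inner (hd v) (hd w) hx (constField p u x)
    have h2 := dirDeriv_inner (hd v) (hd w) hx' (constField p u x)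
    simp only [hT, covDerivAlong_eq_covAlong_self, inner_sub_left]
    rw [h1] at h2
    rw [real_inner_comm (constField p v x) , real_inner_comm (constField p v x)] at *
    linarith
  have hzero : ∀ u v w, T u v w = 0 := by
    intro u v w
    linarith [hskew u v w, hsymm u w v, hskew w u v, hsymm w v u, hskew v w u, hsymm v u w]
  refine eq_of_inner_right fun z => ?_
  have := hzero u v (toModel p x z)
  simp only [hT, inner_sub_left, constField, ofModel_toModel hx] at this
  exact sub_eq_zero.1 this

/-- Reduces statements about fields along `h` to statements about fields on `N`. It serves both for
the independence of the chart and for the parallelism of `P` along maps. -/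
theorem covAlong_eq_sum {p : N} {h : A → N} {W : ∀ a, TangentSpace 𝓘(ℝ, E) (h a)} {a : A}
    {ι : Type*} [Fintype ι] {c : ι → A → ℝ} {X : ι → ∀ y : N, TangentSpace 𝓘(ℝ, E) y}
    (hh : MDifferentiableAt 𝓘(ℝ, EA) 𝓘(ℝ, E) h a)
    (hc : ∀ i, MDifferentiableAt 𝓘(ℝ, EA) 𝓘(ℝ, ℝ) (c i) a)
    (hX : ∀ i, DiffAlongAt (EA := E) (fun y : N => y) (X i) (h a))
    (hW : ∀ᶠ b in 𝓝 a, W b = ∑ i, c i b • X i (h b)) (ha : h a ∈ (chartAt E p).source)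
    (v : TangentSpace 𝓘(ℝ, EA) a) :
    covAlong p h W a v = ∑ i, (dirDeriv (EA := EA) (c i) a v • X i (h a)
      + c i a • covAlong p (fun y : N => y) (X i) (h a) (mfderiv 𝓘(ℝ, EA) 𝓘(ℝ, E) h a v)) := by
  have hs := covAlong_sum (W := fun i b => c i b • X i (h b)) Finset.univ hh
    (fun i => ((hX i).comp hh).smul (hc i)) ha v
  rw [covAlong_congr hs.1 ha hW, hs.2]
  refine Finset.sum_congr rfl fun i _ => ?_
  rw [covAlong_smul (hc i) ((hX i).comp hh) ha, covAlong_comp (hX i) hh ha]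

theorem eventually_eq_sum_constField {p : N} {h : A → N} {a : A}
    (W : ∀ a, TangentSpace 𝓘(ℝ, E) (h a)) (hh : ContinuousAt h a)
    (ha : h a ∈ (chartAt E p).source) {ι : Type*} [Fintype ι] (B : Module.Basis ι ℝ E) :
    ∀ᶠ b in 𝓝 a, W b = ∑ i, B.repr (rep p h W b) i • constField p (B i) (h b) := by
  filter_upwards [eventually_mem_source hh ha] with b hb
  rw [rep_eq hb]
  simp only [constField]
  simp only [← map_smul, ← map_sum]
  rw [B.sum_repr, ofModel_toModel hb]

theorem DiffAlongAt.mdifferentiableAt_coeff {p : N} {h : A → N} {a : A}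
    {W : ∀ a, TangentSpace 𝓘(ℝ, E) (h a)} (hW : DiffAlongAt (EA := EA) h W a)
    (ha : h a ∈ (chartAt E p).source) {ι : Type*} [Fintype ι] (B : Module.Basis ι ℝ E) (i : ι) :
    MDifferentiableAt 𝓘(ℝ, EA) 𝓘(ℝ, ℝ) (fun b => B.repr (_root_.rep p h W b) i) a :=
  (LinearMap.toContinuousLinearMap (B.coord i)).mdifferentiableAt.comp a (hW.rep ha)

/-- The connection does not depend on the chart. -/
theorem covAlong_eq_covDerivAlong {p : N} {h : A → N} {W : ∀ a, TangentSpace 𝓘(ℝ, E) (h a)} {a : A}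
    (hW : DiffAlongAt (EA := EA) h W a) (ha : h a ∈ (chartAt E p).source)
    (v : TangentSpace 𝓘(ℝ, EA) a) :
    covAlong p h W a v = covDerivAlong h W a v := by
  have hB := eventually_eq_sum_constField W hW.base.continuousAt ha (Module.finBasis ℝ E)
  have hc := hW.mdifferentiableAt_coeff ha (Module.finBasis ℝ E)
  have hX : ∀ i, DiffAlongAt (EA := E) (fun y : N => y)
      (constField p (Module.finBasis ℝ E i)) (h a) := fun i =>
    (contDiffAlongAt_constField (n := ∞) ha _).diffAlongAt (by simp)
  rw [covDerivAlong_eq_covAlong_self, covAlong_eq_sum hW.base hc hX hB ha,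
    covAlong_eq_sum hW.base hc hX hB (mem_chart_source E (h a))]
  refine Finset.sum_congr rfl fun i _ => ?_
  have hv : mfderiv 𝓘(ℝ, EA) 𝓘(ℝ, E) h a v
      = constField p (toModel p (h a) (mfderiv 𝓘(ℝ, EA) 𝓘(ℝ, E) h a v)) (h a) :=
    (ofModel_toModel ha _).symm
  rw [hv, covAlong_constField_eq ha]
  rfl

end LeviCivita

/-! ### Global extension of tangent vectors -/

section Extension

variable {E : Type*} [NormedAddCommGroup E] [NormedSpace ℝ E] [FiniteDimensional ℝ E]
  {N : Type*} [TopologicalSpace N] [ChartedSpace E N] [IsManifold 𝓘(ℝ, E) ∞ N] [T2Space N]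

/-- A bump function makes the local field global; `IsKahler.parallel` speaks only of globally smooth
fields. -/
theorem exists_smooth_eventuallyEq_constField (x : N) (u : E) :
    ∃ X : ∀ y : N, TangentSpace 𝓘(ℝ, E) y,
      (∀ y, ContDiffAlongAt (EA := E) ∞ (fun y : N => y) X y) ∧
      ∀ᶠ y in 𝓝 x, X y = constField x u y := by
  obtain ⟨f⟩ : Nonempty (SmoothBumpFunction 𝓘(ℝ, E) x) := inferInstance
  refine ⟨fun y => f y • constField x u y, ?_, ?_⟩
  · have h := ContMDiffOn.smul_section_of_tsupport (n := ∞) (V := TangentSpace 𝓘(ℝ, E))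
      (s := constField x u) (ψ := f) (u := (chartAt E x).source) f.contMDiff.contMDiffOn
      (chartAt E x).open_source f.tsupport_subset_chartAt_source
      (fun y hy => (contDiffAlongAt_constField (n := ∞) hy u).contMDiffWithinAt)
    exact fun y => h y
  · filter_upwards [f.eventuallyEq_one] with y hy
    rw [hy]; exact one_smul ℝ _

theorem exists_smooth_extension (x : N) (v : TangentSpace 𝓘(ℝ, E) x) :
    ∃ X : ∀ y : N, TangentSpace 𝓘(ℝ, E) y,
      (∀ y, ContDiffAlongAt (EA := E) ∞ (fun y : N => y) X y) ∧ X x = v := by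
  obtain ⟨X, hX, hXc⟩ := exists_smooth_eventuallyEq_constField x (toModel x x v)
  exact ⟨X, hX, hXc.self_of_nhds.trans (ofModel_toModel (mem_chart_source E x) v)⟩

end Extension

/-! ### The complex structure along maps -/

section Kahler

variable {EA : Type*} [NormedAddCommGroup EA] [NormedSpace ℝ EA]
  {A : Type*} [TopologicalSpace A] [ChartedSpace EA A]
  {E : Type*} [NormedAddCommGroup E] [NormedSpace ℝ E] [FiniteDimensional ℝ E]
  {N : Type*} [TopologicalSpace N] [ChartedSpace E N] [IsManifold 𝓘(ℝ, E) ∞ N] [T2Space N]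
  [RiemannianBundle (fun y : N => TangentSpace 𝓘(ℝ, E) y)]
  [IsContMDiffRiemannianBundle 𝓘(ℝ, E) ∞ E (fun y : N => TangentSpace 𝓘(ℝ, E) y)]
  {P : ∀ y : N, TangentSpace 𝓘(ℝ, E) y →L[ℝ] TangentSpace 𝓘(ℝ, E) y}

theorem IsKahler.contDiffAlongAt (hP : IsKahler P) {h : A → N}
    {W : ∀ a, TangentSpace 𝓘(ℝ, E) (h a)} {a : A} (hW : ContDiffAlongAt (EA := EA) ∞ h W a) :
    ContDiffAlongAt (EA := EA) ∞ h (fun b => P (h b) (W b)) a := by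
  have hh : ContMDiffAt 𝓘(ℝ, EA) 𝓘(ℝ, E) ∞ h a :=
    ((contDiffAlongAt_iff (mem_chart_source E (h a))).1 hW).1
  exact ContMDiffAt.clm_bundle_apply (b := h) (hP.smooth.contMDiffAt.comp a hh) hW

/-- The complex structure of a Kähler manifold is parallel along any map. -/
theorem IsKahler.covDerivAlong_apply (hP : IsKahler P) {h : A → N}
    {W : ∀ a, TangentSpace 𝓘(ℝ, E) (h a)} {a : A} (hW : DiffAlongAt (EA := EA) h W a)
    (v : TangentSpace 𝓘(ℝ, EA) a) :
    covDerivAlong h (fun b => P (h b) (W b)) a v = P (h a) (covDerivAlong h W a v) := by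
  have ha := mem_chart_source E (h a)
  set B := Module.finBasis ℝ E
  choose X hX hXc using fun i => exists_smooth_eventuallyEq_constField (h a) (B i)
  -- The hypothesis `∇P = 0` concerns fields on `N` in both arguments, so the direction `dh v` is
  -- extended to a field as well.
  obtain ⟨V, hV, hVv⟩ := exists_smooth_extension (h a) (mfderiv 𝓘(ℝ, EA) 𝓘(ℝ, E) h a v)
  have hW' : ∀ᶠ b in 𝓝 a, W b = ∑ i, B.repr (rep (h a) h W b) i • X i (h b) := by
    have hX' : ∀ᶠ b in 𝓝 a, ∀ i, X i (h b) = constField (h a) (B i) (h b) :=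
      Filter.eventually_all.2 fun i => hW.base.continuousAt.eventually (hXc i)
    filter_upwards [eventually_eq_sum_constField W hW.base.continuousAt ha B, hX'] with b hb hb'
    rw [hb]
    simp only [hb']
  have hPW : ∀ᶠ b in 𝓝 a, P (h b) (W b) = ∑ i, B.repr (rep (h a) h W b) i • P (h b) (X i (h b)) := by
    filter_upwards [hW'] with b hb
    conv_lhs => rw [hb]
    rw [map_sum]
    simp only [map_smul]
  have hc := hW.mdifferentiableAt_coeff ha B
  have hXd : ∀ i, DiffAlongAt (EA := E) (fun y : N => y) (X i) (h a) := fun i =>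
    (hX i (h a)).diffAlongAt (by simp)
  have hPXd : ∀ i, DiffAlongAt (EA := E) (fun y : N => y) (fun y => P y (X i y)) (h a) := fun i =>
    (hP.contDiffAlongAt (hX i (h a))).diffAlongAt (by simp)
  rw [covDerivAlong_eq_covAlong_self, covDerivAlong_eq_covAlong_self,
    covAlong_eq_sum hW.base hc hXd hW' ha,
    covAlong_eq_sum (X := fun i y => P y (X i y)) hW.base hc hPXd hPW ha, map_sum]
  refine Finset.sum_congr rfl fun i _ => ?_
  have hpar := hP.parallel V (X i) (fun y _ => (hV y).contMDiffWithinAt)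
    (fun y _ => (hX i y).contMDiffWithinAt) (h a)
  simp only [leviCivita, covDerivAlong_eq_covAlong_self, hVv] at hpar
  rw [map_add, map_smul, map_smul, hpar]

end Kahler

/-! ### Smoothness tested by inner products with a frame -/

section Gram

variable {EA : Type*} [NormedAddCommGroup EA] [NormedSpace ℝ EA]
  {A : Type*} [TopologicalSpace A] [ChartedSpace EA A]
  {E : Type*} [NormedAddCommGroup E] [NormedSpace ℝ E]
  {N : Type*} [TopologicalSpace N] [ChartedSpace E N] [IsManifold 𝓘(ℝ, E) ∞ N]

theorem contDiffAlongAt_sum {n : WithTop ℕ∞}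
    [ContMDiffVectorBundle n E (TangentSpace 𝓘(ℝ, E) : N → Type _) 𝓘(ℝ, E)]
    {h : A → N} {a : A} {ι : Type*} (s : Finset ι) {W : ι → ∀ a, TangentSpace 𝓘(ℝ, E) (h a)}
    (hh : ContMDiffAt 𝓘(ℝ, EA) 𝓘(ℝ, E) n h a)
    (hW : ∀ i, ContDiffAlongAt (EA := EA) n h (W i) a) :
    ContDiffAlongAt (EA := EA) n h (fun b => ∑ i ∈ s, W i b) a := by
  classical
  have ha := mem_chart_source E (h a)
  induction s using Finset.induction_on with
  | empty =>
    simp only [Finset.sum_empty]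
    refine (contDiffAlongAt_iff ha).2 ⟨hh, (contMDiffAt_const (c := (0 : E))).congr_of_eventuallyEq ?_⟩
    filter_upwards [eventually_mem_source hh.continuousAt ha] with b hb
    rw [rep_eq hb, map_zero]
  | insert i s hi ih =>
    simp only [Finset.sum_insert hi]
    exact (hW i).add ih

theorem contMDiffAt_det {n : WithTop ℕ∞} {k : ℕ} {G : A → Matrix (Fin k) (Fin k) ℝ} {a : A}
    (hG : ∀ i j, ContMDiffAt 𝓘(ℝ, EA) 𝓘(ℝ, ℝ) n (fun b => G b i j) a) :
    ContMDiffAt 𝓘(ℝ, EA) 𝓘(ℝ, ℝ) n (fun b => (G b).det) a := by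
  simp only [Matrix.det_apply']
  refine contMDiffAt_finsetSum fun σ _ => ?_
  exact contMDiffAt_const.mul (contMDiffAt_finsetProd fun i _ => hG _ _)

theorem Matrix.cramer_mulVec {k : ℕ} (G : Matrix (Fin k) (Fin k) ℝ) (x : Fin k → ℝ) :
    G.cramer (G.mulVec x) = G.det • x := by
  rw [Matrix.cramer_eq_adjugate_mulVec, Matrix.mulVec_mulVec, Matrix.adjugate_mul,
    Matrix.smul_mulVec, Matrix.one_mulVec]

variable [RiemannianBundle (fun y : N => TangentSpace 𝓘(ℝ, E) y)]

/-- The coefficients of `Y` in the frame solve a linear system whose matrix is the Gram matrix,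
which is invertible, and whose right side is the given inner products. Cramer's rule expresses them
by quotients of determinants with `C^n` entries. -/
theorem contDiffAlongAt_of_inner {n : WithTop ℕ∞}
    [ContMDiffVectorBundle n E (TangentSpace 𝓘(ℝ, E) : N → Type _) 𝓘(ℝ, E)]
    [IsContMDiffRiemannianBundle 𝓘(ℝ, E) n E (fun y : N => TangentSpace 𝓘(ℝ, E) y)]
    {h : A → N} {a : A} {k : ℕ} {s : Fin k → ∀ a, TangentSpace 𝓘(ℝ, E) (h a)}
    {Y : ∀ a, TangentSpace 𝓘(ℝ, E) (h a)}
    (hh : ContMDiffAt 𝓘(ℝ, EA) 𝓘(ℝ, E) n h a)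
    (hs : ∀ i, ContDiffAlongAt (EA := EA) n h (s i) a)
    (hli : ∀ᶠ b in 𝓝 a, LinearIndependent ℝ (fun i => s i b))
    (hY : ∀ᶠ b in 𝓝 a, Y b ∈ Submodule.span ℝ (range fun i => s i b))
    (hin : ∀ i, ContMDiffAt 𝓘(ℝ, EA) 𝓘(ℝ, ℝ) n (fun b => inner ℝ (s i b) (Y b)) a) :
    ContDiffAlongAt (EA := EA) n h Y a := by
  set G : A → Matrix (Fin k) (Fin k) ℝ := fun b => Matrix.gram ℝ (fun i => s i b) with hGdef
  set r : A → Fin k → ℝ := fun b i => inner ℝ (s i b) (Y b) with hr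
  have hG : ∀ i j, ContMDiffAt 𝓘(ℝ, EA) 𝓘(ℝ, ℝ) n (fun b => G b i j) a := by
    intro i j
    have h1 : ContMDiffAt 𝓘(ℝ, EA) 𝓘(ℝ, ℝ) n (fun b => inner ℝ (s i b) (s j b)) a :=
      ContMDiffAt.inner_bundle (b := h) (hs i) (hs j)
    exact h1
  have hdet0 : ∀ᶠ b in 𝓝 a, (G b).det ≠ 0 := by
    filter_upwards [hli] with b hb using Matrix.det_gram_ne_zero_iff_linearIndependent.2 hb
  have hdet : ContMDiffAt 𝓘(ℝ, EA) 𝓘(ℝ, ℝ) n (fun b => ((G b).det)⁻¹) a :=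
    (contMDiffAt_det hG).inv₀ hdet0.self_of_nhds
  have hcr : ∀ i, ContMDiffAt 𝓘(ℝ, EA) 𝓘(ℝ, ℝ) n (fun b => (G b).cramer (r b) i) a := by
    intro i
    simp only [Matrix.cramer_apply]
    refine contMDiffAt_det fun j l => ?_
    by_cases hl : l = i
    · subst hl
      simpa using hin j
    · simpa [Matrix.updateCol_ne hl] using hG j l
  have hsum : ContDiffAlongAt (EA := EA) n h
      (fun b => ∑ i, (((G b).det)⁻¹ * (G b).cramer (r b) i) • s i b) a :=
    contDiffAlongAt_sum _ hh fun i => (hs i).smul (hdet.mul (hcr i))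
  refine hsum.congr ?_
  filter_upwards [hdet0, hY] with b hb hYb
  obtain ⟨x, hx⟩ := (Submodule.mem_span_range_iff_exists_fun ℝ).1 hYb
  have hrb : r b = (G b).mulVec x := by
    funext i
    simp only [hr, hGdef, Matrix.mulVec, dotProduct, Matrix.gram_apply]
    rw [← hx, inner_sum]
    refine Finset.sum_congr rfl fun j _ => ?_
    rw [real_inner_smul_right, mul_comm]
  rw [← hx]
  refine Finset.sum_congr rfl fun i _ => ?_
  rw [hrb, Matrix.cramer_mulVec, Pi.smul_apply, smul_eq_mul, inv_mul_cancel_left₀ hb]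

end Gram

/-! ### Orthogonal projection onto a subbundle -/

section Projection

variable {EA : Type*} [NormedAddCommGroup EA] [NormedSpace ℝ EA]
  {A : Type*} [TopologicalSpace A] [ChartedSpace EA A]
  {E : Type*} [NormedAddCommGroup E] [NormedSpace ℝ E] [FiniteDimensional ℝ E]
  {N : Type*} [TopologicalSpace N] [ChartedSpace E N]

instance finiteDimensionalTangentSpace (x : N) : FiniteDimensional ℝ (TangentSpace 𝓘(ℝ, E) x) :=
  inferInstanceAs (FiniteDimensional ℝ E)

variable [IsManifold 𝓘(ℝ, E) ∞ N]
  [RiemannianBundle (fun y : N => TangentSpace 𝓘(ℝ, E) y)]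
  [IsContMDiffRiemannianBundle 𝓘(ℝ, E) ∞ E (fun y : N => TangentSpace 𝓘(ℝ, E) y)]

/-- The orthogonal projection of a vector onto a subspace. -/
def tangentProj {x : N} (K : Submodule ℝ (TangentSpace 𝓘(ℝ, E) x)) (v : TangentSpace 𝓘(ℝ, E) x) :
    TangentSpace 𝓘(ℝ, E) x := K.starProjection v

theorem tangentProj_mem {x : N} (K : Submodule ℝ (TangentSpace 𝓘(ℝ, E) x))
    (v : TangentSpace 𝓘(ℝ, E) x) : tangentProj K v ∈ K := K.starProjection_apply_mem v

theorem sub_tangentProj_mem {x : N} (K : Submodule ℝ (TangentSpace 𝓘(ℝ, E) x))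
    (v : TangentSpace 𝓘(ℝ, E) x) : v - tangentProj K v ∈ Kᗮ := K.sub_starProjection_mem_orthogonal v

theorem tangentProj_eq_self {x : N} {K : Submodule ℝ (TangentSpace 𝓘(ℝ, E) x)}
    {v : TangentSpace 𝓘(ℝ, E) x} (hv : v ∈ K) : tangentProj K v = v :=
  Submodule.starProjection_eq_self_iff.2 hv

theorem tangentProj_eq_zero {x : N} {K : Submodule ℝ (TangentSpace 𝓘(ℝ, E) x)}
    {v : TangentSpace 𝓘(ℝ, E) x} (hv : v ∈ Kᗮ) : tangentProj K v = 0 :=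
  (K.starProjection_apply_eq_zero_iff).2 hv

theorem inner_tangentProj {x : N} {K : Submodule ℝ (TangentSpace 𝓘(ℝ, E) x)}
    {z : TangentSpace 𝓘(ℝ, E) x} (hz : z ∈ K) (v : TangentSpace 𝓘(ℝ, E) x) :
    inner ℝ z (tangentProj K v) = inner ℝ z v := by
  have h := K.inner_right_of_mem_orthogonal hz (sub_tangentProj_mem K v)
  rw [inner_sub_right] at h
  linarith

/-- The projection has the same inner products with the frame as `W` itself. The order `n` is kept
general because the velocity of a geodesic is only treated as `C^1`. -/
theorem contDiffAlongAt_tangentProj {n : WithTop ℕ∞}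
    [ContMDiffVectorBundle n E (TangentSpace 𝓘(ℝ, E) : N → Type _) 𝓘(ℝ, E)]
    [IsContMDiffRiemannianBundle 𝓘(ℝ, E) n E (fun y : N => TangentSpace 𝓘(ℝ, E) y)]
    {h : A → N} {a : A} {k : ℕ} {s : Fin k → ∀ a, TangentSpace 𝓘(ℝ, E) (h a)}
    {D : ∀ a, Submodule ℝ (TangentSpace 𝓘(ℝ, E) (h a))}
    {W : ∀ a, TangentSpace 𝓘(ℝ, E) (h a)}
    (hs : ∀ i, ContDiffAlongAt (EA := EA) n h (s i) a)
    (hD : ∀ᶠ b in 𝓝 a, LinearIndependent ℝ (fun i => s i b) ∧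
      Submodule.span ℝ (range fun i => s i b) = D b)
    (hW : ContDiffAlongAt (EA := EA) n h W a) :
    ContDiffAlongAt (EA := EA) n h (fun b => tangentProj (D b) (W b)) a := by
  have hh : ContMDiffAt 𝓘(ℝ, EA) 𝓘(ℝ, E) n h a :=
    ((contDiffAlongAt_iff (mem_chart_source E (h a))).1 hW).1
  refine contDiffAlongAt_of_inner hh hs (hD.mono fun b hb => hb.1) (hD.mono fun b hb => ?_) fun i => ?_
  · rw [hb.2]; exact tangentProj_mem _ _
  · have h1 : ContMDiffAt 𝓘(ℝ, EA) 𝓘(ℝ, ℝ) n (fun b => inner ℝ (s i b) (W b)) a :=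
      ContMDiffAt.inner_bundle (b := h) (hs i) hW
    refine h1.congr_of_eventuallyEq (hD.mono fun b hb => ?_)
    refine inner_tangentProj ?_ _
    rw [← hb.2]
    exact Submodule.subset_span ⟨i, rfl⟩

theorem IsSubbundleAlong.contDiffAlongAt_tangentProj {h : A → N} {a : A} {S : Set A}
    {D : ∀ a, Submodule ℝ (TangentSpace 𝓘(ℝ, E) (h a))} {W : ∀ a, TangentSpace 𝓘(ℝ, E) (h a)}
    (hD : IsSubbundleAlong (EA := EA) h D S) (ha : a ∈ S)
    (hW : ContDiffAlongAt (EA := EA) ∞ h W a) :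
    ContDiffAlongAt (EA := EA) ∞ h (fun b => tangentProj (D b) (W b)) a := by
  obtain ⟨V, hV, haV, k, s, hs, hsD⟩ := hD a ha
  exact _root_.contDiffAlongAt_tangentProj (fun i => (hs i).contMDiffAt (hV.mem_nhds haV))
    (Filter.eventually_of_mem (hV.mem_nhds haV) hsD) hW

theorem ContDiffAlongAt.sub {n : WithTop ℕ∞}
    [ContMDiffVectorBundle n E (TangentSpace 𝓘(ℝ, E) : N → Type _) 𝓘(ℝ, E)]
    {h : A → N} {a : A} {W Z : ∀ a, TangentSpace 𝓘(ℝ, E) (h a)}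
    (hW : ContDiffAlongAt (EA := EA) n h W a) (hZ : ContDiffAlongAt (EA := EA) n h Z a) :
    ContDiffAlongAt (EA := EA) n h (fun b => W b - Z b) a := by
  refine (hW.add (hZ.smul (c := fun _ => -1) contMDiffAt_const)).congr
    (Filter.Eventually.of_forall fun b => ?_)
  rw [neg_one_smul, sub_eq_add_neg]

end Projection

/-! ### The adjoint of the differential -/

section Adjoint

variable {EM : Type*} [NormedAddCommGroup EM] [NormedSpace ℝ EM] [FiniteDimensional ℝ EM]
  {M : Type*} [TopologicalSpace M] [ChartedSpace EM M] [IsManifold 𝓘(ℝ, EM) ∞ M]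
  [RiemannianBundle (fun x : M => TangentSpace 𝓘(ℝ, EM) x)]
  [IsContMDiffRiemannianBundle 𝓘(ℝ, EM) ∞ EM (fun x : M => TangentSpace 𝓘(ℝ, EM) x)]
  {EN : Type*} [NormedAddCommGroup EN] [NormedSpace ℝ EN] [FiniteDimensional ℝ EN]
  {N : Type*} [TopologicalSpace N] [ChartedSpace EN N] [IsManifold 𝓘(ℝ, EN) ∞ N]
  [RiemannianBundle (fun y : N => TangentSpace 𝓘(ℝ, EN) y)]
  [IsContMDiffRiemannianBundle 𝓘(ℝ, EN) ∞ EN (fun y : N => TangentSpace 𝓘(ℝ, EN) y)]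

/-- The adjoint of the differential. -/
def pullVec (F : M → N) (q : M) (w : TangentSpace 𝓘(ℝ, EN) (F q)) : TangentSpace 𝓘(ℝ, EM) q :=
  LinearMap.adjoint (pushforward (EM := EM) (EN := EN) F q) w

theorem inner_pullVec (F : M → N) (q : M) (w : TangentSpace 𝓘(ℝ, EN) (F q))
    (v : TangentSpace 𝓘(ℝ, EM) q) :
    inner ℝ v (pullVec (EM := EM) F q w) = inner ℝ (pushforward (EM := EM) F q v) w :=
  LinearMap.adjoint_inner_right _ _ _

/-- Tested against a coordinate frame `e_i`, the adjoint gives the smooth functions `⟨F_* e_i, W⟩`.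
For a Riemannian map the adjoint is the horizontal lift on the range, so this is what makes
horizontal lifts smooth. -/
theorem contDiffAlongAt_pullVec {F : M → N} (hF : ContMDiff 𝓘(ℝ, EM) 𝓘(ℝ, EN) ∞ F)
    {W : ∀ q, TangentSpace 𝓘(ℝ, EN) (F q)} {q : M} (hW : ContDiffAlongAt (EA := EM) ∞ F W q) :
    ContDiffAlongAt (EA := EM) ∞ (fun x : M => x) (fun x => pullVec (EM := EM) F x (W x)) q := by
  have hq := mem_chart_source EM q
  set B := Module.finBasis ℝ EM
  have hc : ∀ i, ContDiffAlongAt (EA := EM) ∞ (fun x : M => x) (constField q (B i)) q := fun i =>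
    contDiffAlongAt_constField hq _
  have hB : ∀ᶠ x in 𝓝 q, LinearIndependent ℝ (fun i => constField q (B i) x) ∧
      Submodule.span ℝ (range fun i => constField q (B i) x) = ⊤ := by
    filter_upwards [(chartAt EM q).open_source.mem_nhds hq] with x hx
    let e : EM ≃ₗ[ℝ] TangentSpace 𝓘(ℝ, EM) x := LinearEquiv.ofLinearMap (ofModel q x).toLinearMap
      (toModel q x).toLinearMap (LinearMap.ext fun v => ofModel_toModel hx v)
      (LinearMap.ext fun v => toModel_ofModel hx v)
    have he : (fun i => constField q (B i) x) = B.map e := by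
      funext i; exact (B.map_apply e i).symm
    rw [he]
    exact ⟨(B.map e).linearIndependent, (B.map e).span_eq⟩
  refine contDiffAlongAt_of_inner contMDiffAt_id hc (hB.mono fun x hx => hx.1)
    (hB.mono fun x hx => ?_) fun i => ?_
  · rw [hx.2]; exact Submodule.mem_top
  · have h1 : ContMDiffAt 𝓘(ℝ, EM) 𝓘(ℝ, ℝ) ∞ (fun x => inner ℝ
        (pushforward (EM := EM) F x (constField q (B i) x)) (W x)) q :=
      ContMDiffAt.inner_bundle (b := F) (contDiffAlongAt_pushforward hF (hc i)) hW
    refine h1.congr_of_eventuallyEq (Filter.Eventually.of_forall fun x => ?_)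
    exact inner_pullVec F x (W x) _

end Adjoint

/-! ### Smoothness of the inverse metric applied to the Christoffel form -/

section GeodesicForm

variable {E : Type*} [NormedAddCommGroup E] [NormedSpace ℝ E] [FiniteDimensional ℝ E]

/-- The Christoffel symbol of the first kind of the metric `g`, at the point `z.1` and applied twice
to the vector `z.2`. -/
def geodesicForm (g : E → E →L[ℝ] E →L[ℝ] ℝ) (z : E × E) : E →L[ℝ] ℝ :=
  (1 / 2 : ℝ) • (fderiv ℝ g z.1 z.2 z.2 + fderiv ℝ g z.1 z.2 z.2
    - ((fderiv ℝ g z.1).flip z.2).flip z.2)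

theorem ContDiffOn.fderiv_fst_snd {V : Type*} [NormedAddCommGroup V] [NormedSpace ℝ V] {g : E → V}
    {t : Set E} (ht : IsOpen t) (hg : ContDiffOn ℝ ∞ g t) {k : E × E → E}
    (hk : ContDiffOn ℝ ∞ k (t ×ˢ (univ : Set E))) :
    ContDiffOn ℝ ∞ (fun z : E × E => fderiv ℝ g z.1 (k z)) (t ×ˢ (univ : Set E)) :=
  ((hg.fderiv_of_isOpen ht (m := ∞) (by simp)).comp contDiffOn_fst fun _ hz => hz.1).clm_apply hk

theorem ContDiffOn.clm_inverse {V W : Type*} [NormedAddCommGroup V] [NormedSpace ℝ V]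
    [NormedAddCommGroup W] [NormedSpace ℝ W] [CompleteSpace V] {g : E → V →L[ℝ] W} {t : Set E}
    (hg : ContDiffOn ℝ ∞ g t) (hi : ∀ y ∈ t, (g y).IsInvertible) :
    ContDiffOn ℝ ∞ (fun y => (g y).inverse) t :=
  fun y hy => (ContDiffAt.comp_contDiffWithinAt (g := ContinuousLinearMap.inverse) y
    (hi y hy).contDiffAt_map_inverse (hg y hy))

theorem contDiffOn_geodesicForm {g : E → E →L[ℝ] E →L[ℝ] ℝ} {t : Set E} (ht : IsOpen t)
    (hg : ContDiffOn ℝ ∞ g t) : ContDiffOn ℝ ∞ (geodesicForm g) (t ×ˢ (univ : Set E)) := by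
  have hsnd : ContDiffOn ℝ ∞ (Prod.snd : E × E → E) (t ×ˢ (univ : Set E)) := contDiffOn_snd
  refine contDiffOn_clm_apply.2 fun w => ?_
  have h1 : ContDiffOn ℝ ∞ (fun z : E × E => fderiv ℝ g z.1 z.2 z.2 w) (t ×ˢ (univ : Set E)) :=
    ((hg.fderiv_fst_snd ht hsnd).clm_apply hsnd).clm_apply contDiffOn_const
  have h2 : ContDiffOn ℝ ∞ (fun z : E × E => fderiv ℝ g z.1 w z.2 z.2) (t ×ˢ (univ : Set E)) :=
    ((hg.fderiv_fst_snd ht contDiffOn_const).clm_apply hsnd).clm_apply hsnd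
  exact (contDiffOn_const (c := (1 / 2 : ℝ))).mul ((h1.add h1).sub h2)

theorem contDiffOn_inverse_geodesicForm {g : E → E →L[ℝ] E →L[ℝ] ℝ} {t : Set E} (ht : IsOpen t)
    (hg : ContDiffOn ℝ ∞ g t) (hi : ∀ y ∈ t, (g y).IsInvertible) :
    ContDiffOn ℝ ∞ (fun z : E × E => (g z.1).inverse (geodesicForm g z))
      (t ×ˢ (univ : Set E)) := by
  have : CompleteSpace E := FiniteDimensional.complete ℝ E
  have hinv : ContDiffOn ℝ ∞ (fun z : E × E => (g z.1).inverse) (t ×ˢ (univ : Set E)) :=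
    (hg.clm_inverse hi).comp contDiffOn_fst fun _ hz => hz.1
  exact hinv.clm_apply (contDiffOn_geodesicForm ht hg)

end GeodesicForm

/-! ### The geodesic equation as an ordinary differential equation -/

section GeodesicODE

variable {E : Type*} [NormedAddCommGroup E] [NormedSpace ℝ E] [FiniteDimensional ℝ E]
  {N : Type*} [TopologicalSpace N] [ChartedSpace E N] [IsManifold 𝓘(ℝ, E) ∞ N]
  [RiemannianBundle (fun y : N => TangentSpace 𝓘(ℝ, E) y)]

theorem chartAt_source_of_mem_target {p : N} {y : E} (hy : y ∈ (extChartAt 𝓘(ℝ, E) p).target) :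
    (extChartAt 𝓘(ℝ, E) p).symm y ∈ (chartAt E p).source := by
  rw [← extChartAt_source 𝓘(ℝ, E)]; exact (extChartAt 𝓘(ℝ, E) p).map_target hy

/-- Positive definiteness gives injectivity, and `E` and its dual have the same dimension. -/
theorem isInvertible_chartMetric {p : N} {y : E} (hy : y ∈ (extChartAt 𝓘(ℝ, E) p).target) :
    (chartMetric p y).IsInvertible := by
  have hx := chartAt_source_of_mem_target hy
  have hinj : Function.Injective (chartMetric p y).toLinearMap := by
    rw [← LinearMap.ker_eq_bot, LinearMap.ker_eq_bot']
    intro v hv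
    have h1 : chartMetric p y v v = 0 := by
      have : chartMetric p y v = 0 := hv
      rw [this]; rfl
    rw [← (extChartAt 𝓘(ℝ, E) p).right_inv hy, ← inner_ofModel hx, inner_self_eq_zero] at h1
    rw [← toModel_ofModel hx v, h1, map_zero]
  have hdim : Module.finrank ℝ E = Module.finrank ℝ (E →L[ℝ] ℝ) := by
    rw [← (LinearMap.toContinuousLinearMap (𝕜 := ℝ) (E := E) (F' := ℝ)).finrank_eq]
    exact Subspace.dual_finrank_eq.symm
  refine ⟨(LinearEquiv.ofInjectiveOfFinrankEq _ hinj hdim).toContinuousLinearEquiv, ?_⟩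
  ext v w
  rfl

/-- The Christoffel term of the geodesic equation in the chart at `p`. -/
def geodesicTerm (p : N) (z : E × E) : E :=
  toModel p ((extChartAt 𝓘(ℝ, E) p).symm z.1)
    (chartChristoffel p ((extChartAt 𝓘(ℝ, E) p).symm z.1) z.2 z.2)

theorem chartMetric_geodesicTerm {p : N} {z : E × E} (hz : z.1 ∈ (extChartAt 𝓘(ℝ, E) p).target) :
    chartMetric p z.1 (geodesicTerm p z) = geodesicForm (chartMetric p) z := by
  have hx := chartAt_source_of_mem_target hz
  have hr := (extChartAt 𝓘(ℝ, E) p).right_inv hz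
  ext w
  have h1 := inner_chartChristoffel p ((extChartAt 𝓘(ℝ, E) p).symm z.1) z.2 z.2
    (ofModel p ((extChartAt 𝓘(ℝ, E) p).symm z.1) w)
  rw [inner_eq_chartMetric hx, toModel_ofModel hx, hr] at h1
  rw [geodesicTerm, h1, metricDeriv, hr]
  rfl

variable [IsContMDiffRiemannianBundle 𝓘(ℝ, E) ∞ E (fun y : N => TangentSpace 𝓘(ℝ, E) y)]

/-- The Christoffel symbol is defined pointwise by Riesz representation, which does not show how it
depends on the point. Written as `g⁻¹` applied to the form of the first kind it is visibly smooth.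
-/
theorem contDiffOn_geodesicTerm (p : N) :
    ContDiffOn ℝ ∞ (geodesicTerm p) ((extChartAt 𝓘(ℝ, E) p).target ×ˢ (univ : Set E)) := by
  refine (contDiffOn_inverse_geodesicForm (isOpen_extChartAt_target p) (contDiffOn_chartMetric p)
    fun y hy => isInvertible_chartMetric hy).congr fun z hz => ?_
  rw [← chartMetric_geodesicTerm hz.1]
  exact ((isInvertible_chartMetric hz.1).inverse_apply_eq.2 rfl).symm

theorem dirDeriv_of_hasDerivAt {V : Type*} [NormedAddCommGroup V] [NormedSpace ℝ V] {k : ℝ → V}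
    {k' : V} {t : ℝ} (hk : HasDerivAt k k' t) :
    dirDeriv (EA := ℝ) k t ((1 : ℝ) : TangentSpace 𝓘(ℝ, ℝ) t) = k' := by
  have h : fderiv ℝ k t (1 : ℝ) = k' := hk.hasFDerivAt.fderiv ▸ by simp
  rw [← h]
  simp only [dirDeriv, mfld_simps]
  rfl

/-- Picard–Lindelöf, on an interval shrunk so that the solution stays in `s`. The equation then
raises the regularity: a continuous right side makes `α` of class `C^1`, and then a `C^1` right side
makes it `C^2`. -/
theorem exists_solution {f : E × E → E × E} {s : Set (E × E)} (hs : IsOpen s)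
    (hf : ContDiffOn ℝ 1 f s) {z : E × E} (hz : z ∈ s) :
    ∃ ε > (0 : ℝ), ∃ α : ℝ → E × E, α 0 = z ∧ (∀ t ∈ Ioo (-ε) ε, α t ∈ s) ∧
      (∀ t ∈ Ioo (-ε) ε, HasDerivAt α (f (α t)) t) ∧ ContDiffOn ℝ 2 α (Ioo (-ε) ε) := by
  obtain ⟨r, hr, ε, hε, hα⟩ := (hf.contDiffAt (hs.mem_nhds
    hz)).exists_forall_mem_closedBall_exists_eq_forall_mem_Ioo_hasDerivAt 0
  obtain ⟨α, hα0, hαd⟩ := hα z (Metric.mem_closedBall_self hr.le)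
  simp only [zero_sub, zero_add] at hαd
  have hcont : ContinuousAt α 0 := (hαd 0 ⟨by linarith, hε⟩).continuousAt
  obtain ⟨δ, hδ, hδs⟩ := Metric.eventually_nhds_iff.1
    (hcont.eventually (hs.mem_nhds (by rwa [hα0])))
  refine ⟨min ε δ, lt_min hε hδ, α, hα0, ?_, ?_, ?_⟩
  · intro t ht
    refine hδs ?_
    rw [Real.dist_eq, sub_zero, abs_lt]
    exact ⟨by linarith [ht.1, min_le_right ε δ], by linarith [ht.2, min_le_right ε δ]⟩
  · exact fun t ht => hαd t ⟨by linarith [ht.1, min_le_left ε δ], by linarith [ht.2, min_le_left ε δ]⟩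
  · have hmem : MapsTo α (Ioo (-(min ε δ)) (min ε δ)) s := by
      intro t ht
      refine hδs ?_
      rw [Real.dist_eq, sub_zero, abs_lt]
      exact ⟨by linarith [ht.1, min_le_right ε δ], by linarith [ht.2, min_le_right ε δ]⟩
    have hd : ∀ t ∈ Ioo (-(min ε δ)) (min ε δ), HasDerivAt α (f (α t)) t := fun t ht =>
      hαd t ⟨by linarith [ht.1, min_le_left ε δ], by linarith [ht.2, min_le_left ε δ]⟩
    have hdiff : DifferentiableOn ℝ α (Ioo (-(min ε δ)) (min ε δ)) := fun t ht =>
      (hd t ht).differentiableAt.differentiableWithinAt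
    have h1 : ContDiffOn ℝ 1 α (Ioo (-(min ε δ)) (min ε δ)) := by
      have := (contDiffOn_succ_iff_deriv_of_isOpen (𝕜 := ℝ) (n := 0) (f := α)
        (isOpen_Ioo (a := -(min ε δ)) (b := min ε δ))).2 ⟨hdiff, by simp, ?_⟩
      · simpa using this
      · refine ContDiffOn.congr ?_ fun t ht => (hd t ht).deriv
        exact contDiffOn_zero.2 (hf.continuousOn.comp hdiff.continuousOn hmem)
    have := (contDiffOn_succ_iff_deriv_of_isOpen (𝕜 := ℝ) (n := 1) (f := α)
        (isOpen_Ioo (a := -(min ε δ)) (b := min ε δ))).2 ⟨hdiff, by simp, ?_⟩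
    · exact this
    · exact (hf.comp h1 hmem).congr fun t ht => (hd t ht).deriv

end GeodesicODE

/-! ### Existence of geodesics -/

section Geodesic

variable {E : Type*} [NormedAddCommGroup E] [NormedSpace ℝ E] [FiniteDimensional ℝ E]
  {N : Type*} [TopologicalSpace N] [ChartedSpace E N] [IsManifold 𝓘(ℝ, E) ∞ N]
  [RiemannianBundle (fun y : N => TangentSpace 𝓘(ℝ, E) y)]
  [IsContMDiffRiemannianBundle 𝓘(ℝ, E) ∞ E (fun y : N => TangentSpace 𝓘(ℝ, E) y)]

/-- A geodesic is a `C^2` curve, so fields along it built from its velocity are handled in class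
`C^1`. -/
instance contMDiffVectorBundleOne : ContMDiffVectorBundle 1 E (TangentSpace 𝓘(ℝ, E) : N → Type _) 𝓘(ℝ, E) :=
  haveI : IsManifold 𝓘(ℝ, E) (1 + 1) N := IsManifold.of_le (n := ∞)
    (by rw [one_add_one_eq_two]; exact ENat.LEInfty.out)
  TangentBundle.contMDiffVectorBundle

instance isContMDiffRiemannianBundleOne :
    IsContMDiffRiemannianBundle 𝓘(ℝ, E) 1 E (fun y : N => TangentSpace 𝓘(ℝ, E) y) :=
  IsContMDiffRiemannianBundle.of_le (n := ∞) ENat.LEInfty.out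

/-- Short time existence of geodesics. -/
theorem exists_geodesic {p : N} (w : TangentSpace 𝓘(ℝ, E) p) {O : Set N} (hO : IsOpen O)
    (hp : p ∈ O) :
    ∃ ε > (0 : ℝ), ∃ β : ℝ → N, β 0 = p ∧ IsGeodesicOn (E := E) β (-ε) ε ∧
      MapsTo β (Ioo (-ε) ε) O ∧ toModel p (β 0) (velocity (E := E) β 0) = toModel p p w ∧
      (∀ t ∈ Ioo (-ε) ε, ContDiffAlongAt (EA := ℝ) 1 β (velocity (E := E) β) t) := by
  set φ := extChartAt 𝓘(ℝ, E) p with hφ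
  have hs1 : IsOpen (φ.target ∩ φ.symm ⁻¹' O) :=
    (continuousOn_extChartAt_symm p).isOpen_inter_preimage (isOpen_extChartAt_target p) hO
  set s : Set (E × E) := (φ.target ∩ φ.symm ⁻¹' O) ×ˢ (univ : Set E) with hs
  have hso : IsOpen s := hs1.prod isOpen_univ
  -- The geodesic equation as a first order system for position and velocity: `x' = u`, `u' = -Γ(u,
  -- u)`.
  have hf : ContDiffOn ℝ 1 (fun z : E × E => (z.2, -geodesicTerm p z)) s :=
    contDiffOn_snd.prodMk (((contDiffOn_geodesicTerm p).mono fun z hz => ⟨hz.1.1, hz.2⟩).neg.of_le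
      ENat.LEInfty.out)
  have hz : ((φ p, toModel p p w) : E × E) ∈ s := by
    refine ⟨⟨mem_extChartAt_target p, ?_⟩, mem_univ _⟩
    simp only [mem_preimage, hφ, extChartAt_to_inv]
    exact hp
  obtain ⟨ε, hε, α, hα0, hαs, hαd, hα2⟩ := exists_solution hso hf hz
  have h0 : (0 : ℝ) ∈ Ioo (-ε) ε := ⟨by linarith, hε⟩
  set β : ℝ → N := fun t => φ.symm (α t).1 with hβ
  have hsrc : ∀ t ∈ Ioo (-ε) ε, β t ∈ (chartAt E p).source := fun t ht =>
    chartAt_source_of_mem_target (hαs t ht).1.1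
  have hφβ : ∀ t ∈ Ioo (-ε) ε, φ (β t) = (α t).1 := fun t ht => φ.right_inv (hαs t ht).1.1
  have hβ2 : ContMDiffOn 𝓘(ℝ, ℝ) 𝓘(ℝ, E) 2 β (Ioo (-ε) ε) := by
    have h1 : ContMDiffOn 𝓘(ℝ, E) 𝓘(ℝ, E) 2 φ.symm φ.target :=
      (contMDiffOn_extChartAt_symm (n := ∞) p).of_le ENat.LEInfty.out
    exact h1.comp (contDiff_fst.comp_contDiffOn hα2).contMDiffOn fun t ht => (hαs t ht).1.1
  have hnhds : ∀ t ∈ Ioo (-ε) ε, Ioo (-ε) ε ∈ 𝓝 t := fun t ht => isOpen_Ioo.mem_nhds ht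
  have hβd : ∀ t ∈ Ioo (-ε) ε, MDifferentiableAt 𝓘(ℝ, ℝ) 𝓘(ℝ, E) β t := fun t ht =>
    (hβ2.contMDiffAt (hnhds t ht)).mdifferentiableAt (by simp)
  have hα1 : ∀ t ∈ Ioo (-ε) ε, HasDerivAt (fun t => (α t).1) (α t).2 t := fun t ht => (hαd t ht).fst
  have hα2d : ∀ t ∈ Ioo (-ε) ε, HasDerivAt (fun t => (α t).2) (-geodesicTerm p (α t)) t :=
    fun t ht => (hαd t ht).snd
  have hφd : ∀ t ∈ Ioo (-ε) ε, dirDeriv (EA := ℝ) (fun b => φ (β b)) t (1 : ℝ) = (α t).2 := by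
    intro t ht
    have he : (fun b => φ (β b)) =ᶠ[𝓝 t] fun b => (α b).1 :=
      Filter.eventually_of_mem (hnhds t ht) hφβ
    exact (dirDeriv_congr he _).trans (dirDeriv_of_hasDerivAt (hα1 t ht))
  have hvel : ∀ t ∈ Ioo (-ε) ε, toModel p (β t) (velocity β t) = (α t).2 := fun t ht =>
    (toModel_mfderiv (hβd t ht) (hsrc t ht) _).trans (hφd t ht)
  have hrep : ∀ t ∈ Ioo (-ε) ε, rep p β (velocity β) t = (α t).2 := fun t ht =>
    (rep_eq (hsrc t ht)).trans (hvel t ht)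
  have hcd : ∀ t ∈ Ioo (-ε) ε, ContDiffAlongAt (EA := ℝ) 1 β (velocity (E := E) β) t := by
    intro t ht
    refine (contDiffAlongAt_iff (hsrc t ht)).2
      ⟨(hβ2.contMDiffAt (hnhds t ht)).of_le (by norm_num), ?_⟩
    have h2 : ContMDiffAt 𝓘(ℝ, ℝ) 𝓘(ℝ, E) 1 (fun t => (α t).2) t :=
      (((contDiff_snd.comp_contDiffOn hα2).contDiffAt (hnhds t ht)).of_le
        (by norm_num)).contMDiffAt
    exact h2.congr_of_eventuallyEq (Filter.eventually_of_mem (hnhds t ht) hrep)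
  refine ⟨ε, hε, β, ?_, ⟨hβ2, fun t ht => ?_⟩, fun t ht => (hαs t ht).1.2, ?_, hcd⟩
  · simp only [hβ, hα0]; exact extChartAt_to_inv p
  · have hd := (hcd t ht).diffAlongAt (by simp)
    -- The definition of a geodesic uses the chart at `β t`, which varies with `t`, whereas the
    -- equation was solved in the chart at `p`. Here the independence of the chart is needed.
    refine (covAlong_eq_covDerivAlong hd (hsrc t ht) _).symm.trans
      ((covAlong_eq hd (hsrc t ht) _).trans ?_)
    have he : rep p β (velocity β) =ᶠ[𝓝 t] fun b => (α b).2 :=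
      Filter.eventually_of_mem (hnhds t ht) hrep
    have h3 : dirDeriv (EA := ℝ) (rep p β (velocity β)) t (1 : ℝ) = -geodesicTerm p (α t) :=
      (dirDeriv_congr he _).trans (dirDeriv_of_hasDerivAt (hα2d t ht))
    have h4 : ofModel p (β t) (geodesicTerm p (α t)) = chartChristoffel p (β t) (α t).2 (α t).2 :=
      ofModel_toModel (hsrc t ht) _
    have h5 := hφd t ht
    have h6 := hrep t ht
    calc ofModel p (β t) (dirDeriv (EA := ℝ) (rep p β (velocity β)) t (1 : ℝ))
        + chartChristoffel p (β t) (dirDeriv (EA := ℝ) (fun b => φ (β b)) t (1 : ℝ))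
          (rep p β (velocity β) t)
        = ofModel p (β t) (-geodesicTerm p (α t)) + chartChristoffel p (β t) (α t).2 (α t).2 := by
          rw [h3, h5, h6]
      _ = 0 := by rw [map_neg, h4, neg_add_cancel]
  · rw [hvel 0 h0, hα0]

end Geodesic

/-- The sine is `|x| / |x + v|`; the form without division also covers `x + v = 0`. For `v = 0` the
identity rests on the convention that the angle is `π / 2`. -/
theorem sin_angle_sq_mul_norm_sq {V : Type*} [NormedAddCommGroup V] [InnerProductSpace ℝ V]
    {x v : V} (hxv : inner ℝ x v = (0 : ℝ)) :
    Real.sin (InnerProductGeometry.angle (x + v) v) ^ 2 * inner ℝ (x + v) (x + v)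
      = (inner ℝ x x : ℝ) := by
  by_cases hv : v = 0
  · simp [hv]
  have hvv : (inner ℝ v v : ℝ) ≠ 0 := by simpa using hv
  have h := InnerProductGeometry.sin_angle_mul_norm_mul_norm (x + v) v
  have e1 : (inner ℝ (x + v) v : ℝ) = inner ℝ v v := by rw [inner_add_left, hxv, zero_add]
  have e2 : (inner ℝ (x + v) (x + v) : ℝ) = inner ℝ x x + inner ℝ v v := by
    rw [inner_add_right, e1, inner_add_left, real_inner_comm x v, hxv, add_zero]
  have h2 := congrArg (fun r => r ^ 2) h
  have hx0 : (0 : ℝ) ≤ inner ℝ x x := real_inner_self_nonneg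
  have hv0 : (0 : ℝ) ≤ inner ℝ v v := real_inner_self_nonneg
  rw [Real.sq_sqrt (by rw [e1, e2]; nlinarith), mul_pow, mul_pow, ← real_inner_self_eq_norm_sq,
    ← real_inner_self_eq_norm_sq, e1] at h2
  refine mul_right_cancel₀ hvv ?_
  rw [e2] at h2 ⊢
  linarith

/-! ### Clairaut's relation implies umbilicity -/

section Clairaut

variable {E : Type*} [NormedAddCommGroup E] [NormedSpace ℝ E] [FiniteDimensional ℝ E]
  {N : Type*} [TopologicalSpace N] [ChartedSpace E N] [IsManifold 𝓘(ℝ, E) ∞ N]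
  [RiemannianBundle (fun y : N => TangentSpace 𝓘(ℝ, E) y)]
  [IsContMDiffRiemannianBundle 𝓘(ℝ, E) ∞ E (fun y : N => TangentSpace 𝓘(ℝ, E) y)]
  {R : ∀ y : N, Submodule ℝ (TangentSpace 𝓘(ℝ, E) y)} {O : Set N} {f : N → ℝ} {β : ℝ → N} {ε : ℝ}

theorem IsSubbundleAlong.diffAlongAt_tangentProj_comp
    (hR : IsSubbundleAlong (EA := E) (A := N) (fun y => y) R O) {W : ∀ t, TangentSpace 𝓘(ℝ, E) (β t)}
    {t : ℝ} (ht : β t ∈ O) (hW : ContDiffAlongAt (EA := ℝ) 1 β W t) :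
    DiffAlongAt (EA := ℝ) β (fun b => tangentProj (R (β b)) (W b)) t := by
  obtain ⟨V, hV, haV, k, s, hs, hsD⟩ := hR _ ht
  have hβ : ContMDiffAt 𝓘(ℝ, ℝ) 𝓘(ℝ, E) 1 β t :=
    ((contDiffAlongAt_iff (mem_chart_source E (β t))).1 hW).1
  have hs' : ∀ i, ContDiffAlongAt (EA := ℝ) 1 β (fun b => s i (β b)) t := fun i =>
    (((hs i).contMDiffAt (hV.mem_nhds haV)).of_le ENat.LEInfty.out).comp t hβ
  refine (_root_.contDiffAlongAt_tangentProj hs' ?_ hW).diffAlongAt (by simp)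
  filter_upwards [hβ.continuousAt.eventually (hV.mem_nhds haV)] with b hb using hsD _ hb

theorem tangentProj_add {x : N} (K : Submodule ℝ (TangentSpace 𝓘(ℝ, E) x))
    (v w : TangentSpace 𝓘(ℝ, E) x) : tangentProj K (v + w) = tangentProj K v + tangentProj K w :=
  map_add K.starProjection v w

/-- Clairaut's relation, differentiated along a geodesic. -/
theorem ClairautCondition.inner_covDerivAlong (hR : IsSubbundleAlong (EA := E) (A := N) (fun y => y) R O)
    (hC : ClairautCondition R O (fun y => Real.exp (f y)))
    (hf : ContMDiff 𝓘(ℝ, E) 𝓘(ℝ, ℝ) ∞ f) (hε : 0 < ε) (hβ : IsGeodesicOn (E := E) β (-ε) ε)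
    (hβO : MapsTo β (Ioo (-ε) ε) O)
    (hd : ∀ t ∈ Ioo (-ε) ε, ContDiffAlongAt (EA := ℝ) 1 β (velocity (E := E) β) t) :
    inner ℝ (covDerivAlong (EA := ℝ) β (fun t => tangentProj (R (β t)) (velocity (E := E) β t)) 0 (1 : ℝ))
        (tangentProj (R (β 0)) (velocity (E := E) β 0))
      = -(dirDeriv f (β 0) (velocity (E := E) β 0)
        * inner ℝ (tangentProj (R (β 0)) (velocity (E := E) β 0))
          (tangentProj (R (β 0)) (velocity (E := E) β 0))) := by
  have h0 : (0 : ℝ) ∈ Ioo (-ε) ε := ⟨by linarith, hε⟩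
  set X : ∀ t, TangentSpace 𝓘(ℝ, E) (β t) := fun t => tangentProj (R (β t)) (velocity (E := E) β t)
    with hX
  have hvd := (hd 0 h0).diffAlongAt (by simp)
  have hXd : DiffAlongAt (EA := ℝ) β X 0 := hR.diffAlongAt_tangentProj_comp (hβO h0) (hd 0 h0)
  set V : ∀ t, TangentSpace 𝓘(ℝ, E) (β t) := fun t => velocity (E := E) β t - X t with hV
  set C := Real.exp (f (β 0)) * Real.sin (InnerProductGeometry.angle (velocity (E := E) β 0) (V 0))
  -- Squaring Clairaut's relation and multiplying by `|β'|²` removes the angle, leaving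
  -- differentiable functions on both sides.
  have hconst : ∀ t ∈ Ioo (-ε) ε, Real.exp (f (β t)) ^ 2 * inner ℝ (X t) (X t)
      = C ^ 2 * inner ℝ (velocity (E := E) β t) (velocity (E := E) β t) := by
    intro t ht
    have h1 := hC _ _ β hβ hβO X V (fun t _ => ⟨tangentProj_mem _ _, sub_tangentProj_mem _ _,
      (add_sub_cancel _ _).symm⟩) t ht 0 h0
    have h2 : (inner ℝ (X t) (V t) : ℝ) = 0 :=
      Submodule.inner_right_of_mem_orthogonal (tangentProj_mem _ _) (sub_tangentProj_mem _ _)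
    have h3 := sin_angle_sq_mul_norm_sq h2
    have h4 : X t + V t = velocity (E := E) β t := add_sub_cancel _ _
    rw [h4] at h3
    simp only at h1
    rw [← h3, ← mul_assoc, ← mul_pow, h1]
  have hcd : MDifferentiableAt 𝓘(ℝ, E) 𝓘(ℝ, ℝ) f (β 0) := hf.mdifferentiableAt (by simp)
  have hfβ : MDifferentiableAt 𝓘(ℝ, ℝ) 𝓘(ℝ, ℝ) (fun t => f (β t)) 0 := hcd.comp 0 hvd.base
  have hG : HasDerivAt (fun r : ℝ => Real.exp r ^ 2)
      (2 * Real.exp (f (β 0)) ^ 2) (f (β 0)) := by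
    have := (Real.hasDerivAt_exp (f (β 0))).pow 2
    refine this.congr_deriv ?_
    simp; ring
  have hGβ : MDifferentiableAt 𝓘(ℝ, ℝ) 𝓘(ℝ, ℝ) (fun t => Real.exp (f (β t)) ^ 2) 0 :=
    MDifferentiableAt.comp (I' := 𝓘(ℝ, ℝ)) (g := fun r : ℝ => Real.exp r ^ 2) 0
      hG.differentiableAt.mdifferentiableAt hfβ
  have hin : ∀ {W : ∀ t, TangentSpace 𝓘(ℝ, E) (β t)}, DiffAlongAt (EA := ℝ) β W 0 →
      MDifferentiableAt 𝓘(ℝ, ℝ) 𝓘(ℝ, ℝ) (fun t => (inner ℝ (W t) (W t) : ℝ)) 0 := fun {W} hW =>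
    MDifferentiableAt.inner_bundle (b := β) hW hW
  have e1 := dirDeriv_smul (EA := ℝ) hGβ (hin hXd) (1 : ℝ)
  have e2 := dirDeriv_smul (EA := ℝ) (c := fun _ : ℝ => C ^ 2) (a := (0 : ℝ)) mdifferentiableAt_const
    (hin hvd) (1 : ℝ)
  have e3 : dirDeriv (EA := ℝ) (fun t => Real.exp (f (β t)) ^ 2 • (inner ℝ (X t) (X t) : ℝ)) 0 (1 : ℝ)
      = dirDeriv (EA := ℝ) (fun t => C ^ 2 • (inner ℝ (velocity (E := E) β t) (velocity (E := E) β t) : ℝ))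
        0 (1 : ℝ) :=
    dirDeriv_congr (Filter.eventually_of_mem (isOpen_Ioo.mem_nhds h0) hconst) _
  have hs := mem_chart_source E (β 0)
  have e4 := dirDeriv_inner hXd hXd hs (1 : ℝ)
  have e5 := dirDeriv_inner hvd hvd hs (1 : ℝ)
  -- The geodesic equation: `|β'|²` has derivative zero, so the right side of `hconst` drops out
  -- after differentiation.
  have e6 : covAlong (β 0) β (velocity (E := E) β) 0 (1 : ℝ) = 0 := hβ.2 0 h0
  have e7 : dirDeriv (EA := ℝ) (fun t => Real.exp (f (β t)) ^ 2) 0 (1 : ℝ)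
      = 2 * Real.exp (f (β 0)) ^ 2 * dirDeriv f (β 0) (velocity (E := E) β 0) := by
    have h1 := dirDeriv_comp (EA := ℝ) (k := fun t => f (β t)) (a := (0 : ℝ))
      (G := fun r : ℝ => Real.exp r ^ 2) hG.differentiableAt hfβ (1 : ℝ)
    refine h1.trans ?_
    rw [hG.hasFDerivAt.fderiv]
    have h2 := dirDeriv_comp_map hcd hvd.base (1 : ℝ)
    simp only [ContinuousLinearMap.toSpanSingleton_apply]
    rw [h2]
    simp only [smul_eq_mul]
    exact mul_comm _ _
  have e8 : dirDeriv (EA := ℝ) (fun _ : ℝ => C ^ 2) 0 (1 : ℝ) = 0 := dirDeriv_const _ _ _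
  have e9 := e1.symm.trans (e3.trans e2)
  rw [e4, e5, e6, e7, e8] at e9
  have hpos : Real.exp (f (β 0)) ^ 2 ≠ 0 := by positivity
  rw [inner_zero_left, inner_zero_right] at e9
  simp only [smul_eq_mul, add_zero, zero_mul, mul_zero] at e9
  rw [real_inner_comm (covAlong (β 0) β X 0 (1 : ℝ)) (X 0)] at e9
  have e10 : Real.exp (f (β 0)) ^ 2 * (2 * (inner ℝ (covAlong (β 0) β X 0 (1 : ℝ)) (X 0)
    + dirDeriv f (β 0) (velocity (E := E) β 0) * inner ℝ (X 0) (X 0))) = 0 := by linarith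
  have e11 := (mul_eq_zero.1 e10).resolve_left hpos
  have e12 : covDerivAlong (EA := ℝ) β X 0 (1 : ℝ) = covAlong (β 0) β X 0 (1 : ℝ) := rfl
  rw [e12]
  linarith

/-- The fibres of a Clairaut distribution `R` with totally geodesic complement are umbilical, with
mean curvature `-grad f`. -/
theorem ClairautCondition.inner_covDerivAlong_field [T2Space N] (hO : IsOpen O)
    (hR : IsSubbundleAlong (EA := E) (A := N) (fun y => y) R O)
    (hT : IsTotallyGeodesicOn (fun y => (R y)ᗮ) O)
    (hC : ClairautCondition R O (fun y => Real.exp (f y)))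
    (hf : ContMDiff 𝓘(ℝ, E) 𝓘(ℝ, ℝ) ∞ f) {Z : ∀ y : N, TangentSpace 𝓘(ℝ, E) y}
    (hZ : IsSectionOn (fun y => (R y)ᗮ) O Z) {p : N} (hp : p ∈ O) {x : TangentSpace 𝓘(ℝ, E) p}
    (hx : x ∈ R p) :
    inner ℝ x (covDerivAlong (EA := E) (fun y : N => y) Z p x)
      = dirDeriv f p (Z p) * inner ℝ x x := by
  -- The statement with an additional term `df(x) |x|²`, obtained from the geodesic with initial
  -- velocity `x + Z p`.
  have main : ∀ Z : ∀ y : N, TangentSpace 𝓘(ℝ, E) y, IsSectionOn (fun y => (R y)ᗮ) O Z →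
      inner ℝ x (covDerivAlong (EA := E) (fun y : N => y) Z p x)
        = dirDeriv f p (x + Z p) * inner ℝ x x := by
    intro Z hZ
    obtain ⟨ε, hε, β, rfl, hβ, hβO, hw, hd⟩ := exists_geodesic (x + Z p) hO hp
    have hv : velocity (E := E) β 0 = x + Z (β 0) := by
      rw [toModel_self, toModel_self] at hw; exact hw
    have h0 : (0 : ℝ) ∈ Ioo (-ε) ε := ⟨by linarith, hε⟩
    have hs := mem_chart_source E (β 0)
    have key := hC.inner_covDerivAlong hR hf hε hβ hβO hd
    set X : ∀ t, TangentSpace 𝓘(ℝ, E) (β t) := fun t => tangentProj (R (β t)) (velocity (E := E) β t)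
      with hX
    have hX0 : X 0 = x := by
      have h1 := tangentProj_add (R (β 0)) x (Z (β 0))
      rw [tangentProj_eq_self hx, tangentProj_eq_zero (hZ.2 _ hp), add_zero] at h1
      rw [hX]
      simp only
      rw [hv]
      exact h1
    have hvd := (hd 0 h0).diffAlongAt (by simp)
    have hXd : DiffAlongAt (EA := ℝ) β X 0 := hR.diffAlongAt_tangentProj_comp hp (hd 0 h0)
    have hZd : DiffAlongAt (EA := E) (fun y : N => y) Z (β 0) :=
      (hZ.1.contMDiffAt (hO.mem_nhds hp)).mdifferentiableAt (by simp)
    have e1 := dirDeriv_inner hXd hXd hs (1 : ℝ)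
    have e2 := dirDeriv_inner hXd hvd hs (1 : ℝ)
    have e3 := dirDeriv_inner hXd (hZd.comp hvd.base) hs (1 : ℝ)
    -- Differentiating `⟨X, β'⟩ = ⟨X, X⟩` along the geodesic gives `⟨∇X, x + Z⟩ = 2 ⟨∇X, x⟩`, that
    -- is `⟨∇X, Z⟩ = ⟨∇X, x⟩`.
    have e4 : dirDeriv (EA := ℝ) (fun t => (inner ℝ (X t) (velocity (E := E) β t) : ℝ)) 0 (1 : ℝ)
        = dirDeriv (EA := ℝ) (fun t => (inner ℝ (X t) (X t) : ℝ)) 0 (1 : ℝ) :=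
      dirDeriv_congr (Filter.Eventually.of_forall fun t =>
        (inner_tangentProj (tangentProj_mem _ _) _).symm) _
    have e5 : dirDeriv (EA := ℝ) (fun t => (inner ℝ (X t) (Z (β t)) : ℝ)) 0 (1 : ℝ) = 0 := by
      refine (dirDeriv_congr (l := fun _ => (0 : ℝ)) ?_ _).trans (dirDeriv_const _ _ _)
      refine Filter.eventually_of_mem (isOpen_Ioo.mem_nhds h0) fun t ht => ?_
      exact Submodule.inner_right_of_mem_orthogonal (tangentProj_mem _ _) (hZ.2 _ (hβO ht))
    have e6 : covAlong (β 0) β (velocity (E := E) β) 0 (1 : ℝ) = 0 := hβ.2 0 h0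
    have e7 := covAlong_comp hZd hvd.base hs (1 : ℝ)
    have e8 : mfderiv 𝓘(ℝ, ℝ) 𝓘(ℝ, E) β 0 (1 : ℝ) = x + Z (β 0) := hv
    rw [e8, covAlong_add_dir] at e7
    -- Total geodesy of `R^⊥` removes the `∇_Z Z` part of `∇_{x + Z} Z`.
    have e9 : covAlong (β 0) (fun y : N => y) Z (β 0) (Z (β 0)) ∈ (R (β 0))ᗮ := hT Z Z hZ hZ _ hp
    have e10 := Submodule.inner_right_of_mem_orthogonal hx e9
    have e11 : inner ℝ (covAlong (β 0) β X 0 (1 : ℝ)) (X 0)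
      = -(dirDeriv f (β 0) (velocity (E := E) β 0) * inner ℝ (X 0) (X 0)) := key
    rw [e4, e1, e6, inner_zero_right, hX0, hv, inner_add_right,
      real_inner_comm (covAlong (β 0) β X 0 (1 : ℝ)) x] at e2
    rw [e5, e7, hX0, inner_add_right, e10] at e3
    rw [hX0, hv] at e11
    change inner ℝ x (covAlong (β 0) (fun y : N => y) Z (β 0) x) = _
    linarith
  -- For the zero section `main` reads `0 = df(x) |x|²`, which removes the additional term.
  have hZ0 : IsSectionOn (fun y => (R y)ᗮ) O (fun y => (0 : TangentSpace 𝓘(ℝ, E) y)) := by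
    refine ⟨fun y _ => ContMDiffAt.contMDiffWithinAt ?_, fun y _ => Submodule.zero_mem _⟩
    exact contDiffAlongAt_sum (h := fun y : N => y) (W := fun (i : Fin 0) _ => 0) Finset.univ contMDiffAt_id
      fun i => i.elim0
  have h1 := main Z hZ
  have h2 := main _ hZ0
  have h3 := (covAlong_zero (EA := E) (h := fun y : N => y) (a := p) mdifferentiableAt_id
    (mem_chart_source E p) x).2
  have h4 : covDerivAlong (EA := E) (fun y : N => y) (fun y => (0 : TangentSpace 𝓘(ℝ, E) y)) p x = 0 :=
    h3
  rw [h4, inner_zero_right, add_zero] at h2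
  rw [h1, dirDeriv_add_right]
  linarith

end Clairaut

/-! ### Riemannian maps: horizontal lifts and the second fundamental form -/

section RiemannianMap

variable {EM : Type*} [NormedAddCommGroup EM] [NormedSpace ℝ EM] [FiniteDimensional ℝ EM]
  {M : Type*} [TopologicalSpace M] [ChartedSpace EM M] [IsManifold 𝓘(ℝ, EM) ∞ M]
  [RiemannianBundle (fun x : M => TangentSpace 𝓘(ℝ, EM) x)]
  [IsContMDiffRiemannianBundle 𝓘(ℝ, EM) ∞ EM (fun x : M => TangentSpace 𝓘(ℝ, EM) x)]
  {EN : Type*} [NormedAddCommGroup EN] [NormedSpace ℝ EN] [FiniteDimensional ℝ EN]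
  {N : Type*} [TopologicalSpace N] [ChartedSpace EN N] [IsManifold 𝓘(ℝ, EN) ∞ N]
  [RiemannianBundle (fun y : N => TangentSpace 𝓘(ℝ, EN) y)]
  [IsContMDiffRiemannianBundle 𝓘(ℝ, EN) ∞ EN (fun y : N => TangentSpace 𝓘(ℝ, EN) y)]
  {F : M → N}

theorem pullVec_mem_horizontal (F : M → N) (q : M) (w : TangentSpace 𝓘(ℝ, EN) (F q)) :
    pullVec (EM := EM) (EN := EN) F q w ∈ horizontal (EM := EM) (EN := EN) F q := by
  refine (Submodule.mem_orthogonal _ _).2 fun u hu => ?_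
  have hu' : pushforward (EM := EM) (EN := EN) F q u = 0 := hu
  rw [inner_pullVec, hu', inner_zero_left]

/-- The difference `d` of the two sides is horizontal, and `⟨d, d⟩ = ⟨F_* d, F_* v⟩ - ⟨d, v⟩`
vanishes by the isometry property. -/
theorem IsRiemannianMap.pullVec_pushforward (hF : IsRiemannianMap (EM := EM) (EN := EN) F) {q : M}
    {v : TangentSpace 𝓘(ℝ, EM) q} (hv : v ∈ horizontal (EM := EM) (EN := EN) F q) :
    pullVec (EM := EM) (EN := EN) F q (pushforward (EM := EM) (EN := EN) F q v) = v := by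
  have hd : pullVec (EM := EM) (EN := EN) F q (pushforward (EM := EM) (EN := EN) F q v) - v
      ∈ horizontal (EM := EM) (EN := EN) F q :=
    Submodule.sub_mem _ (pullVec_mem_horizontal _ _ _) hv
  refine sub_eq_zero.1 ((inner_self_eq_zero (𝕜 := ℝ)).1 ?_)
  rw [inner_sub_right, inner_pullVec, hF.isometry q _ hd _ hv, sub_self]

theorem IsRiemannianMap.pushforward_pullVec (hF : IsRiemannianMap (EM := EM) (EN := EN) F) {q : M}
    {w : TangentSpace 𝓘(ℝ, EN) (F q)} (hw : w ∈ rangeBundle (EM := EM) (EN := EN) F q) :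
    pushforward (EM := EM) (EN := EN) F q (pullVec (EM := EM) (EN := EN) F q w) = w := by
  obtain ⟨v, rfl⟩ := hw
  set K := horizontal (EM := EM) (EN := EN) F q
  have h2 : v - tangentProj K v ∈ vertical (EM := EM) (EN := EN) F q := by
    have h3 := sub_tangentProj_mem K v
    rwa [show Kᗮ = vertical (EM := EM) (EN := EN) F q from Submodule.orthogonal_orthogonal _] at h3
  have h4 : pushforward (EM := EM) (EN := EN) F q (v - tangentProj K v) = 0 := h2
  rw [map_sub, sub_eq_zero] at h4
  rw [h4, hF.pullVec_pushforward (tangentProj_mem K v)]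

theorem IsRiemannianMap.sub_pullVec_pushforward_mem (hF : IsRiemannianMap (EM := EM) (EN := EN) F)
    {q : M} (v : TangentSpace 𝓘(ℝ, EM) q) :
    v - pullVec (EM := EM) (EN := EN) F q (pushforward (EM := EM) (EN := EN) F q v)
      ∈ vertical (EM := EM) (EN := EN) F q := by
  change pushforward (EM := EM) (EN := EN) F q _ = 0
  rw [map_sub, hF.pushforward_pullVec ⟨v, rfl⟩, sub_self]

/-- One horizontal argument suffices: the vertical part of `z` contributes nothing on either side.
-/
theorem IsRiemannianMap.inner_eq (hF : IsRiemannianMap (EM := EM) (EN := EN) F) {q : M}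
    {v : TangentSpace 𝓘(ℝ, EM) q} (hv : v ∈ horizontal (EM := EM) (EN := EN) F q)
    (z : TangentSpace 𝓘(ℝ, EM) q) :
    (inner ℝ (pushforward (EM := EM) (EN := EN) F q z) (pushforward (EM := EM) (EN := EN) F q v) : ℝ) = inner ℝ z v := by
  rw [← inner_pullVec, hF.pullVec_pushforward hv]

theorem covDerivAlong_pushforward_sub (hF : ContMDiff 𝓘(ℝ, EM) 𝓘(ℝ, EN) ∞ F)
    {X Y : ∀ q : M, TangentSpace 𝓘(ℝ, EM) q} {q : M}
    (hX : DiffAlongAt (EA := EM) (fun y : M => y) X q)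
    (hY : DiffAlongAt (EA := EM) (fun y : M => y) Y q) :
    covDerivAlong (EA := EM) (E := EN) F (fun x => pushforward (EM := EM) (EN := EN) F x (Y x)) q (X q)
        - covDerivAlong (EA := EM) (E := EN) F (fun x => pushforward (EM := EM) (EN := EN) F x (X x)) q (Y q)
      = pushforward (EM := EM) (EN := EN) F q (VectorField.mlieBracket 𝓘(ℝ, EM) X Y q) :=
  covAlong_pushforward_sub hF (mem_chart_source EN (F q)) hX hY

theorem leviCivita_sub {X Y : ∀ q : M, TangentSpace 𝓘(ℝ, EM) q} {q : M}
    (hX : DiffAlongAt (EA := EM) (fun y : M => y) X q)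
    (hY : DiffAlongAt (EA := EM) (fun y : M => y) Y q) :
    leviCivita X Y q - leviCivita Y X q = VectorField.mlieBracket 𝓘(ℝ, EM) X Y q :=
  covAlong_sub_of_mlieBracket (mem_chart_source EM q) hX hY

theorem dirDeriv_inner_leviCivita {X Y Z : ∀ q : M, TangentSpace 𝓘(ℝ, EM) q} {q : M}
    (hY : DiffAlongAt (EA := EM) (fun y : M => y) Y q)
    (hZ : DiffAlongAt (EA := EM) (fun y : M => y) Z q) :
    dirDeriv (fun x => (inner ℝ (Y x) (Z x) : ℝ)) q (X q)
      = inner ℝ (leviCivita X Y q) (Z q) + inner ℝ (Y q) (leviCivita X Z q) :=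
  dirDeriv_inner hY hZ (mem_chart_source EM q) (X q)

theorem dirDeriv_inner_covDerivAlong {W Z : ∀ q, TangentSpace 𝓘(ℝ, EN) (F q)} {q : M}
    (hW : DiffAlongAt (EA := EM) F W q) (hZ : DiffAlongAt (EA := EM) F Z q)
    (x : TangentSpace 𝓘(ℝ, EM) q) :
    dirDeriv (fun y => (inner ℝ (W y) (Z y) : ℝ)) q x
      = inner ℝ (covDerivAlong F W q x) (Z q) + inner ℝ (W q) (covDerivAlong F Z q x) :=
  dirDeriv_inner hW hZ (mem_chart_source EN (F q)) x

theorem inner_covDerivAlong_of_eventually_orthogonal {W Z : ∀ q, TangentSpace 𝓘(ℝ, EN) (F q)} {q : M}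
    (hW : DiffAlongAt (EA := EM) F W q) (hZ : DiffAlongAt (EA := EM) F Z q)
    (hWZ : ∀ᶠ y in 𝓝 q, (inner ℝ (W y) (Z y) : ℝ) = 0) (x : TangentSpace 𝓘(ℝ, EM) q) :
    (inner ℝ (covDerivAlong F W q x) (Z q) : ℝ) = -inner ℝ (W q) (covDerivAlong F Z q x) := by
  have h1 := dirDeriv_inner_covDerivAlong hW hZ x
  have h2 : dirDeriv (fun y => (inner ℝ (W y) (Z y) : ℝ)) q x = 0 :=
    (dirDeriv_congr (l := fun _ => (0 : ℝ)) hWZ x).trans (dirDeriv_const _ _ _)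
  rw [h2] at h1
  linarith

theorem DiffAlongAt.pushforward (hF : ContMDiff 𝓘(ℝ, EM) 𝓘(ℝ, EN) ∞ F)
    {X : ∀ q : M, TangentSpace 𝓘(ℝ, EM) q} {q : M}
    (hX : DiffAlongAt (EA := EM) (fun y : M => y) X q) :
    DiffAlongAt (EA := EM) F (fun x => _root_.pushforward (EM := EM) (EN := EN) F x (X x)) q :=
  diffAlongAt_pushforward hF hX

theorem ContDiffAlongAt.pushforward (hF : ContMDiff 𝓘(ℝ, EM) 𝓘(ℝ, EN) ∞ F)
    {X : ∀ q : M, TangentSpace 𝓘(ℝ, EM) q} {q : M}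
    (hX : ContDiffAlongAt (EA := EM) ∞ (fun y : M => y) X q) :
    ContDiffAlongAt (EA := EM) ∞ F (fun x => _root_.pushforward (EM := EM) (EN := EN) F x (X x)) q :=
  contDiffAlongAt_pushforward hF hX

/-- The second fundamental form of a Riemannian map, applied to horizontal fields, is orthogonal to
the range. -/
theorem IsRiemannianMap.inner_covDerivAlong_pushforward
    (hF : IsRiemannianMap (EM := EM) (EN := EN) F) {X Y Z : ∀ q : M, TangentSpace 𝓘(ℝ, EM) q} {q : M}
    (hX : DiffAlongAt (EA := EM) (fun y : M => y) X q)
    (hY : DiffAlongAt (EA := EM) (fun y : M => y) Y q)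
    (hZ : DiffAlongAt (EA := EM) (fun y : M => y) Z q)
    (hXh : ∀ x, X x ∈ horizontal (EM := EM) (EN := EN) F x)
    (hYh : ∀ x, Y x ∈ horizontal (EM := EM) (EN := EN) F x)
    (hZh : ∀ x, Z x ∈ horizontal (EM := EM) (EN := EN) F x) :
    (inner ℝ (covDerivAlong (EA := EM) (E := EN) F (fun x => pushforward (EM := EM) (EN := EN) F x (Y x)) q (X q))
      (pushforward (EM := EM) (EN := EN) F q (Z q)) : ℝ) = inner ℝ (leviCivita X Y q) (Z q) := by
  -- The defect `T` is skew in the last two arguments, as both connections are metric and `F_*` is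
  -- isometric, and symmetric in the first two, as both are torsion-free; therefore it vanishes. All
  -- three fields must be horizontal because the argument permutes them.
  set T : (∀ q : M, TangentSpace 𝓘(ℝ, EM) q) → (∀ q : M, TangentSpace 𝓘(ℝ, EM) q) →
      (∀ q : M, TangentSpace 𝓘(ℝ, EM) q) → ℝ := fun X Y Z =>
    inner ℝ (covDerivAlong (EA := EM) (E := EN) F (fun x => pushforward (EM := EM) (EN := EN) F x (Y x)) q (X q))
      (pushforward (EM := EM) (EN := EN) F q (Z q)) - inner ℝ (leviCivita X Y q) (Z q) with hT
  have skew : ∀ X Y Z : ∀ q : M, TangentSpace 𝓘(ℝ, EM) q,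
      DiffAlongAt (EA := EM) (fun y : M => y) Y q → DiffAlongAt (EA := EM) (fun y : M => y) Z q →
      (∀ x, Z x ∈ horizontal (EM := EM) (EN := EN) F x) → T X Y Z + T X Z Y = 0 := by
    intro X Y Z hY hZ hZh
    have h1 := dirDeriv_inner_leviCivita (X := X) hY hZ
    have h2 := dirDeriv_inner_covDerivAlong (hY.pushforward hF.smooth) (hZ.pushforward hF.smooth) (X q)
    have h3 : (fun x => (inner ℝ (pushforward (EM := EM) (EN := EN) F x (Y x)) (pushforward (EM := EM) (EN := EN) F x (Z x)) : ℝ))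
        = fun x => inner ℝ (Y x) (Z x) := funext fun x => hF.inner_eq (hZh x) (Y x)
    rw [h3, h1] at h2
    simp only [hT]
    rw [real_inner_comm (pushforward (EM := EM) (EN := EN) F q (Y q)), real_inner_comm (Y q)]
    linarith
  have symm : ∀ X Y Z : ∀ q : M, TangentSpace 𝓘(ℝ, EM) q,
      DiffAlongAt (EA := EM) (fun y : M => y) X q → DiffAlongAt (EA := EM) (fun y : M => y) Y q →
      (∀ x, Z x ∈ horizontal (EM := EM) (EN := EN) F x) → T X Y Z = T Y X Z := by
    intro X Y Z hX hY hZh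
    have h1 := covDerivAlong_pushforward_sub hF.smooth hX hY
    have h2 := leviCivita_sub hX hY
    have h3 := hF.inner_eq (hZh q) (VectorField.mlieBracket 𝓘(ℝ, EM) X Y q)
    rw [← h1, ← h2, inner_sub_left, inner_sub_left] at h3
    simp only [hT]
    linarith
  have e1 := skew X Y Z hY hZ hZh
  have e2 := symm X Z Y hX hZ hYh
  have e3 := skew Z X Y hX hY hYh
  have e4 := symm Z Y X hZ hY hXh
  have e5 := skew Y Z X hZ hX hXh
  have e6 := symm Y X Z hY hX hZh
  have e7 : T X Y Z = 0 := by linarith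
  simp only [hT] at e7
  linarith

/-- Differentiating `⟨Y, U⟩ = 0` gives `-⟨Y, ∇_X U⟩`. Since `F_* U = 0`, the second fundamental form
is just `-F_* (∇_X U)`, and `F_*` preserves products with the horizontal `Y`. -/
theorem IsRiemannianMap.inner_leviCivita_vertical
    (hF : IsRiemannianMap (EM := EM) (EN := EN) F) {X Y U : ∀ q : M, TangentSpace 𝓘(ℝ, EM) q} {q : M}
    (hY : DiffAlongAt (EA := EM) (fun y : M => y) Y q)
    (hU : DiffAlongAt (EA := EM) (fun y : M => y) U q)
    (hYh : ∀ x, Y x ∈ horizontal (EM := EM) (EN := EN) F x)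
    (hUv : ∀ x, U x ∈ vertical (EM := EM) (EN := EN) F x) :
    (inner ℝ (leviCivita X Y q) (U q) : ℝ)
      = inner ℝ (pushforward (EM := EM) (EN := EN) F q (Y q)) (secondFundamentalForm (EN := EN) F X U q) := by
  have h1 := dirDeriv_inner_leviCivita (X := X) hY hU
  have h2 : dirDeriv (fun x => (inner ℝ (Y x) (U x) : ℝ)) q (X q) = 0 := by
    refine (dirDeriv_congr (l := fun _ => (0 : ℝ)) (Filter.Eventually.of_forall fun x => ?_) _).trans
      (dirDeriv_const _ _ _)
    exact Submodule.inner_left_of_mem_orthogonal (hUv x) (hYh x)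
  have hd : MDifferentiableAt 𝓘(ℝ, EM) 𝓘(ℝ, EN) F q := hF.smooth.mdifferentiableAt (by simp)
  have h3 : covDerivAlong (EA := EM) (E := EN) F (fun x => pushforward (EM := EM) (EN := EN) F x (U x)) q (X q) = 0 := by
    have h4 : (fun x => pushforward (EM := EM) (EN := EN) F x (U x)) = fun x => 0 := funext fun x => hUv x
    rw [h4]
    exact (covAlong_zero hd (mem_chart_source EN (F q)) (X q)).2
  have h5 := hF.inner_eq (hYh q) (leviCivita X U q)
  rw [real_inner_comm, real_inner_comm (Y q)] at h5
  rw [secondFundamentalForm, h3, zero_sub, inner_neg_right, h5]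
  rw [h2] at h1
  linarith

end RiemannianMap

/-! ### Clairaut maps, and the interplay with the Kähler structure -/

section ClairautMap

variable {EM : Type*} [NormedAddCommGroup EM] [NormedSpace ℝ EM] [FiniteDimensional ℝ EM]
  {M : Type*} [TopologicalSpace M] [ChartedSpace EM M] [IsManifold 𝓘(ℝ, EM) ∞ M] [T2Space M]
  [RiemannianBundle (fun x : M => TangentSpace 𝓘(ℝ, EM) x)]
  [IsContMDiffRiemannianBundle 𝓘(ℝ, EM) ∞ EM (fun x : M => TangentSpace 𝓘(ℝ, EM) x)]
  {EN : Type*} [NormedAddCommGroup EN] [NormedSpace ℝ EN] [FiniteDimensional ℝ EN]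
  {N : Type*} [TopologicalSpace N] [ChartedSpace EN N] [IsManifold 𝓘(ℝ, EN) ∞ N] [T2Space N]
  [RiemannianBundle (fun y : N => TangentSpace 𝓘(ℝ, EN) y)]
  [IsContMDiffRiemannianBundle 𝓘(ℝ, EN) ∞ EN (fun y : N => TangentSpace 𝓘(ℝ, EN) y)]
  {F : M → N} {f : N → ℝ} {D₁ D₂ : ∀ q : M, Submodule ℝ (TangentSpace 𝓘(ℝ, EN) (F q))}
  {P : ∀ y : N, TangentSpace 𝓘(ℝ, EN) y →L[ℝ] TangentSpace 𝓘(ℝ, EN) y}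

/-- Clairaut's relation determines the shape form `B x y = ⟨y, ∇_x Z⟩` only on the diagonal, so its
symmetry is needed for polarisation. `R` is not assumed integrable; the symmetry comes from `M`,
where the skew part is `⟨F_* [X, Y], v⟩ = 0` up to sign. -/
theorem IsClairautRiemannianMap.inner_covDerivAlong_pushforward_of_mem_orthogonal
    (hF : IsClairautRiemannianMap (EM := EM) (EN := EN) F (fun y => Real.exp (f y)))
    (hf : ContMDiff 𝓘(ℝ, EN) 𝓘(ℝ, ℝ) ∞ f) {X Y : ∀ q : M, TangentSpace 𝓘(ℝ, EM) q} {q : M}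
    (hX : DiffAlongAt (EA := EM) (fun y : M => y) X q)
    (hY : DiffAlongAt (EA := EM) (fun y : M => y) Y q)
    {v : TangentSpace 𝓘(ℝ, EN) (F q)} (hv : v ∈ (rangeBundle (EM := EM) (EN := EN) F q)ᗮ) :
    (inner ℝ (covDerivAlong (EA := EM) (E := EN) F
        (fun x => pushforward (EM := EM) (EN := EN) F x (Y x)) q (X q)) v : ℝ)
      = -(inner ℝ (pushforward (EM := EM) (EN := EN) F q (X q))
          (pushforward (EM := EM) (EN := EN) F q (Y q)) * dirDeriv f (F q) v) := by
  obtain ⟨U, O, R, hU, hqU, hO, hUO, hR, hRF, hT, hC⟩ := hF.clairaut q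
  obtain ⟨V, hV, hVv⟩ := exists_smooth_extension (F q) v
  have hFs := hF.riemannianMap.smooth
  have hFd : MDifferentiableAt 𝓘(ℝ, EM) 𝓘(ℝ, EN) F q := hFs.mdifferentiableAt (by simp)
  -- A section of `R^⊥` near `F q` with value `v`: the normal part of any extension of `v`.
  set Z : ∀ y : N, TangentSpace 𝓘(ℝ, EN) y := fun y => V y - tangentProj (R y) (V y) with hZ
  have hZs : ∀ y ∈ O, ContDiffAlongAt (EA := EN) ∞ (fun y : N => y) Z y := fun y hy =>
    (hV y).sub (hR.contDiffAlongAt_tangentProj hy (hV y))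
  have hZO : IsSectionOn (fun y => (R y)ᗮ) O Z :=
    ⟨fun y hy => (hZs y hy).contMDiffWithinAt, fun y _ => sub_tangentProj_mem _ _⟩
  have hZq : Z (F q) = v := by
    simp only [hZ]
    rw [hVv, tangentProj_eq_zero (by rw [hRF q hqU]; exact hv), sub_zero]
  have hZd : DiffAlongAt (EA := EN) (fun y : N => y) Z (F q) :=
    (hZs _ (hUO hqU)).diffAlongAt (by simp)
  set B : TangentSpace 𝓘(ℝ, EN) (F q) → TangentSpace 𝓘(ℝ, EN) (F q) → ℝ := fun x y =>
    inner ℝ y (covDerivAlong (EA := EN) (fun y : N => y) Z (F q) x) with hB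
  have hBself : ∀ x ∈ rangeBundle (EM := EM) (EN := EN) F q,
      B x x = dirDeriv f (F q) v * inner ℝ x x := by
    intro x hx
    rw [← hRF q hqU] at hx
    have := hC.inner_covDerivAlong_field hO hR hT hf hZO (hUO hqU) hx
    rwa [hZq] at this
  have hcov : ∀ X Y : ∀ q : M, TangentSpace 𝓘(ℝ, EM) q,
      DiffAlongAt (EA := EM) (fun y : M => y) Y q →
      (inner ℝ (covDerivAlong (EA := EM) (E := EN) F
        (fun x => pushforward (EM := EM) (EN := EN) F x (Y x)) q (X q)) v : ℝ)
      = -B (pushforward (EM := EM) (EN := EN) F q (X q))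
          (pushforward (EM := EM) (EN := EN) F q (Y q)) := by
    intro X Y hY
    have h1 := inner_covDerivAlong_of_eventually_orthogonal (hY.pushforward hFs) (hZd.comp hFd)
      (Filter.eventually_of_mem (hU.mem_nhds hqU) fun x hx => by
        refine Submodule.inner_right_of_mem_orthogonal (K := R (F x)) ?_ (hZO.2 _ (hUO hx))
        rw [hRF x hx]; exact ⟨_, rfl⟩) (X q)
    rw [hZq] at h1
    rw [h1]
    exact congrArg (fun w => -(inner ℝ (pushforward (EM := EM) (EN := EN) F q (Y q)) w : ℝ))
      (covAlong_comp hZd hFd (mem_chart_source EN (F q)) (X q))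
  have hsymm : B (pushforward (EM := EM) (EN := EN) F q (X q))
      (pushforward (EM := EM) (EN := EN) F q (Y q))
      = B (pushforward (EM := EM) (EN := EN) F q (Y q))
      (pushforward (EM := EM) (EN := EN) F q (X q)) := by
    have h1 := covDerivAlong_pushforward_sub hFs hX hY
    have h2 : (inner ℝ (pushforward (EM := EM) (EN := EN) F q
        (VectorField.mlieBracket 𝓘(ℝ, EM) X Y q)) v : ℝ) = 0 :=
      Submodule.inner_right_of_mem_orthogonal
        (K := rangeBundle (EM := EM) (EN := EN) F q) ⟨_, rfl⟩ hv
    rw [← h1, inner_sub_left, hcov X Y hY, hcov Y X hX] at h2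
    linarith
  rw [hcov X Y hY]
  set x := pushforward (EM := EM) (EN := EN) F q (X q) with hx
  set y := pushforward (EM := EM) (EN := EN) F q (Y q) with hy
  have hxr : x ∈ rangeBundle (EM := EM) (EN := EN) F q := ⟨_, rfl⟩
  have hyr : y ∈ rangeBundle (EM := EM) (EN := EN) F q := ⟨_, rfl⟩
  have e1 := hBself x hxr
  have e2 := hBself y hyr
  have e3 := hBself (x + y) (Submodule.add_mem _ hxr hyr)
  have e4 : B (x + y) (x + y) = B x x + B x y + B y x + B y y := by
    have h : covDerivAlong (EA := EN) (fun y : N => y) Z (F q) (x + y)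
        = covDerivAlong (EA := EN) (fun y : N => y) Z (F q) x
          + covDerivAlong (EA := EN) (fun y : N => y) Z (F q) y :=
      covAlong_add_dir (EA := EN) (h := fun y : N => y) (a := F q) (F q) Z x y
    simp only [hB]
    rw [h, inner_add_left, inner_add_right, inner_add_right]
    ring
  have e5 : (inner ℝ (x + y) (x + y) : ℝ) = inner ℝ x x + 2 * inner ℝ x y + inner ℝ y y :=
    real_inner_add_add_self x y
  rw [e5] at e3
  linarith

/-- The fields along `F` with values in the range are umbilical. -/
theorem IsClairautRiemannianMap.inner_covDerivAlong_of_mem_orthogonal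
    (hF : IsClairautRiemannianMap (EM := EM) (EN := EN) F (fun y => Real.exp (f y)))
    (hf : ContMDiff 𝓘(ℝ, EN) 𝓘(ℝ, ℝ) ∞ f) {W : ∀ q : M, TangentSpace 𝓘(ℝ, EN) (F q)} {q : M}
    (hW : ContDiffAlongAt (EA := EM) ∞ F W q)
    (hWr : ∀ᶠ b in 𝓝 q, W b ∈ rangeBundle (EM := EM) (EN := EN) F b) (x : TangentSpace 𝓘(ℝ, EM) q)
    {v : TangentSpace 𝓘(ℝ, EN) (F q)} (hv : v ∈ (rangeBundle (EM := EM) (EN := EN) F q)ᗮ) :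
    (inner ℝ (covDerivAlong (EA := EM) (E := EN) F W q x) v : ℝ)
      = -(inner ℝ (pushforward (EM := EM) (EN := EN) F q x) (W q) * dirDeriv f (F q) v) := by
  obtain ⟨X, hX, rfl⟩ := exists_smooth_extension q x
  have hFR := hF.riemannianMap
  -- As `W` lies in the range near `q`, it is there the pushforward of its horizontal lift, which
  -- brings it under the previous result.
  have hY := contDiffAlongAt_pullVec hFR.smooth hW
  have h1 := hF.inner_covDerivAlong_pushforward_of_mem_orthogonal hf ((hX q).diffAlongAt (by simp))
    (hY.diffAlongAt (by simp)) hv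
  have h2 : covDerivAlong (EA := EM) (E := EN) F (fun x => pushforward (EM := EM) (EN := EN) F x
      (pullVec (EM := EM) (EN := EN) F x (W x))) q (X q)
      = covDerivAlong (EA := EM) (E := EN) F W q (X q) :=
    covAlong_congr (hW.diffAlongAt (by simp)) (mem_chart_source EN (F q))
      (hWr.mono fun b hb => hFR.pushforward_pullVec hb) (X q)
  rwa [h2, hFR.pushforward_pullVec hWr.self_of_nhds] at h1

theorem IsKahler.inner_apply_left (hP : IsKahler P) {y : N} (v w : TangentSpace 𝓘(ℝ, EN) y) :
    (inner ℝ (P y v) w : ℝ) = -inner ℝ v (P y w) := by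
  rw [← hP.isometry y (P y v) w, hP.sq, inner_neg_left]

theorem IsSemiInvariantRiemannianMap.le_range₁
    (hF : IsSemiInvariantRiemannianMap (EM := EM) F P D₁ D₂) (q : M) :
    D₁ q ≤ rangeBundle (EM := EM) (EN := EN) F q := hF.sup_eq q ▸ le_sup_left

theorem IsSemiInvariantRiemannianMap.le_range₂
    (hF : IsSemiInvariantRiemannianMap (EM := EM) F P D₁ D₂) (q : M) :
    D₂ q ≤ rangeBundle (EM := EM) (EN := EN) F q := hF.sup_eq q ▸ le_sup_right

theorem IsSemiInvariantRiemannianMap.apply_mem_orthogonal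
    (hF : IsSemiInvariantRiemannianMap (EM := EM) F P D₁ D₂) {q : M}
    {w : TangentSpace 𝓘(ℝ, EN) (F q)} (hw : w ∈ D₂ q) :
    P (F q) w ∈ (rangeBundle (EM := EM) (EN := EN) F q)ᗮ :=
  hF.antiInvariant q (Submodule.mem_map_of_mem hw)

theorem IsSemiInvariantRiemannianMap.apply_mem
    (hF : IsSemiInvariantRiemannianMap (EM := EM) F P D₁ D₂) {q : M}
    {w : TangentSpace 𝓘(ℝ, EN) (F q)} (hw : w ∈ D₁ q) : P (F q) w ∈ D₁ q :=
  (hF.invariant q).le (Submodule.mem_map_of_mem hw)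

/-- Orthogonality of `D₁` and `D₂` is a consequence, not an assumption: the isometry `P` carries one
into the range and the other into its orthogonal complement. -/
theorem IsSemiInvariantRiemannianMap.inner_eq_zero (hP : IsKahler P)
    (hF : IsSemiInvariantRiemannianMap (EM := EM) F P D₁ D₂) {q : M}
    {v w : TangentSpace 𝓘(ℝ, EN) (F q)} (hv : v ∈ D₁ q) (hw : w ∈ D₂ q) :
    (inner ℝ v w : ℝ) = 0 := by
  rw [← hP.isometry]
  exact Submodule.inner_right_of_mem_orthogonal (hF.le_range₁ q (hF.apply_mem hv))
    (hF.apply_mem_orthogonal hw)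

/-- A linear functional on a space of dimension at least two has a nontrivial kernel. -/
theorem exists_mem_ne_zero_inner_eq_zero {V : Type*} [NormedAddCommGroup V] [InnerProductSpace ℝ V]
    {K : Submodule ℝ V} [FiniteDimensional ℝ K] (hK : 1 < Module.finrank ℝ K) (w : V) :
    ∃ z ∈ K, z ≠ 0 ∧ (inner ℝ w z : ℝ) = 0 := by
  have h := LinearMap.ker_ne_bot_of_finrank_lt (f := ((innerSL ℝ w).toLinearMap ∘ₗ K.subtype))
    (by rwa [Module.finrank_self])
  obtain ⟨z, hz, hz0⟩ := Submodule.exists_mem_ne_zero_of_ne_bot h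
  exact ⟨z, z.2, fun h0 => hz0 (Subtype.ext h0), hz⟩

/-- A smooth section along `F` of a subbundle, with a given value at a point. -/
theorem IsSubbundleAlong.exists_section {D : ∀ q : M, Submodule ℝ (TangentSpace 𝓘(ℝ, EN) (F q))}
    (hD : IsSubbundleAlong (EA := EM) F D univ) (hF : ContMDiff 𝓘(ℝ, EM) 𝓘(ℝ, EN) ∞ F) {q : M}
    {w : TangentSpace 𝓘(ℝ, EN) (F q)} (hw : w ∈ D q) :
    ∃ W : ∀ q : M, TangentSpace 𝓘(ℝ, EN) (F q), (∀ x, ContDiffAlongAt (EA := EM) ∞ F W x) ∧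
      (∀ x, W x ∈ D x) ∧ W q = w := by
  obtain ⟨V, hV, rfl⟩ := exists_smooth_extension (F q) w
  refine ⟨fun x => tangentProj (D x) (V (F x)), fun x => ?_, fun x => tangentProj_mem _ _,
    tangentProj_eq_self hw⟩
  have h1 : ContDiffAlongAt (EA := EM) ∞ F (fun x => V (F x)) x :=
    ContMDiffAt.comp x (hV (F x)) hF.contMDiffAt
  exact hD.contDiffAlongAt_tangentProj (mem_univ x) h1

/-- With `z ∈ D₂` nonzero and orthogonal to `w`, umbilicity gives `⟨∇_z Z, P w⟩ = -|z|² df(P w)`.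
Skewness and parallelism of `P` turn the same number into `⟨P z, ∇_z W⟩`, where umbilicity produces
the factor `⟨z, w⟩ = 0`. -/
theorem IsClairautSemiInvariantRiemannianMap.dirDeriv_apply_eq_zero (hP : IsKahler P)
    (hF : IsClairautSemiInvariantRiemannianMap (EM := EM) F P D₁ D₂ (fun y => Real.exp (f y)))
    (hf : ContMDiff 𝓘(ℝ, EN) 𝓘(ℝ, ℝ) ∞ f) {q : M} (hdim : 1 < Module.finrank ℝ (D₂ q))
    {w : TangentSpace 𝓘(ℝ, EN) (F q)} (hw : w ∈ D₂ q) : dirDeriv f (F q) (P (F q) w) = 0 := by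
  have hS := hF.semiInvariant
  have hFs := hS.riemannianMap.smooth
  obtain ⟨z, hz, hz0, hwz⟩ := exists_mem_ne_zero_inner_eq_zero hdim w
  obtain ⟨W, hW, hWD, rfl⟩ := hS.subbundle₂.exists_section hFs hw
  obtain ⟨Z, hZ, hZD, rfl⟩ := hS.subbundle₂.exists_section hFs hz
  set x := pullVec (EM := EM) (EN := EN) F q (Z q)
  have hx : pushforward (EM := EM) (EN := EN) F q x = Z q :=
    hS.riemannianMap.pushforward_pullVec (hS.le_range₂ q hz)
  have hWd := (hW q).diffAlongAt (by simp)
  have hZd := (hZ q).diffAlongAt (by simp)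
  have e1 := hF.clairaut.inner_covDerivAlong_of_mem_orthogonal hf (hZ q)
    (Filter.Eventually.of_forall fun b => hS.le_range₂ b (hZD b)) x (hS.apply_mem_orthogonal hw)
  have e2 := hF.clairaut.inner_covDerivAlong_of_mem_orthogonal hf (hW q)
    (Filter.Eventually.of_forall fun b => hS.le_range₂ b (hWD b)) x (hS.apply_mem_orthogonal hz)
  have e3 := inner_covDerivAlong_of_eventually_orthogonal hZd
    ((hP.contDiffAlongAt (hW q)).diffAlongAt (by simp)) (Filter.Eventually.of_forall fun b =>
      Submodule.inner_right_of_mem_orthogonal (hS.le_range₂ b (hZD b))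
        (hS.apply_mem_orthogonal (hWD b))) x
  rw [hP.covDerivAlong_apply hWd] at e3
  have e4 := hP.inner_apply_left (Z q) (covDerivAlong (EA := EM) (E := EN) F W q x)
  rw [hx] at e1 e2
  rw [real_inner_comm, real_inner_comm (W q), hwz, zero_mul, neg_zero] at e2
  rw [e1, ← e4, e2, neg_eq_zero] at e3
  exact (mul_eq_zero.1 e3).resolve_left (by simpa using hz0)

/-- Applying `P` to both factors leaves the product unchanged and replaces `W` by `P W`, still a
section of the range, and `w` by the normal vector `P w`. Umbilicity then yields a multiple of `df(P
w) = 0`. -/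
theorem IsClairautSemiInvariantRiemannianMap.inner_covDerivAlong_eq_zero (hP : IsKahler P)
    (hF : IsClairautSemiInvariantRiemannianMap (EM := EM) F P D₁ D₂ (fun y => Real.exp (f y)))
    (hf : ContMDiff 𝓘(ℝ, EN) 𝓘(ℝ, ℝ) ∞ f) {q : M} (hdim : 1 < Module.finrank ℝ (D₂ q))
    {W : ∀ q : M, TangentSpace 𝓘(ℝ, EN) (F q)} (hW : ContDiffAlongAt (EA := EM) ∞ F W q)
    (hWD : ∀ x, W x ∈ D₁ x) (x : TangentSpace 𝓘(ℝ, EM) q)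
    {w : TangentSpace 𝓘(ℝ, EN) (F q)} (hw : w ∈ D₂ q) :
    (inner ℝ (covDerivAlong (EA := EM) (E := EN) F W q x) w : ℝ) = 0 := by
  have hS := hF.semiInvariant
  have e1 := hF.clairaut.inner_covDerivAlong_of_mem_orthogonal hf (hP.contDiffAlongAt hW)
    (Filter.Eventually.of_forall fun b => hS.le_range₁ b (hS.apply_mem (hWD b))) x
    (hS.apply_mem_orthogonal hw)
  rw [hF.dirDeriv_apply_eq_zero hP hf hdim hw, mul_zero, neg_zero,
    hP.covDerivAlong_apply (hW.diffAlongAt (by simp)), hP.isometry] at e1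
  exact e1

end ClairautMap

/-! ### Horizontal lifts as totally geodesic foliations -/

section Foliation

variable {EM : Type*} [NormedAddCommGroup EM] [NormedSpace ℝ EM] [FiniteDimensional ℝ EM]
  {M : Type*} [TopologicalSpace M] [ChartedSpace EM M] [IsManifold 𝓘(ℝ, EM) ∞ M] [T2Space M]
  [RiemannianBundle (fun x : M => TangentSpace 𝓘(ℝ, EM) x)]
  [IsContMDiffRiemannianBundle 𝓘(ℝ, EM) ∞ EM (fun x : M => TangentSpace 𝓘(ℝ, EM) x)]
  {EN : Type*} [NormedAddCommGroup EN] [NormedSpace ℝ EN] [FiniteDimensional ℝ EN]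
  {N : Type*} [TopologicalSpace N] [ChartedSpace EN N] [IsManifold 𝓘(ℝ, EN) ∞ N] [T2Space N]
  [RiemannianBundle (fun y : N => TangentSpace 𝓘(ℝ, EN) y)]
  [IsContMDiffRiemannianBundle 𝓘(ℝ, EN) ∞ EN (fun y : N => TangentSpace 𝓘(ℝ, EN) y)]
  {F : M → N} {D D' : ∀ q : M, Submodule ℝ (TangentSpace 𝓘(ℝ, EN) (F q))}

theorem IsSectionOn.contDiffAlongAt {L : ∀ y : M, Submodule ℝ (TangentSpace 𝓘(ℝ, EM) y)}
    {X : ∀ q : M, TangentSpace 𝓘(ℝ, EM) q} (hX : IsSectionOn L univ X) (q : M) :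
    ContDiffAlongAt (EA := EM) ∞ (fun y : M => y) X q :=
  hX.1.contMDiffAt Filter.univ_mem

theorem isSectionOn_univ {L : ∀ y : M, Submodule ℝ (TangentSpace 𝓘(ℝ, EM) y)}
    {X : ∀ q : M, TangentSpace 𝓘(ℝ, EM) q}
    (hX : ∀ q, ContDiffAlongAt (EA := EM) ∞ (fun y : M => y) X q) (hL : ∀ q, X q ∈ L q) :
    IsSectionOn L univ X :=
  ⟨fun q _ => (hX q).contMDiffWithinAt, fun q _ => hL q⟩

theorem IsRiemannianMap.pullVec_mem_horizontalLift
    (hF : IsRiemannianMap (EM := EM) (EN := EN) F)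
    (hD : ∀ q, D q ≤ rangeBundle (EM := EM) (EN := EN) F q) {q : M}
    {w : TangentSpace 𝓘(ℝ, EN) (F q)} (hw : w ∈ D q) :
    pullVec (EM := EM) (EN := EN) F q w ∈ horizontalLift (EM := EM) F D q := by
  refine ⟨pullVec_mem_horizontal F q w, ?_⟩
  change pushforward (EM := EM) (EN := EN) F q _ ∈ D q
  rwa [hF.pushforward_pullVec (hD q hw)]

theorem IsRiemannianMap.exists_section_horizontalLift
    (hF : IsRiemannianMap (EM := EM) (EN := EN) F) (hDs : IsSubbundleAlong (EA := EM) F D univ)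
    (hD : ∀ q, D q ≤ rangeBundle (EM := EM) (EN := EN) F q) {q : M}
    {w : TangentSpace 𝓘(ℝ, EN) (F q)} (hw : w ∈ D q) :
    ∃ Y : ∀ q : M, TangentSpace 𝓘(ℝ, EM) q, IsSectionOn (horizontalLift (EM := EM) F D) univ Y ∧
      pushforward (EM := EM) (EN := EN) F q (Y q) = w := by
  obtain ⟨W, hW, hWD, rfl⟩ := hDs.exists_section hF.smooth hw
  exact ⟨fun x => pullVec (EM := EM) (EN := EN) F x (W x),
    isSectionOn_univ (fun x => contDiffAlongAt_pullVec hF.smooth (hW x))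
      fun x => hF.pullVec_mem_horizontalLift hD (hWD x), hF.pushforward_pullVec (hD q hw)⟩

/-- The horizontal part of any smooth extension, obtained from the adjoint of `F_*`, is smooth and
vanishes at `q`; subtracting it makes the extension vertical. -/
theorem IsRiemannianMap.exists_section_vertical
    (hF : IsRiemannianMap (EM := EM) (EN := EN) F) {q : M} {u : TangentSpace 𝓘(ℝ, EM) q}
    (hu : u ∈ vertical (EM := EM) (EN := EN) F q) :
    ∃ U : ∀ q : M, TangentSpace 𝓘(ℝ, EM) q,
      IsSectionOn (vertical (EM := EM) (EN := EN) F) univ U ∧ U q = u := by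
  obtain ⟨X, hX, rfl⟩ := exists_smooth_extension q u
  refine ⟨fun x => X x - pullVec (EM := EM) (EN := EN) F x (pushforward (EM := EM) (EN := EN) F x (X x)),
    isSectionOn_univ (fun x => (hX x).sub (contDiffAlongAt_pullVec hF.smooth ((hX x).pushforward hF.smooth)))
      fun x => hF.sub_pullVec_pushforward_mem (X x), ?_⟩
  have hu' : pushforward (EM := EM) (EN := EN) F q (X q) = 0 := hu
  have h0 : pullVec (EM := EM) (EN := EN) F q 0 = 0 := map_zero _
  simp only
  rw [hu', h0, sub_zero]

theorem IsRiemannianMap.isSubbundleAlong_horizontalLift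
    (hF : IsRiemannianMap (EM := EM) (EN := EN) F) (hDs : IsSubbundleAlong (EA := EM) F D univ)
    (hD : ∀ q, D q ≤ rangeBundle (EM := EM) (EN := EN) F q) :
    IsSubbundleAlong (EA := EM) (A := M) (fun y => y) (horizontalLift (EM := EM) F D) univ := by
  intro q hq
  obtain ⟨V, hV, hqV, k, s, hs, hsD⟩ := hDs q hq
  refine ⟨V, hV, hqV, k, fun i x => pullVec (EM := EM) (EN := EN) F x (s i x), fun i x hx => ?_,
    fun b hb => ⟨?_, ?_⟩⟩
  · exact (contDiffAlongAt_pullVec hF.smooth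
      ((hs i).contMDiffAt (hV.mem_nhds hx))).contMDiffWithinAt
  · refine LinearIndependent.of_comp (pushforward (EM := EM) (EN := EN) F b) ?_
    have h1 : (pushforward (EM := EM) (EN := EN) F b ∘ fun i => pullVec (EM := EM) (EN := EN) F b (s i b))
        = fun i => s i b := funext fun i => hF.pushforward_pullVec (hD b (by
      rw [← (hsD b hb).2]; exact Submodule.subset_span ⟨i, rfl⟩))
    rw [h1]
    exact (hsD b hb).1
  · have h1 : (range fun i => pullVec (EM := EM) (EN := EN) F b (s i b))
        = LinearMap.adjoint (pushforward (EM := EM) (EN := EN) F b) '' range fun i => s i b :=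
      range_comp (LinearMap.adjoint (pushforward (EM := EM) (EN := EN) F b)) _
    rw [h1, ← Submodule.map_span, (hsD b hb).2]
    refine le_antisymm ?_ fun v hv => ?_
    · rintro _ ⟨w, hw, rfl⟩
      exact hF.pullVec_mem_horizontalLift hD hw
    · exact ⟨_, hv.2, hF.pullVec_pushforward hv.1⟩

/-- By `hpar` the derivative `∇_X Y` of sections of the lift of `D` has no component in the lift of
`D'`, so only its vertical component can obstruct. That component is measured by the second
fundamental form through `key`. -/
theorem IsRiemannianMap.isTotallyGeodesicFoliation_horizontalLift_iff
    (hF : IsRiemannianMap (EM := EM) (EN := EN) F) (hDs : IsSubbundleAlong (EA := EM) F D univ)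
    (hDs' : IsSubbundleAlong (EA := EM) F D' univ)
    (hsup : ∀ q, D q ⊔ D' q = rangeBundle (EM := EM) (EN := EN) F q)
    (hperp : ∀ q, ∀ v ∈ D q, ∀ w ∈ D' q, (inner ℝ v w : ℝ) = 0)
    (hpar : ∀ W : ∀ q : M, TangentSpace 𝓘(ℝ, EN) (F q),
      (∀ x, ContDiffAlongAt (EA := EM) ∞ F W x) → (∀ x, W x ∈ D x) →
      ∀ (q : M) (x : TangentSpace 𝓘(ℝ, EM) q), ∀ w ∈ D' q,
        (inner ℝ (covDerivAlong (EA := EM) (E := EN) F W q x) w : ℝ) = 0) :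
    IsTotallyGeodesicFoliation (horizontalLift (EM := EM) F D) ↔
      ∀ X U : ∀ q : M, TangentSpace 𝓘(ℝ, EM) q,
        IsSectionOn (horizontalLift (EM := EM) F D) univ X →
        IsSectionOn (vertical (EM := EM) (EN := EN) F) univ U →
        ∀ q, secondFundamentalForm (EN := EN) F X U q ∈ (D q)ᗮ := by
  have hD : ∀ q, D q ≤ rangeBundle (EM := EM) (EN := EN) F q := fun q => hsup q ▸ le_sup_left
  have hD' : ∀ q, D' q ≤ rangeBundle (EM := EM) (EN := EN) F q := fun q => hsup q ▸ le_sup_right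
  have key : ∀ X Y U : ∀ q : M, TangentSpace 𝓘(ℝ, EM) q,
      IsSectionOn (horizontalLift (EM := EM) F D) univ Y →
      IsSectionOn (vertical (EM := EM) (EN := EN) F) univ U → ∀ q,
      (inner ℝ (leviCivita X Y q) (U q) : ℝ)
        = inner ℝ (pushforward (EM := EM) (EN := EN) F q (Y q))
          (secondFundamentalForm (EN := EN) F X U q) := fun X Y U hY hU q =>
    hF.inner_leviCivita_vertical ((hY.contDiffAlongAt q).diffAlongAt (by simp))
      ((hU.contDiffAlongAt q).diffAlongAt (by simp)) (fun x => (hY.2 x trivial).1)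
      fun x => hU.2 x trivial
  constructor
  · intro h X U hX hU q
    refine (Submodule.mem_orthogonal _ _).2 fun d hd => ?_
    obtain ⟨Y, hY, rfl⟩ := hF.exists_section_horizontalLift hDs hD hd
    rw [← key X Y U hY hU q]
    exact Submodule.inner_left_of_mem_orthogonal (hU.2 q trivial)
      (h.totallyGeodesic X Y hX hY q trivial).1
  · intro h
    have hT : IsTotallyGeodesicOn (horizontalLift (EM := EM) F D) univ := by
      intro X Y hX hY q _
      have hXd := (hX.contDiffAlongAt q).diffAlongAt (by simp)
      have hYd := (hY.contDiffAlongAt q).diffAlongAt (by simp)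
      refine ⟨(Submodule.mem_orthogonal' _ _).2 fun u hu => ?_, ?_⟩
      · obtain ⟨U, hU, rfl⟩ := hF.exists_section_vertical hu
        rw [key X Y U hY hU q]
        exact Submodule.inner_right_of_mem_orthogonal (hY.2 q trivial).2 (h X U hX hU q)
      · change pushforward (EM := EM) (EN := EN) F q (leviCivita X Y q) ∈ D q
        have hr : pushforward (EM := EM) (EN := EN) F q (leviCivita X Y q)
            ∈ rangeBundle (EM := EM) (EN := EN) F q := ⟨_, rfl⟩
        rw [← hsup q] at hr
        -- The `D'`-part `d'` of `F_* (∇_X Y)` is tested against itself: with a horizontal `Z` such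
        -- that `F_* Z = d'`, both `⟨∇_X Y, Z⟩ = 0` and `⟨F_* (∇_X Y), d'⟩ = |d'|²` hold.
        obtain ⟨d, hd, d', hd', hdd⟩ := Submodule.mem_sup.1 hr
        obtain ⟨Z, hZ, hZq⟩ := hF.exists_section_horizontalLift hDs' hD' hd'
        have e1 := hF.inner_covDerivAlong_pushforward hXd hYd
          ((hZ.contDiffAlongAt q).diffAlongAt (by simp)) (fun x => (hX.2 x trivial).1)
          (fun x => (hY.2 x trivial).1) fun x => (hZ.2 x trivial).1
        have e2 := hpar (fun x => pushforward (EM := EM) (EN := EN) F x (Y x))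
          (fun x => (hY.contDiffAlongAt x).pushforward hF.smooth) (fun x => (hY.2 x trivial).2) q (X q)
          d' hd'
        have e3 := hF.inner_eq (hZ.2 q trivial).1 (leviCivita X Y q)
        rw [← e1, hZq, e2, ← hdd, inner_add_left, hperp q d hd d' hd', zero_add] at e3
        rw [← hdd, (inner_self_eq_zero (𝕜 := ℝ)).1 e3, add_zero]
        exact hd
    refine ⟨hF.isSubbundleAlong_horizontalLift hDs hD, fun X Y hX hY q => ?_, hT⟩
    -- Involutivity is automatic: the bracket is `∇_X Y - ∇_Y X`.
    rw [← leviCivita_sub ((hX.contDiffAlongAt q).diffAlongAt (by simp))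
      ((hY.contDiffAlongAt q).diffAlongAt (by simp))]
    exact Submodule.sub_mem _ (hT X Y hX hY q trivial) (hT Y X hY hX q trivial)

theorem IsRiemannianMap.horizontalLift_inf_eq_bot (hinf : ∀ q, D q ⊓ D' q = ⊥) (q : M) :
    horizontalLift (EM := EM) F D q ⊓ horizontalLift (EM := EM) F D' q = ⊥ := by
  refine (Submodule.eq_bot_iff _).2 fun v hv => ?_
  have h1 : pushforward (EM := EM) (EN := EN) F q v ∈ D q ⊓ D' q := ⟨hv.1.2, hv.2.2⟩
  rw [hinf q] at h1
  have h2 : v ∈ vertical (EM := EM) (EN := EN) F q := h1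
  exact (inner_self_eq_zero (𝕜 := ℝ)).1 (Submodule.inner_right_of_mem_orthogonal h2 hv.1.1)

theorem IsRiemannianMap.horizontalLift_sup_eq (hF : IsRiemannianMap (EM := EM) (EN := EN) F)
    (hsup : ∀ q, D q ⊔ D' q = rangeBundle (EM := EM) (EN := EN) F q) (q : M) :
    horizontalLift (EM := EM) F D q ⊔ horizontalLift (EM := EM) F D' q
      = horizontal (EM := EM) (EN := EN) F q := by
  refine le_antisymm (sup_le inf_le_left inf_le_left) fun v hv => ?_
  have hr : pushforward (EM := EM) (EN := EN) F q v ∈ rangeBundle (EM := EM) (EN := EN) F q := ⟨_, rfl⟩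
  rw [← hsup q] at hr
  obtain ⟨d, hd, d', hd', hdd⟩ := Submodule.mem_sup.1 hr
  refine Submodule.mem_sup.2 ⟨_, hF.pullVec_mem_horizontalLift (fun q => hsup q ▸ le_sup_left) hd, _,
    hF.pullVec_mem_horizontalLift (fun q => hsup q ▸ le_sup_right) hd', ?_⟩
  rw [← hF.pullVec_pushforward hv, ← hdd]
  exact (map_add (LinearMap.adjoint (pushforward (EM := EM) (EN := EN) F q)) d d').symm

end Foliation

end

/-! ### The main theorem -/

theorem mainTheorem4
    {EM : Type*} [NormedAddCommGroup EM] [NormedSpace ℝ EM] [FiniteDimensional ℝ EM]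
    {M : Type*} [TopologicalSpace M] [ChartedSpace EM M] [IsManifold 𝓘(ℝ, EM) ∞ M]
    [T2Space M] [SecondCountableTopology M]
    [RiemannianBundle (fun x : M => TangentSpace 𝓘(ℝ, EM) x)]
    [IsContMDiffRiemannianBundle 𝓘(ℝ, EM) ∞ EM (fun x : M => TangentSpace 𝓘(ℝ, EM) x)]
    {EN : Type*} [NormedAddCommGroup EN] [NormedSpace ℝ EN] [FiniteDimensional ℝ EN]
    {N : Type*} [TopologicalSpace N] [ChartedSpace EN N] [IsManifold 𝓘(ℝ, EN) ∞ N]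
    [T2Space N] [SecondCountableTopology N]
    [RiemannianBundle (fun y : N => TangentSpace 𝓘(ℝ, EN) y)]
    [IsContMDiffRiemannianBundle 𝓘(ℝ, EN) ∞ EN (fun y : N => TangentSpace 𝓘(ℝ, EN) y)]
    (P : ∀ y : N, TangentSpace 𝓘(ℝ, EN) y →L[ℝ] TangentSpace 𝓘(ℝ, EN) y)
    (hP : IsKahler P)
    (F : M → N) (D₁ D₂ : ∀ q : M, Submodule ℝ (TangentSpace 𝓘(ℝ, EN) (F q)))
    (f : N → ℝ) (hf : ContMDiff 𝓘(ℝ, EN) 𝓘(ℝ, ℝ) ∞ f)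
    (hF : IsClairautSemiInvariantRiemannianMap (EM := EM) F P D₁ D₂ (fun y => Real.exp (f y)))
    (hdim : ∀ q, 1 < Module.finrank ℝ (D₂ q)) :
    IsLocallyProductOf (horizontal (EM := EM) (EN := EN) F)
        (horizontalLift (EM := EM) F D₁) (horizontalLift (EM := EM) F D₂) ↔
      (∀ X U : ∀ q : M, TangentSpace 𝓘(ℝ, EM) q,
        IsSectionOn (horizontalLift (EM := EM) F D₁) univ X →
        IsSectionOn (vertical (EM := EM) (EN := EN) F) univ U →
        ∀ q, secondFundamentalForm (EN := EN) F X U q ∈ (D₁ q)ᗮ) ∧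
      (∀ X₂ U : ∀ q : M, TangentSpace 𝓘(ℝ, EM) q,
        IsSectionOn (horizontalLift (EM := EM) F D₂) univ X₂ →
        IsSectionOn (vertical (EM := EM) (EN := EN) F) univ U →
        ∀ q, secondFundamentalForm (EN := EN) F X₂ U q ∈ (D₂ q)ᗮ) := by
  have hS := hF.semiInvariant
  have hR := hS.riemannianMap
  have hperp : ∀ q, ∀ v ∈ D₁ q, ∀ w ∈ D₂ q, (inner ℝ v w : ℝ) = 0 := fun q v hv w hw =>
    hS.inner_eq_zero hP hv hw
  have hsup' : ∀ q, D₂ q ⊔ D₁ q = rangeBundle (EM := EM) (EN := EN) F q := fun q =>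
    (sup_comm _ _).trans (hS.sup_eq q)
  have h₁ := hR.isTotallyGeodesicFoliation_horizontalLift_iff hS.subbundle₁ hS.subbundle₂ hS.sup_eq
    hperp fun W hW hWD q x w hw => hF.inner_covDerivAlong_eq_zero hP hf (hdim q) (hW q) hWD x hw
  have h₂ := hR.isTotallyGeodesicFoliation_horizontalLift_iff hS.subbundle₂ hS.subbundle₁ hsup'
    (fun q v hv w hw => (real_inner_comm _ _).trans (hperp q w hw v hv))
    fun W hW hWD q x w hw => by
      -- For `D₂` the property follows from that of `D₁`: differentiating `⟨W, Z⟩ = 0`, with `Z` a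
      -- section of `D₁`, moves the derivative onto `Z`.
      obtain ⟨Z, hZ, hZD, rfl⟩ := hS.subbundle₁.exists_section hR.smooth hw
      rw [inner_covDerivAlong_of_eventually_orthogonal ((hW q).diffAlongAt (by simp))
        ((hZ q).diffAlongAt (by simp)) (Filter.Eventually.of_forall fun b =>
          (real_inner_comm _ _).trans (hperp b _ (hZD b) _ (hWD b))) x, real_inner_comm,
        hF.inner_covDerivAlong_eq_zero hP hf (hdim q) (hZ q) hZD x (hWD q), neg_zero]
  rw [← h₁, ← h₂]
  -- The direct sum decomposition of the horizontal space holds in any case, so only the two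
  -- foliation conditions matter.
  exact ⟨fun h => ⟨h.foliation₁, h.foliation₂⟩, fun h =>
    ⟨IsRiemannianMap.horizontalLift_inf_eq_bot hS.inf_eq_bot, hR.horizontalLift_sup_eq hS.sup_eq,
      h.1, h.2⟩⟩
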